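/- **Setting.** Let $D\subset\mathbb R^2$ be a polygonal domain with a conforming fine mesh $\mathcal T^h$ of closed simple polygons $E$ (angles equal to $\pi$ at a vertex are allowed). The mesh is shape-regular with parameter $\gamma>0$: each $E$ is star-shaped with respect to every point of a ball of radius $\gamma\,\mathrm{diam}(E)$, and any two vertices of $E$ have distance at least $\gamma\,\mathrm{diam}(E)$. Let $\kappa>0$ be constant on each fine element. For $k\ge 1$, let $$V_k(E)=\{v\in H^1(E):\ v|_{\partial E}\in C^0(\partial E),\ v|_e\in\mathcal P_k(e)\ \text{for every edge } e,\ \Delta v\in\mathcal P_{k-2}(E)\},\qquad \mathcal P_{-1}=\{0\},$$ with degrees of freedom the values at the vertices, the values at the $k-1$ interior Gauss–Lobatto nodes of each edge, and the moments against $\mathcal P_{k-2}(E)$ (for $k=1$: the vertex values only; then $V_1(E)$ is the space of affine functions on a triangle and of bilinear functions on a square). For a union $\omega$ of fine elements, $V^h(\omega)$ is the space of continuous functions on $\overline\omega$ whose restriction to each fine element $E\subset\overline\omega$ is in $V_k(E)$, and $V^h_0(D)=V^h(D)\cap H^1_0(D)$. $I^h z\in V^h(D)$ is the interpolant of $z$,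 i.e. the member of $V^h(D)$ having the degrees of freedom of $z$. Let the coarse elements $K$ be a partition of the fine elements into blocks (of arbitrary shape), with coarse vertices $y_1,\dots,y_{N_c}$, which are vertices of the fine mesh. Let $\omega_i$ be the union of the coarse elements whose closure contains $y_i$, and $\omega_K=\bigcup_{y_i\in \overline K}\omega_i$. Let $H>0$ (the coarse mesh size) and let $\chi_i\in V^h(D)$ be a partition of unity subordinated to $\{\omega_i\}$: $\chi_i\ge 0$, $\sum_i\chi_i=1$ on $\overline D$, $\chi_i=0$ outside $\overline{\omega_i}$, and $|\nabla\chi_i|\le C_\chi/H$ inside each fine element. Let $\widetilde V^h(\omega_i)=\{v\in V^h(\omega_i): v=0 \text{ on }\partial\omega_i\cap\partial D\}$, and let $\psi^{\omega_i}_1,\dots,\psi^{\omega_i}_{n_i}$ be a basis of $\widetilde V^h(\omega_i)$ of eigenfunctions, $$\int_{\omega_i}\kappa\nabla\psi^{\omega_i}_\ell\cdot\nabla w=\lambda^{\omega_i}_\ell\int_{\omega_i}\kappa\,\psi^{\omega_i}_\ell w\quad\text{for all } w\in\widetilde V^h(\omega_i),\qquad \lambda_1^{\omega_i}\le\dots\le\lambda_{n_i}^{\omega_i},$$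 orthonormal with respect to $\int_{\omega_i}\kappa uw$. For integers $L_i\ge 0$ put $$I^{\omega_i}_{L_i}v=\sum_{\ell\le L_i}\Big(\int_{\omega_i}\kappa v\psi_\ell^{\omega_i}\Big)\psi^{\omega_i}_\ell,\qquad I_0v=\sum_{i=1}^{N_c} I^h\big(\chi_i\,I^{\omega_i}_{L_i}v\big).$$ **Statement.** For all $k\ge1$, $\gamma>0$, $m\in\mathbb N$ and $C_\chi$ there is a constant $C>0$, depending only on $k,\gamma,m,C_\chi$ (in particular not on $\kappa$ or its contrast, on $D$, $h$, $H$, on the shape of the coarse elements, on the $L_i$, or on $v$), such that the following holds in the above setting. Let $K$ be a coarse element with at most $m$ coarse vertices, suppose that $L_i<n_i$ for each $y_i\in\overline K$, and that $\lambda_{K,L+1}:=\min_{y_i\in \overline K}\lambda^{\omega_i}_{L_i+1}>0$. Then for all $v\in V^h_0(D)$ $$\int_K\kappa\,(v-I_0v)^2\le \frac{C}{\lambda_{K,L+1}}\int_{\omega_K}\kappa|\nabla v|^2,$$ $$\int_K\kappa\,|\nabla I_0v|^2\le C\max\Big\{1,\frac1{H^2\lambda_{K,L+1}}\Big\}\int_{\omega_K}\kappa|\nabla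 v|^2 .$$ -/

import Mathlib

open MeasureTheory Polynomial
open scoped BigOperators

noncomputable section

namespace SpectralCoarse

/-- The Euclidean plane. -/
abbrev Plane : Type := EuclideanSpace ℝ (Fin 2)

/-! ### Polygonal elements and the local virtual element space -/

/-- A closed polygonal element: the compact region `carrier` enclosed by a simple closed polygonal
curve. Angles equal to `π` at a vertex are allowed (hanging nodes). -/
structure Element where
  n : ℕ
  three_le : 3 ≤ n
  poly : Polygon Plane n
  vertices_injective : Function.Injective poly.vertices
  /-- two different edges can only meet in an endpoint -/
  edges_simple : ∀ a b : Fin n, a ≠ b → ∀ x ∈ poly.edgeSet ℝ a ∩ poly.edgeSet ℝ b,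
    x = poly a ∨ x = poly (finRotate n a)
  carrier : Set Plane
  isCompact_carrier : IsCompact carrier
  closure_interior : closure (interior carrier) = carrier
  frontier_carrier : frontier carrier = poly.boundary ℝ

/-- The usual shape-regularity of polygonal meshes, with parameter `γ`: the element is star-shaped
with respect to every point of a ball of radius `γ * diam`, and any two of its vertices have
distance at least `γ * diam`. -/
def Element.IsShapeRegular (T : Element) (γ : ℝ) : Prop :=
  (∃ c : Plane, Metric.closedBall c (γ * Metric.diam T.carrier) ⊆ T.carrier ∧
    ∀ y ∈ Metric.closedBall c (γ * Metric.diam T.carrier), StarConvex ℝ y T.carrier) ∧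
  ∀ a b : Fin T.n, a ≠ b → γ * Metric.diam T.carrier ≤ dist (T.poly a) (T.poly b)

/-- `p` belongs to `P_{k-2}`, the polynomials in two variables of total degree at most `k - 2`;
for `k = 1` this is the zero space. -/
def IsMomentPoly (k : ℕ) (p : MvPolynomial (Fin 2) ℝ) : Prop :=
  p = 0 ∨ p.totalDegree + 2 ≤ k

/-- The local virtual element space `V_k(T)`: functions in `H¹(T)`, continuous and a polynomial of
degree at most `k` on each edge of the boundary, with Laplacian in `P_{k-2}(T)`.
By regularity such functions are `C²` inside `T` and continuous up to the boundary, so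
the conditions are stated classically. For `k = 1` this is the space of affine functions on a
triangle and of bilinear functions on a square. -/
def Element.localSpace (k : ℕ) (T : Element) : Set (Plane → ℝ) :=
  {v | ContinuousOn v T.carrier ∧
    ContDiffOn ℝ 2 v (interior T.carrier) ∧
    IntegrableOn (fun x => ‖gradient v x‖ ^ 2) (interior T.carrier) ∧
    (∃ p : MvPolynomial (Fin 2) ℝ, IsMomentPoly k p ∧
      ∀ x ∈ interior T.carrier, Laplacian.laplacian v x = MvPolynomial.eval (fun i => x i) p) ∧
    ∀ a : Fin T.n, ∃ q : ℝ[X], q.natDegree ≤ k ∧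
      ∀ t ∈ Set.Icc (0 : ℝ) 1, v (T.poly.edgePath ℝ a t) = q.eval t}

/-- `z` and `w` have the same degrees of freedom of degree `k` on `T`: the values at the vertices,
the values at the `k - 1` interior Gauss-Lobatto nodes of every edge (the zeros of the
derivative of the Legendre polynomial of degree `k`, transplanted to `[0,1]`), and the moments
against `P_{k-2}`. For `k = 1` these are just the nodal values at the vertices. -/
def Element.SameDofs (k : ℕ) (T : Element) (z w : Plane → ℝ) : Prop :=
  (∀ a : Fin T.n, w (T.poly a) = z (T.poly a)) ∧
  (∀ a : Fin T.n, ∀ t ∈ Set.Ioo (0 : ℝ) 1, aeval t (derivative (shiftedLegendre k)) = 0 →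
    w (T.poly.edgePath ℝ a t) = z (T.poly.edgePath ℝ a t)) ∧
  ∀ p : MvPolynomial (Fin 2) ℝ, IsMomentPoly k p →
    ∫ x in T.carrier, w x * MvPolynomial.eval (fun i => x i) p =
      ∫ x in T.carrier, z x * MvPolynomial.eval (fun i => x i) p

/-! ### The fine mesh and the global spaces -/

/-- A conforming fine mesh of finitely many polygonal elements. -/
structure FineMesh where
  num : ℕ
  elem : Fin num → Element
  nonoverlapping : ∀ i j, i ≠ j →
    Disjoint (interior (elem i).carrier) (interior (elem j).carrier)
  /-- a common point of two elements is a common vertex or lies on a common edge -/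
  conforming : ∀ i j, i ≠ j → ∀ x ∈ (elem i).carrier ∩ (elem j).carrier,
    (∃ a b, (elem i).poly a = x ∧ (elem j).poly b = x) ∨
    (∃ a b, x ∈ (elem i).poly.edgeSet ℝ a ∧
      (elem i).poly.edgeSet ℝ a = (elem j).poly.edgeSet ℝ b)

namespace FineMesh

variable (M : FineMesh)

/-- The closed region covered by a set of fine elements. -/
def region (S : Set (Fin M.num)) : Set Plane := ⋃ j ∈ S, (M.elem j).carrier

/-- The closure of the computational domain `D`. -/
def closedDomain : Set Plane := M.region Set.univ

/-- The space `V^h` of degree `k` on the region covered by `S`. Its members are taken to vanish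
outside of the closed region, so that they are determined by their values there. -/
def space (k : ℕ) (S : Set (Fin M.num)) : Set (Plane → ℝ) :=
  {v | ContinuousOn v (M.region S) ∧ (∀ x, x ∉ M.region S → v x = 0) ∧
    ∀ j ∈ S, v ∈ (M.elem j).localSpace k}

/-- The members of `V^h` on the region covered by `S` which vanish on the part of the region that
lies on `∂D`. For a region not touching `∂D` this is all of `V^h`; for `S = univ` it is
`V^h(D) ∩ H¹₀(D)`. -/
def space₀ (k : ℕ) (S : Set (Fin M.num)) : Set (Plane → ℝ) :=
  {v | v ∈ M.space k S ∧ ∀ x ∈ M.region S ∩ frontier M.closedDomain, v x = 0}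

/-- `w = I^h z`: `w` is the member of `V^h(D)` with the degrees of freedom of `z`. -/
def IsInterpolant (k : ℕ) (z w : Plane → ℝ) : Prop :=
  w ∈ M.space k Set.univ ∧ ∀ j, (M.elem j).SameDofs k z w

/-- The coefficient is positive and constant on (the interior of) every fine element. -/
def IsCoefficient (κ : Plane → ℝ) : Prop :=
  ∀ j, ∃ c : ℝ, 0 < c ∧ ∀ x ∈ interior (M.elem j).carrier, κ x = c

end FineMesh

/-! ### The local generalized eigenvalue problem -/

/-- The form `∫_R κ ∇u · ∇w`. -/
def energyForm (κ : Plane → ℝ) (R : Set Plane) (u w : Plane → ℝ) : ℝ :=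
  ∫ x in R, κ x * inner ℝ (gradient u x) (gradient w x)

/-- The form `∫_R κ u w`. -/
def massForm (κ : Plane → ℝ) (R : Set Plane) (u w : Plane → ℝ) : ℝ :=
  ∫ x in R, κ x * (u x * w x)

/-- A complete system `ψ_1, …, ψ_n` of mass-orthonormal eigenfunctions, in the discrete space `W`
over the region `R`, of the generalized eigenvalue problem `A ψ = λ M ψ`, ordered such that
`λ_1 ≤ … ≤ λ_n`. (Indices in Lean start from `0`.) -/
structure Eigenbasis (κ : Plane → ℝ) (R : Set Plane) (W : Set (Plane → ℝ)) where
  n : ℕ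
  psi : Fin n → Plane → ℝ
  lam : Fin n → ℝ
  mem : ∀ l, psi l ∈ W
  orthonormal : ∀ l m, massForm κ R (psi l) (psi m) = if l = m then 1 else 0
  eigen : ∀ l, ∀ w ∈ W, energyForm κ R (psi l) w = lam l * massForm κ R (psi l) w
  ordered : Monotone lam
  complete : ∀ w ∈ W, w ∈ Submodule.span ℝ (Set.range psi)

/-- The truncated expansion `I_L v = ∑_{l ≤ L} (∫_R κ v ψ_l) ψ_l`. -/
def Eigenbasis.trunc {κ : Plane → ℝ} {R : Set Plane} {W : Set (Plane → ℝ)}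
    (B : Eigenbasis κ R W) (L : ℕ) (v : Plane → ℝ) : Plane → ℝ :=
  ∑ l : Fin B.n with l.val < L, massForm κ R v (B.psi l) • B.psi l

/-! ### The coarse mesh, the partition of unity and the coarse interpolation -/

/-- A coarse partition: every coarse element is a union of fine elements (`block j` is the coarse
element which contains the fine element `j`), with finitely many coarse vertices `y`. The coarse
elements may be arbitrarily irregular. -/
structure CoarseMesh (M : FineMesh) where
  num : ℕ
  block : Fin M.num → Fin num
  block_surjective : Function.Surjective block
  numVert : ℕ
  y : Fin numVert → Plane
  y_injective : Function.Injective y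
  y_mem : ∀ i, ∃ j a, y i = (M.elem j).poly a

namespace CoarseMesh

variable {M : FineMesh} (T : CoarseMesh M)

/-- The fine elements of the coarse element `K`. -/
def elems (K : Fin T.num) : Set (Fin M.num) := {j | T.block j = K}

/-- The closed coarse element. -/
def region (K : Fin T.num) : Set Plane := M.region (T.elems K)

/-- The fine elements of `ω_i`, the union of the coarse elements whose closure contains `y_i`. -/
def nbhdElems (i : Fin T.numVert) : Set (Fin M.num) := {j | T.y i ∈ T.region (T.block j)}

/-- The (closed) vertex neighborhood `ω_i`. -/
def nbhd (i : Fin T.numVert) : Set Plane := M.region (T.nbhdElems i)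

/-- The (closed) neighborhood `ω_K`: the union of the `ω_i` over the vertices `y_i` of `K`. -/
def elemNbhd (K : Fin T.num) : Set Plane := ⋃ i ∈ {i | T.y i ∈ T.region K}, T.nbhd i

/-- A partition of unity in `V^h(D)` subordinated to the covering by the `ω_i`, with gradients
bounded by `Cχ / H`. -/
structure IsPartitionOfUnity (k : ℕ) (Cχ H : ℝ) (χ : Fin T.numVert → Plane → ℝ) : Prop where
  mem : ∀ i, χ i ∈ M.space k Set.univ
  nonneg : ∀ i, ∀ x ∈ M.closedDomain, 0 ≤ χ i x
  sum_eq_one : ∀ x ∈ M.closedDomain, ∑ i, χ i x = 1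
  support : ∀ i, ∀ x, x ∉ T.nbhd i → χ i x = 0
  gradient_le : ∀ i j, ∀ x ∈ interior (M.elem j).carrier, ‖gradient (χ i) x‖ ≤ Cχ / H

/-- A choice, for every coarse vertex, of a complete eigensystem of the local eigenvalue problem
on `ω_i` (Neumann conditions, combined with Dirichlet conditions on `∂D`). -/
abbrev LocalEigenbases (k : ℕ) (κ : Plane → ℝ) : Type :=
  (i : Fin T.numVert) → Eigenbasis κ (T.nbhd i) (M.space₀ k (T.nbhdElems i))

variable {k : ℕ} {κ : Plane → ℝ}

/-- `u = I_0 v = ∑_i I^h (χ_i I^{ω_i}_{L_i} v)`. -/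
def IsCoarseInterpolant (χ : Fin T.numVert → Plane → ℝ) (B : T.LocalEigenbases k κ)
    (L : Fin T.numVert → ℕ) (v u : Plane → ℝ) : Prop :=
  ∃ w : Fin T.numVert → Plane → ℝ,
    (∀ i, M.IsInterpolant k (χ i * (B i).trunc (L i) v) (w i)) ∧ u = ∑ i, w i

/-- `λ_{K,L+1}`: the minimum over the vertices `y_i` of `K` of the first non-selected eigenvalue
`λ^{ω_i}_{L_i+1}`, which is entry number `L i` when counting from `0`. -/
def nextEigenvalue (B : T.LocalEigenbases k κ) (L : Fin T.numVert → ℕ) (K : Fin T.num)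
    (hL : ∀ i, T.y i ∈ T.region K → L i < (B i).n) : ℝ :=
  ⨅ i : {i // T.y i ∈ T.region K}, (B i.1).lam ⟨L i.1, hL i.1 i.2⟩

end CoarseMesh

end SpectralCoarse

end

open MeasureTheory Polynomial
open scoped BigOperators

namespace SpectralCoarse

open Set Filter Topology Metric
open scoped NNReal ENNReal

/-! ### Compact sets that are star-shaped with respect to a ball -/

/-! Let `e_i` be the error of the truncated eigenfunction expansion of `v` on `ω_i`. Since `v = ∑
χ_i v` is its own interpolant and interpolation is linear, on every fine element of `K` the function
`v - I_0 v` is the interpolant of `∑ χ_i e_i`, summed over the coarse vertices of `K`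
(`IsCoarseInterpolant.sameDofs`). Parseval in the eigenbasis gives `∫ κ e_i² ≤ λ⁻¹ ∫ κ |∇v|²` and `∫
κ |∇e_i|² ≤ ∫ κ |∇v|²` on `ω_i` (`truncation_bounds`). It remains to bound the interpolant `z` of `∑
χ_i w_i` on one fine element. There `κ` is a constant, so weighting with `κ` and summing over the
elements brings in no contrast.

The two elementwise bounds are `‖z‖² ≤ C ∑ ‖w_i‖²` in `L²`, together with an inverse estimate
(`exists_interpolant_bound`), and `‖∇z‖² ≤ C ∑ (‖∇w_i‖² + R² ‖w_i‖²)` when `|∇χ_i| ≤ R`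
(`exists_interpolant_energy_bound`). The second follows from the first by subtracting means `a_i`
from `w_i`: interpolation reproduces `∑ a_i χ_i`, and the Poincaré inequality controls `w_i - a_i`.
The choice `R = Cχ / H` produces the term `1 / (H² λ)`.

Polygons have no common reference element, so the constants are derived directly from
star-shapedness with respect to a ball. A function `z` in `V_k` solves `Δz = p` with a polynomial
`p` and piecewise polynomial boundary values. These values extend to a Lipschitz function `g`, by
means of the radial retraction onto the boundary (`exists_lipschitz_extension`). Green's formula
tested with `z - g`, truncated at a small level so that its support is compact, bounds the energy by
the Lipschitz constant of `g` and `∫ p (z - g)` (`energy_le`). The last term can be absorbed,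
because a bubble function bounds `diam · ‖p‖` by `‖∇z‖` (`exists_laplacian_bound`). Hence boundary
values and moments control the energy (`exists_energy_bound`).

Conversely, the `L²` norm controls the boundary values (`exists_inverse_bound`): an edge polynomial
keeps half of its maximum on a piece of fixed relative length, and a trace inequality in a thin
layer next to that piece carries a small factor in front of the energy, which is then absorbed. -/

/-- `E` is compact, of diameter at most `h`, and star-shaped with respect to every point of the
closed ball of radius `ρ` around `c`. -/
structure IsStarRegion (E : Set Plane) (c : Plane) (ρ h : ℝ) : Prop where
  compact : IsCompact E
  pos : 0 < ρ
  ball_subset : closedBall c ρ ⊆ E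
  star : ∀ y ∈ closedBall c ρ, StarConvex ℝ y E
  dist_le : ∀ x ∈ E, ∀ y ∈ E, dist x y ≤ h

namespace IsStarRegion

variable {E : Set Plane} {c : Plane} {ρ h : ℝ}

/-- The homothety with centre `x` and ratio `1 - t` maps a ball about `y` inside the kernel ball
onto a ball about the given point. Star-shapedness with respect to every point of the kernel ball
keeps the image in `E`. -/
lemma segment_mem_interior (hE : IsStarRegion E c ρ h) {x y : Plane} (hx : x ∈ E)
    (hy : y ∈ ball c ρ) {t : ℝ} (ht0 : 0 ≤ t) (ht1 : t < 1) : y + t • (x - y) ∈ interior E := by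
  rw [mem_ball] at hy
  have h1 : 0 < 1 - t := by linarith
  have hδ : 0 < (1 - t) * (ρ - dist y c) := mul_pos h1 (by linarith)
  rw [mem_interior_iff_mem_nhds]
  filter_upwards [ball_mem_nhds _ hδ] with w hw
  rw [mem_ball, dist_eq_norm] at hw
  set u : Plane := w - (y + t • (x - y)) with hu
  have hmem : y + (1 - t)⁻¹ • u ∈ closedBall c ρ := by
    rw [mem_closedBall]
    calc dist (y + (1 - t)⁻¹ • u) c ≤ dist (y + (1 - t)⁻¹ • u) y + dist y c := dist_triangle _ _ _
      _ = (1 - t)⁻¹ * ‖u‖ + dist y c := by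
          rw [dist_eq_norm, add_sub_cancel_left, norm_smul, Real.norm_of_nonneg (by positivity)]
      _ ≤ ρ := by
          have : (1 - t)⁻¹ * ‖u‖ ≤ (1 - t)⁻¹ * ((1 - t) * (ρ - dist y c)) := by gcongr
          rw [← mul_assoc, inv_mul_cancel₀ h1.ne', one_mul] at this
          linarith
  have := hE.star _ hmem hx h1.le ht0 (by ring)
  convert this using 1
  rw [smul_add, smul_smul, mul_inv_cancel₀ h1.ne', one_smul, hu, smul_sub, sub_smul, one_smul]
  abel

lemma ball_subset_interior (hE : IsStarRegion E c ρ h) : ball c ρ ⊆ interior E :=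
  interior_maximal (ball_subset_closedBall.trans hE.ball_subset) isOpen_ball

lemma center_mem (hE : IsStarRegion E c ρ h) : c ∈ E :=
  hE.ball_subset (mem_closedBall_self hE.pos.le)

lemma le_dist_of_mem_frontier (hE : IsStarRegion E c ρ h) {x : Plane} (hx : x ∈ frontier E) :
    ρ ≤ dist x c := by
  by_contra! hlt
  exact hx.2 (hE.ball_subset_interior hlt)

lemma norm_sub_le (hE : IsStarRegion E c ρ h) {x : Plane} (hx : x ∈ E) : ‖x - c‖ ≤ h := by
  rw [← dist_eq_norm]
  exact hE.dist_le x hx c hE.center_mem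

lemma radius_le (hE : IsStarRegion E c ρ h) : ρ ≤ h := by
  have hx : c + ρ • EuclideanSpace.single (0 : Fin 2) (1 : ℝ) ∈ closedBall c ρ := by
    simp [norm_smul, abs_of_pos hE.pos]
  have := hE.norm_sub_le (hE.ball_subset hx)
  simpa [norm_smul, abs_of_pos hE.pos] using this

/-- The largest `s` such that `c + s z` belongs to `E`. -/
noncomputable def extent (E : Set Plane) (c z : Plane) : ℝ := sSup {s : ℝ | 0 ≤ s ∧ c + s • z ∈ E}

lemma isCompact_extent_set (hE : IsStarRegion E c ρ h) {z : Plane} (hz : z ≠ 0) :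
    IsCompact {s : ℝ | 0 ≤ s ∧ c + s • z ∈ E} := by
  apply (isCompact_Icc (a := (0 : ℝ)) (b := h / ‖z‖)).of_isClosed_subset
  · exact isClosed_Ici.inter (hE.compact.isClosed.preimage (by fun_prop))
  · rintro s ⟨hs0, hs⟩
    have := hE.norm_sub_le hs
    rw [add_sub_cancel_left, norm_smul, Real.norm_of_nonneg hs0] at this
    exact ⟨hs0, (le_div_iff₀ (norm_pos_iff.2 hz)).2 this⟩

lemma extent_mem (hE : IsStarRegion E c ρ h) {z : Plane} (hz : z ≠ 0) :
    c + extent E c z • z ∈ E :=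
  ((hE.isCompact_extent_set hz).sSup_mem ⟨0, le_rfl, by simpa using hE.center_mem⟩).2

lemma le_extent (hE : IsStarRegion E c ρ h) {z : Plane} (hz : z ≠ 0) {s : ℝ} (hs : 0 ≤ s)
    (hs' : c + s • z ∈ E) : s ≤ extent E c z :=
  le_csSup (hE.isCompact_extent_set hz).bddAbove ⟨hs, hs'⟩

lemma div_norm_le_extent (hE : IsStarRegion E c ρ h) {z : Plane} (hz : z ≠ 0) :
    ρ / ‖z‖ ≤ extent E c z := by
  have hz' := norm_pos_iff.2 hz
  refine hE.le_extent hz (div_pos hE.pos hz').le (hE.ball_subset ?_)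
  rw [mem_closedBall, dist_eq_norm, add_sub_cancel_left, norm_smul,
    Real.norm_of_nonneg (div_pos hE.pos hz').le, div_mul_cancel₀ _ hz'.ne']

lemma extent_pos (hE : IsStarRegion E c ρ h) {z : Plane} (hz : z ≠ 0) : 0 < extent E c z :=
  (div_pos hE.pos (norm_pos_iff.2 hz)).trans_le (hE.div_norm_le_extent hz)

lemma extent_mul_norm_le (hE : IsStarRegion E c ρ h) {z : Plane} (hz : z ≠ 0) :
    extent E c z * ‖z‖ ≤ h := by
  have := hE.norm_sub_le (hE.extent_mem hz)
  rwa [add_sub_cancel_left, norm_smul, Real.norm_of_nonneg (hE.extent_pos hz).le] at this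

/-- The reciprocal of the extent is the gauge of `E - c`, and the kernel ball makes it Lipschitz
with constant `1 / ρ`: a convex combination of the extreme point in direction `z` and a point of the
ball in direction `w - z` is a multiple of `w`. -/
lemma inv_extent_le (hE : IsStarRegion E c ρ h) {z w : Plane} (hz : z ≠ 0) (hw : w ≠ 0) :
    (extent E c w)⁻¹ ≤ (extent E c z)⁻¹ + ‖w - z‖ / ρ := by
  rcases eq_or_ne w z with rfl | hne
  · simp
  have hs := hE.extent_pos hz
  have hn : 0 < ‖w - z‖ := norm_pos_iff.2 (sub_ne_zero.2 hne)
  set s := extent E c z with hsd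
  set a := ‖w - z‖ / ρ with ha
  have ha0 : 0 < a := div_pos hn hE.pos
  have hT : 0 < s⁻¹ + a := by positivity
  have hmem : c + a⁻¹ • (w - z) ∈ closedBall c ρ := by
    rw [mem_closedBall, dist_eq_norm, add_sub_cancel_left, norm_smul,
      Real.norm_of_nonneg (by positivity), ha, inv_div, div_mul_cancel₀ _ hn.ne']
  have key := hE.star _ hmem (hE.extent_mem hz) (a := a / (s⁻¹ + a)) (b := s⁻¹ / (s⁻¹ + a))
    (by positivity) (by positivity) (by field_simp; ring)
  have hle : (s⁻¹ + a)⁻¹ ≤ extent E c w := by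
    refine hE.le_extent hw (by positivity) ?_
    convert key using 1
    rw [← hsd]
    ext i
    simp only [PiLp.add_apply, PiLp.smul_apply, PiLp.sub_apply, smul_eq_mul]
    field_simp
    ring
  rw [inv_le_comm₀ (hE.extent_pos hw) hT]
  exact hle

/-- The radial retraction onto the boundary. -/
noncomputable def retract (E : Set Plane) (c x : Plane) : Plane :=
  c + extent E c (x - c) • (x - c)

lemma retract_mem_frontier (hE : IsStarRegion E c ρ h) {x : Plane} (hx : x ≠ c) :
    retract E c x ∈ frontier E := by
  have hz : x - c ≠ 0 := sub_ne_zero.2 hx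
  refine ⟨subset_closure (hE.extent_mem hz), fun hint => ?_⟩
  have hcont : Continuous fun s : ℝ => c + s • (x - c) := by fun_prop
  have hnb : ∀ᶠ s in 𝓝 (extent E c (x - c)), c + s • (x - c) ∈ E :=
    hcont.continuousAt.eventually (mem_interior_iff_mem_nhds.1 hint)
  have h2 : ∀ᶠ s in 𝓝[>] (extent E c (x - c)), c + s • (x - c) ∈ E := hnb.filter_mono inf_le_left
  obtain ⟨s, hs, hs'⟩ := (h2.and self_mem_nhdsWithin).exists
  exact absurd (hE.le_extent hz ((hE.extent_pos hz).le.trans (le_of_lt hs')) hs) (not_le.2 hs')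

lemma retract_of_mem_frontier (hE : IsStarRegion E c ρ h) {x : Plane} (hx : x ∈ frontier E) :
    retract E c x = x := by
  have hxE : x ∈ E := hE.compact.isClosed.frontier_subset hx
  have hxc : x ≠ c := by
    rintro rfl
    have := hE.le_dist_of_mem_frontier hx
    rw [dist_self] at this
    exact absurd hE.pos (not_lt.2 this)
  have hz : x - c ≠ 0 := sub_ne_zero.2 hxc
  have h1 : 1 ≤ extent E c (x - c) := hE.le_extent hz zero_le_one (by simpa using hxE)
  have h2 : extent E c (x - c) = 1 := by
    by_contra hne
    have hlt : 1 < extent E c (x - c) := lt_of_le_of_ne h1 (Ne.symm hne)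
    have := hE.segment_mem_interior (hE.extent_mem hz) (mem_ball_self hE.pos)
      (t := (extent E c (x - c))⁻¹) (by positivity) (inv_lt_one_of_one_lt₀ hlt)
    rw [add_sub_cancel_left, smul_smul, inv_mul_cancel₀ (by positivity), one_smul,
      add_sub_cancel] at this
    exact hx.2 this
  rw [retract, h2, one_smul, add_sub_cancel]

/-- With extents `s`, `r`, the difference splits into `s` times the difference of the arguments and
a radial term with factor `s (r⁻¹ - s⁻¹)`. Away from the centre extents are at most `2 h / ρ`, and
`inv_extent_le` bounds the radial term. -/
lemma dist_retract_le (hE : IsStarRegion E c ρ h) {x y : Plane} (hx : ρ / 2 ≤ dist x c)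
    (hy : ρ / 2 ≤ dist y c) :
    dist (retract E c x) (retract E c y) ≤ 2 * h / ρ * (1 + h / ρ) * dist x y := by
  have hρ := hE.pos
  have hh : 0 < h := hρ.trans_le hE.radius_le
  rw [dist_eq_norm] at hx hy
  have hzx : x - c ≠ 0 := norm_pos_iff.1 (by linarith)
  have hzy : y - c ≠ 0 := norm_pos_iff.1 (by linarith)
  set s := extent E c (x - c) with hs
  set r := extent E c (y - c) with hr
  have hs0 : 0 < s := hE.extent_pos hzx
  have hr0 : 0 < r := hE.extent_pos hzy
  have hxy : ‖(x - c) - (y - c)‖ = dist x y := by rw [dist_eq_norm]; congr 1; abel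
  have hJ : |s⁻¹ - r⁻¹| ≤ dist x y / ρ := by
    rw [abs_le]
    have h1 := hE.inv_extent_le hzx hzy
    have h2 := hE.inv_extent_le hzy hzx
    rw [norm_sub_rev, hxy, ← hs, ← hr] at h1
    rw [hxy, ← hs, ← hr] at h2
    constructor <;> linarith
  have hsle : s ≤ 2 * h / ρ := by
    rw [le_div_iff₀ hρ]
    have := hE.extent_mul_norm_le hzx
    nlinarith
  have hryle : r * ‖y - c‖ ≤ h := hE.extent_mul_norm_le hzy
  have hdecomp : retract E c x - retract E c y
      = s • ((x - c) - (y - c)) + (s * (r⁻¹ - s⁻¹)) • (r • (y - c)) := by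
    rw [retract, retract, ← hs, ← hr, smul_smul]
    have : s * (r⁻¹ - s⁻¹) * r = s - r := by field_simp
    rw [this]
    module
  rw [dist_eq_norm, hdecomp]
  calc _ ≤ ‖s • ((x - c) - (y - c))‖ + ‖(s * (r⁻¹ - s⁻¹)) • (r • (y - c))‖ := norm_add_le _ _
    _ = s * dist x y + s * |s⁻¹ - r⁻¹| * (r * ‖y - c‖) := by
        rw [norm_smul, norm_smul, norm_smul, hxy, Real.norm_of_nonneg hs0.le,
          Real.norm_of_nonneg hr0.le, Real.norm_eq_abs, abs_mul, abs_of_pos hs0, abs_sub_comm]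
    _ ≤ s * dist x y + s * (dist x y / ρ) * h := by gcongr
    _ = s * ((1 + h / ρ) * dist x y) := by ring
    _ ≤ 2 * h / ρ * ((1 + h / ρ) * dist x y) := by gcongr
    _ = _ := by ring

end IsStarRegion

/-! ### Lipschitz extension of boundary data -/

/-- A continuous function on an interval is Lipschitz if it is Lipschitz, with the same constant,
on each member of a finite closed cover. -/
lemma abs_sub_le_of_finite_closed_cover {ι : Type*} [DecidableEq ι] {F : ι → Set ℝ} {φ : ℝ → ℝ}
    {Λ : ℝ} (hF : ∀ i, IsClosed (F i))
    (hφ : ∀ i, ∀ s ∈ F i, ∀ t ∈ F i, |φ s - φ t| ≤ Λ * |s - t|) (S : Finset ι) :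
    ∀ a b : ℝ, a ≤ b → ContinuousOn φ (Icc a b) → Icc a b ⊆ ⋃ i ∈ S, F i →
      |φ b - φ a| ≤ Λ * (b - a) := by
  induction S using Finset.strongInduction with
  | H S ih =>
    intro a b hab hcont hcov
    obtain ⟨i, hiS, hai⟩ : ∃ i ∈ S, a ∈ F i := by simpa using hcov (left_mem_Icc.2 hab)
    -- `a'` is the last point of the piece that contains `a`. Beyond it only the other pieces occur,
    -- so the induction hypothesis applies on `[x, b]` for `x > a'`, and `x → a'` closes the gap.
    have hK : IsCompact (F i ∩ Icc a b) := isCompact_Icc.inter_left (hF i)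
    obtain ⟨hm, hmab⟩ := hK.sSup_mem ⟨a, hai, left_mem_Icc.2 hab⟩
    set a' := sSup (F i ∩ Icc a b) with ha'
    have h1 : |φ a' - φ a| ≤ Λ * (a' - a) := by
      simpa [abs_of_nonneg (sub_nonneg.2 hmab.1)] using hφ i a' hm a hai
    have h2 : |φ b - φ a'| ≤ Λ * (b - a') := by
      rcases hmab.2.eq_or_lt with heq | hlt
      · rw [heq]; simp
      have hev : ∀ᶠ x in 𝓝[>] a', |φ b - φ x| ≤ Λ * (b - x) := by
        filter_upwards [Ioo_mem_nhdsGT hlt] with x hx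
        refine ih (S.erase i) (Finset.erase_ssubset hiS) x b hx.2.le
          (hcont.mono (Icc_subset_Icc (hmab.1.trans hx.1.le) le_rfl)) fun y hy => ?_
        obtain ⟨j, hjS, hyj⟩ : ∃ j ∈ S, y ∈ F j := by
          simpa using hcov ⟨(hmab.1.trans hx.1.le).trans hy.1, hy.2⟩
        have hji : j ≠ i := by
          rintro rfl
          have : y ≤ a' := le_csSup hK.bddAbove
            ⟨hyj, (hmab.1.trans hx.1.le).trans hy.1, hy.2⟩
          exact absurd (hx.1.trans_le hy.1) (not_lt.2 this)
        simpa using ⟨j, ⟨hji, hjS⟩, hyj⟩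
      have hc : Tendsto φ (𝓝[>] a') (𝓝 (φ a')) := by
        have := (hcont a' hmab).mono_left
          (nhdsWithin_mono a' (Icc_subset_Icc hmab.1 le_rfl : Icc a' b ⊆ Icc a b))
        rw [nhdsWithin_Icc_eq_nhdsGE hlt] at this
        exact this.mono_left (nhdsWithin_mono _ Ioi_subset_Ici_self)
      have hid : Tendsto (fun x : ℝ => x) (𝓝[>] a') (𝓝 a') := tendsto_id.mono_left inf_le_left
      exact le_of_tendsto_of_tendsto ((tendsto_const_nhds.sub hc).abs)
        ((tendsto_const_nhds.sub hid).const_mul Λ) hev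
    calc |φ b - φ a| ≤ |φ b - φ a'| + |φ a' - φ a| := abs_sub_le _ _ _
      _ ≤ Λ * (b - a) := by linarith

/-- A continuous function on the boundary of a star-shaped region which is Lipschitz on each of
finitely many closed pieces of the boundary extends to a Lipschitz function on the plane. -/
lemma IsStarRegion.exists_lipschitz_extension {E : Set Plane} {c : Plane} {ρ h : ℝ}
    (hE : IsStarRegion E c ρ h) {ι : Type*} [Finite ι] {e : ι → Set Plane}
    (he : ∀ i, IsClosed (e i)) (hfr : frontier E = ⋃ i, e i) {f : Plane → ℝ}
    (hf : ContinuousOn f (frontier E)) {Λ b : ℝ} (hΛ : 0 ≤ Λ)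
    (hlip : ∀ i, ∀ x ∈ e i, ∀ y ∈ e i, |f x - f y| ≤ Λ * dist x y)
    (hb : ∀ x ∈ frontier E, |f x| ≤ b) :
    ∃ g : Plane → ℝ, LipschitzWith
      (Real.toNNReal (Λ * (2 * h / ρ * (1 + h / ρ)) + 4 * b / ρ)) g ∧
      ∀ x ∈ frontier E, g x = f x := by
  classical
  cases nonempty_fintype ι
  have hρ := hE.pos
  have hh : 0 < h := hρ.trans_le hE.radius_le
  set A := 2 * h / ρ * (1 + h / ρ) with hA
  have hA0 : 0 ≤ A := by positivity
  have key : LipschitzOnWith (Real.toNNReal (Λ * A + 4 * b / ρ)) f (frontier E) := by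
    refine LipschitzOnWith.of_dist_le_mul fun x hx y hy => ?_
    have hb0 : 0 ≤ b := (abs_nonneg _).trans (hb x hx)
    rw [Real.coe_toNNReal _ (by positivity), Real.dist_eq]
    -- Points at distance at least `ρ / 2` are handled by the sup bound alone, which gives the
    -- summand `4 b / ρ`.
    rcases le_or_gt (ρ / 2) (dist x y) with hfar | hnear
    · calc |f x - f y| ≤ |f x| + |f y| := abs_sub _ _
        _ ≤ 4 * b / ρ * (ρ / 2) := by
            have h1 := hb x hx
            have h2 := hb y hy
            field_simp
            linarith
        _ ≤ 4 * b / ρ * dist x y := by gcongr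
        _ ≤ (Λ * A + 4 * b / ρ) * dist x y := by gcongr; linarith [mul_nonneg hΛ hA0]
    -- The chord between close boundary points stays at distance `ρ / 2` from the centre. Its radial
    -- retraction is a Lipschitz curve in the boundary from `y` to `x`, covered by the finitely many
    -- closed pieces.
    · set p : ℝ → Plane := fun s => AffineMap.lineMap y x s with hp
      have hpd : ∀ s t, dist (p s) (p t) = |s - t| * dist x y := by
        intro s t
        simp only [hp, dist_lineMap_lineMap, Real.dist_eq, dist_comm x y]
      have hpfar : ∀ s ∈ Icc (0 : ℝ) 1, ρ / 2 ≤ dist (p s) c := by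
        intro s hs
        have h1 : dist (p s) (p 0) ≤ dist x y := by
          rw [hpd, sub_zero, abs_of_nonneg hs.1]
          exact mul_le_of_le_one_left dist_nonneg hs.2
        have h2 := hE.le_dist_of_mem_frontier hy
        have h3 : p 0 = y := by simp [hp]
        rw [h3] at h1
        have h4 := dist_triangle_left y c (p s)
        linarith
      set R : ℝ → Plane := fun s => IsStarRegion.retract E c (p s) with hR
      have hRd : ∀ s ∈ Icc (0 : ℝ) 1, ∀ t ∈ Icc (0 : ℝ) 1,
          dist (R s) (R t) ≤ A * dist x y * |s - t| := by
        intro s hs t ht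
        have := hE.dist_retract_le (hpfar s hs) (hpfar t ht)
        rw [hpd] at this
        calc _ ≤ _ := this
          _ = _ := by ring
      have hRc : ContinuousOn R (Icc 0 1) := by
        have : LipschitzOnWith (Real.toNNReal (A * dist x y)) R (Icc 0 1) := by
          refine LipschitzOnWith.of_dist_le_mul fun s hs t ht => ?_
          rw [Real.coe_toNNReal _ (by positivity), Real.dist_eq]
          exact hRd s hs t ht
        exact this.continuousOn
      have hRf : ∀ s ∈ Icc (0 : ℝ) 1, R s ∈ frontier E := fun s hs =>
        hE.retract_mem_frontier fun hcon => by
          have := hpfar s hs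
          rw [hcon, dist_self] at this
          linarith
      have hfin := abs_sub_le_of_finite_closed_cover (F := fun i => Icc (0 : ℝ) 1 ∩ R ⁻¹' e i)
        (φ := f ∘ R) (Λ := Λ * (A * dist x y))
        (fun i => hRc.preimage_isClosed_of_isClosed isClosed_Icc (he i))
        (fun i s hs t ht => by
          calc |f (R s) - f (R t)| ≤ Λ * dist (R s) (R t) := hlip i _ hs.2 _ ht.2
            _ ≤ Λ * (A * dist x y * |s - t|) := by gcongr; exact hRd s hs.1 t ht.1
            _ = _ := by ring)
        Finset.univ 0 1 zero_le_one (hf.comp hRc hRf) (fun s hs => by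
          have := hRf s hs
          rw [hfr] at this
          simpa using ⟨⟨hs.1, hs.2⟩, mem_iUnion.1 this⟩)
      have h0 : R 0 = y := by simp [hR, hp, hE.retract_of_mem_frontier hy]
      have h1 : R 1 = x := by simp [hR, hp, hE.retract_of_mem_frontier hx]
      simp only [Function.comp, h0, h1, sub_zero, mul_one] at hfin
      have : 0 ≤ 4 * b / ρ * dist x y := by positivity
      calc |f x - f y| ≤ Λ * (A * dist x y) := hfin
        _ ≤ (Λ * A + 4 * b / ρ) * dist x y := by linarith
  obtain ⟨g, hg, hgf⟩ := key.extend_real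
  exact ⟨g, hg, fun x hx => (hgf hx).symm⟩

/-! ### Poincaré and trace inequalities -/

lemma enorm_sq_eq_ofReal {F : Type*} [SeminormedAddCommGroup F] (v : F) :
    ‖v‖ₑ ^ 2 = ENNReal.ofReal (‖v‖ ^ 2) := by
  rw [ENNReal.ofReal_pow (norm_nonneg v), ofReal_norm]

lemma real_enorm_sq (r : ℝ) : ‖r‖ₑ ^ 2 = ENNReal.ofReal (r ^ 2) := by
  rw [enorm_sq_eq_ofReal, Real.norm_eq_abs, sq_abs]

lemma norm_gradient (w : Plane → ℝ) (x : Plane) : ‖gradient w x‖ = ‖fderiv ℝ w x‖ := by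
  simp [gradient]

lemma enorm_sub_sq_le (a b : ℝ) : ‖a‖ₑ ^ 2 ≤ 2 * ‖b‖ₑ ^ 2 + 2 * ‖a - b‖ₑ ^ 2 := by
  rw [real_enorm_sq, real_enorm_sq, real_enorm_sq,
    show (2 : ℝ≥0∞) = ENNReal.ofReal 2 by simp, ← ENNReal.ofReal_mul zero_le_two,
    ← ENNReal.ofReal_mul zero_le_two, ← ENNReal.ofReal_add (by positivity) (by positivity)]
  exact ENNReal.ofReal_le_ofReal (by nlinarith [sq_nonneg (a - 2 * b)])

lemma lintegral_sq_le {α : Type*} [MeasurableSpace α] (μ : Measure α) {g : α → ℝ≥0∞}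
    (hg : AEMeasurable g μ) : (∫⁻ x, g x ∂μ) ^ 2 ≤ μ univ * ∫⁻ x, g x ^ 2 ∂μ := by
  have := ENNReal.lintegral_mul_le_Lp_mul_Lq μ Real.HolderConjugate.two_two
    (aemeasurable_const (b := (1 : ℝ≥0∞))) hg
  simp only [Pi.mul_apply, one_mul, ENNReal.one_rpow, lintegral_const] at this
  calc (∫⁻ x, g x ∂μ) ^ 2
      ≤ (μ univ ^ (1 / 2 : ℝ) * (∫⁻ x, g x ^ (2 : ℝ) ∂μ) ^ (1 / 2 : ℝ)) ^ 2 := by gcongr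
    _ = μ univ * ∫⁻ x, g x ^ 2 ∂μ := by
        rw [mul_pow, ← ENNReal.rpow_natCast, ← ENNReal.rpow_natCast, ← ENNReal.rpow_mul,
          ← ENNReal.rpow_mul]
        norm_num

lemma enorm_integral_sq_le {α : Type*} [MeasurableSpace α] {μ : Measure α} {f : α → ℝ}
    (hf : AEStronglyMeasurable f μ) : ‖∫ x, f x ∂μ‖ₑ ^ 2 ≤ μ univ * ∫⁻ x, ‖f x‖ₑ ^ 2 ∂μ :=
  (pow_le_pow_left' (enorm_integral_le_lintegral_enorm f) 2).trans (lintegral_sq_le μ hf.enorm)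

lemma measurable_enorm_fderiv (w : Plane → ℝ) : Measurable fun x => ‖fderiv ℝ w x‖ₑ :=
  (measurable_fderiv ℝ w).enorm

/-- Fundamental theorem of calculus along a segment, in squared form. -/
lemma enorm_sub_sq_le_lintegral_segment {Ω : Set Plane} (hΩ : IsOpen Ω) {w : Plane → ℝ}
    (hw : ContDiffOn ℝ 1 w Ω) (y v : Plane) {a b : ℝ} (hab : a ≤ b)
    (hseg : ∀ t ∈ Icc a b, y + t • v ∈ Ω) :
    ‖w (y + b • v) - w (y + a • v)‖ₑ ^ 2 ≤ ENNReal.ofReal (b - a) *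
      ∫⁻ t in Icc a b, ‖fderiv ℝ w (y + t • v)‖ₑ ^ 2 * ‖v‖ₑ ^ 2 := by
  have hline : ContDiff ℝ 1 fun t : ℝ => y + t • v := by fun_prop
  have hf : ContDiffOn ℝ 1 (fun t : ℝ => w (y + t • v)) (Icc a b) :=
    hw.comp hline.contDiffOn hseg
  have h1 := enorm_sub_le_lintegral_deriv_of_contDiffOn_Icc hf hab
  have hd : ∀ t ∈ Icc a b,
      ‖deriv (fun t : ℝ => w (y + t • v)) t‖ₑ ≤ ‖fderiv ℝ w (y + t • v)‖ₑ * ‖v‖ₑ := by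
    intro t ht
    have hdw : DifferentiableAt ℝ w (y + t • v) :=
      (hw.contDiffAt (hΩ.mem_nhds (hseg t ht))).differentiableAt one_ne_zero
    have hl : HasDerivAt (fun t : ℝ => y + t • v) v t := by
      simpa using ((hasDerivAt_id t).smul_const v).const_add y
    have hder : HasDerivAt (fun t : ℝ => w (y + t • v)) (fderiv ℝ w (y + t • v) v) t :=
      hdw.hasFDerivAt.comp_hasDerivAt t hl
    rw [hder.deriv]
    exact ContinuousLinearMap.le_opENorm _ _
  have hmeas : Measurable fun t : ℝ => ‖fderiv ℝ w (y + t • v)‖ₑ * ‖v‖ₑ :=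
    ((measurable_enorm_fderiv w).comp hline.continuous.measurable).mul_const _
  calc _ ≤ (∫⁻ t in Icc a b, ‖fderiv ℝ w (y + t • v)‖ₑ * ‖v‖ₑ) ^ 2 := by
        refine pow_le_pow_left' (h1.trans ?_) 2
        exact setLIntegral_mono hmeas hd
    _ ≤ _ := by
        refine (lintegral_sq_le _ hmeas.aemeasurable).trans_eq ?_
        simp [mul_pow]

/-- The Jacobian of the substitution is `t⁻²`, which is at most `4`. -/
lemma lintegral_comp_add_smul {G : Plane → ℝ≥0∞} (hG : Measurable G) (a : Plane) {t : ℝ}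
    (ht : 1 / 2 ≤ t) : ∫⁻ x, G (a + t • x) ≤ 4 * ∫⁻ x, G x := by
  have ht0 : 0 < t := by linarith
  have h1 : ∫⁻ x, G (a + t • x) = ENNReal.ofReal |(t ^ 2)⁻¹| * ∫⁻ x, G (a + x) := by
    have := Measure.map_addHaar_smul (volume : Measure Plane) ht0.ne'
    rw [finrank_euclideanSpace_fin] at this
    rw [← smul_eq_mul, ← lintegral_smul_measure, ← this]
    exact (lintegral_map (hG.comp (measurable_const_add a)) (measurable_const_smul t)).symm
  rw [h1, lintegral_add_left_eq_self G a]
  gcongr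
  rw [abs_of_pos (by positivity), show (4 : ℝ≥0∞) = ENNReal.ofReal 4 by simp]
  apply ENNReal.ofReal_le_ofReal
  rw [inv_le_comm₀ (by positivity) (by positivity)]
  nlinarith

namespace IsStarRegion

variable {E : Set Plane} {c : Plane} {ρ h : ℝ}

/-- Difference form of the Poincaré inequality: write `w x - w y` as an integral of the derivative
along the segment from `y` to `x`, which lies in the interior, and use Fubini. -/
lemma lintegral_enorm_sub_sq_le (hE : IsStarRegion E c ρ h) {w : Plane → ℝ}
    (hw : ContDiffOn ℝ 1 w (interior E)) :
    ∫⁻ x in interior E, ∫⁻ y in ball c ρ, ‖w x - w y‖ₑ ^ 2 ≤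
      8 * volume (interior E) * ENNReal.ofReal (h ^ 2) *
        ∫⁻ x in interior E, ‖fderiv ℝ w x‖ₑ ^ 2 := by
  set Ω := interior E with hΩd
  have hΩ : IsOpen Ω := isOpen_interior
  set G : Plane → ℝ≥0∞ := Ω.indicator fun x => ‖fderiv ℝ w x‖ₑ ^ 2 with hGd
  have hG : Measurable G :=
    ((measurable_enorm_fderiv w).pow_const 2).indicator hΩ.measurableSet
  have hGint : ∫⁻ x, G x = ∫⁻ x in Ω, ‖fderiv ℝ w x‖ₑ ^ 2 :=
    lintegral_indicator hΩ.measurableSet _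
  have hBΩ : volume (ball c ρ) ≤ volume Ω := measure_mono hE.ball_subset_interior
  set Q : Plane → Plane → ℝ → ℝ≥0∞ := fun x y t => G (y + t • (x - y)) with hQ
  have hQm : Measurable fun p : (Plane × Plane) × ℝ => Q p.1.1 p.1.2 p.2 := by
    refine hG.comp (Continuous.measurable ?_)
    fun_prop
  have step1 : ∀ x ∈ Ω, ∀ y ∈ ball c ρ, ‖w x - w y‖ₑ ^ 2 ≤
      ENNReal.ofReal (h ^ 2) * ∫⁻ t in Icc (0 : ℝ) 1, Q x y t := by
    intro x hx y hy
    have hseg : ∀ t ∈ Icc (0 : ℝ) 1, y + t • (x - y) ∈ Ω := by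
      intro t ht
      rcases ht.2.eq_or_lt with rfl | hlt
      · simpa using hx
      · exact hE.segment_mem_interior (interior_subset hx) hy ht.1 hlt
    have := enorm_sub_sq_le_lintegral_segment hΩ hw y (x - y) zero_le_one hseg
    simp only [one_smul, add_sub_cancel, zero_smul, add_zero, sub_zero, ENNReal.ofReal_one,
      one_mul] at this
    refine this.trans ?_
    rw [← lintegral_const_mul']
    · refine setLIntegral_mono' measurableSet_Icc fun t ht => ?_
      simp only [hQ, hGd, indicator_of_mem (hseg t ht)]
      rw [mul_comm]
      gcongr
      rw [enorm_sq_eq_ofReal]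
      refine ENNReal.ofReal_le_ofReal ?_
      gcongr
      rw [← dist_eq_norm]
      exact hE.dist_le x (interior_subset hx) y (interior_subset (hE.ball_subset_interior hy))
    · exact ENNReal.ofReal_ne_top
  have step2 : ∀ t ∈ Icc (0 : ℝ) 1, ∫⁻ x in Ω, ∫⁻ y in ball c ρ, Q x y t ≤
      4 * volume Ω * ∫⁻ x, G x := by
    intro t ht
    have hm : Measurable fun p : Plane × Plane => Q p.1 p.2 t := by
      refine hG.comp (Continuous.measurable ?_)
      fun_prop
    -- One of the weights `t`, `1 - t` is at least `1 / 2`. The variable carrying it is integrated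
    -- first, so that the Jacobian stays bounded; the other variable only contributes a volume.
    rcases le_or_gt (1 / 2) t with h1 | h1
    · rw [lintegral_lintegral_swap hm.aemeasurable]
      calc ∫⁻ y in ball c ρ, ∫⁻ x in Ω, Q x y t ≤ ∫⁻ y in ball c ρ, 4 * ∫⁻ x, G x := by
            refine lintegral_mono fun y => (setLIntegral_le_lintegral _ _).trans ?_
            refine le_trans (le_of_eq ?_) (lintegral_comp_add_smul hG ((1 - t) • y) h1)
            refine lintegral_congr fun x => ?_
            simp only [hQ]
            congr 1
            module
        _ = 4 * (∫⁻ x, G x) * volume (ball c ρ) := by simp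
        _ ≤ 4 * (∫⁻ x, G x) * volume Ω := by gcongr
        _ = _ := by ring
    · calc ∫⁻ x in Ω, ∫⁻ y in ball c ρ, Q x y t ≤ ∫⁻ x in Ω, 4 * ∫⁻ x, G x := by
            refine lintegral_mono fun x => (setLIntegral_le_lintegral _ _).trans ?_
            refine le_trans (le_of_eq ?_) (lintegral_comp_add_smul hG (t • x)
              (by linarith : 1 / 2 ≤ 1 - t))
            refine lintegral_congr fun y => ?_
            simp only [hQ]
            congr 1
            module
        _ = _ := by simp; ring
  calc ∫⁻ x in Ω, ∫⁻ y in ball c ρ, ‖w x - w y‖ₑ ^ 2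
      ≤ ∫⁻ x in Ω, ∫⁻ y in ball c ρ, ENNReal.ofReal (h ^ 2) * ∫⁻ t in Icc (0 : ℝ) 1, Q x y t :=
        setLIntegral_mono' hΩ.measurableSet fun x hx =>
          setLIntegral_mono' measurableSet_ball fun y hy => step1 x hx y hy
    _ = ENNReal.ofReal (h ^ 2) *
          ∫⁻ x in Ω, ∫⁻ y in ball c ρ, ∫⁻ t in Icc (0 : ℝ) 1, Q x y t := by
        simp_rw [lintegral_const_mul' _ _ ENNReal.ofReal_ne_top]
    _ = ENNReal.ofReal (h ^ 2) *
          ∫⁻ t in Icc (0 : ℝ) 1, ∫⁻ x in Ω, ∫⁻ y in ball c ρ, Q x y t := by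
        congr 1
        have e1 : ∫⁻ x in Ω, ∫⁻ y in ball c ρ, ∫⁻ t in Icc (0 : ℝ) 1, Q x y t =
            ∫⁻ p : Plane × Plane, (∫⁻ t in Icc (0 : ℝ) 1, Q p.1 p.2 t)
              ∂((volume.restrict Ω).prod (volume.restrict (ball c ρ))) :=
          (lintegral_prod _ (Measurable.lintegral_prod_right' hQm).aemeasurable).symm
        rw [e1, lintegral_lintegral_swap hQm.aemeasurable]
        refine lintegral_congr fun t => ?_
        refine lintegral_prod _ (Measurable.aemeasurable ?_)
        exact hQm.comp (measurable_id.prodMk measurable_const)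
    _ ≤ ENNReal.ofReal (h ^ 2) * ∫⁻ t in Icc (0 : ℝ) 1, 4 * volume Ω * ∫⁻ x, G x := by
        exact mul_le_mul' le_rfl (setLIntegral_mono' measurableSet_Icc step2)
    _ = 4 * volume Ω * ENNReal.ofReal (h ^ 2) * ∫⁻ x, G x := by
        simp; ring
    _ ≤ _ := by
        rw [hGint]
        gcongr
        norm_num

lemma volume_interior_le (hE : IsStarRegion E c ρ h) :
    volume (interior E) ≤ ENNReal.ofReal (Real.pi * h ^ 2) := by
  have hh : 0 ≤ h := hE.pos.le.trans hE.radius_le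
  calc volume (interior E) ≤ volume (closedBall c h) := measure_mono fun x hx => by
        rw [mem_closedBall]
        exact hE.dist_le x (interior_subset hx) c hE.center_mem
    _ = _ := by
        rw [EuclideanSpace.volume_closedBall_fin_two, mul_comm, ENNReal.ofReal_mul Real.pi_pos.le,
          ENNReal.ofReal_pow hh]

lemma volume_ball_eq (hE : IsStarRegion E c ρ h) :
    volume (ball c ρ) = ENNReal.ofReal (Real.pi * ρ ^ 2) := by
  rw [EuclideanSpace.volume_ball_fin_two, mul_comm, ENNReal.ofReal_mul Real.pi_pos.le,
    ENNReal.ofReal_pow hE.pos.le]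

lemma integrableOn_of_continuousOn (hE : IsStarRegion E c ρ h) {f : Plane → ℝ}
    (hf : ContinuousOn f E) : IntegrableOn f (interior E) :=
  (hf.integrableOn_compact hE.compact).mono_set interior_subset

/-- The Poincaré inequality on a star-shaped region. -/
lemma poincare (hE : IsStarRegion E c ρ h) {w : Plane → ℝ} (hwc : ContinuousOn w E)
    (hw : ContDiffOn ℝ 1 w (interior E))
    (hgrad : IntegrableOn (fun x => ‖gradient w x‖ ^ 2) (interior E)) :
    ∃ a : ℝ, ∫ x in interior E, (w x - a) ^ 2 ≤
        8 * (h / ρ) ^ 2 * h ^ 2 * ∫ x in interior E, ‖gradient w x‖ ^ 2 ∧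
      a ^ 2 * (Real.pi * ρ ^ 2) ≤ ∫ x in interior E, w x ^ 2 := by
  have hρ := hE.pos
  have hh : 0 < h := hρ.trans_le hE.radius_le
  set V : ℝ := Real.pi * ρ ^ 2 with hV
  have hV0 : 0 < V := by positivity
  have hvol := hE.volume_ball_eq
  rw [← hV] at hvol
  set B := ball c ρ
  have hBint : IntegrableOn w B := (hE.integrableOn_of_continuousOn hwc).mono_set
    hE.ball_subset_interior
  have hBreal : (volume.restrict B).real univ = V := by
    simp [Measure.real, hvol, hV0.le]
  have hBuniv : (volume.restrict B) univ = ENNReal.ofReal V := by simp [hvol]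
  have hVne : ENNReal.ofReal V ≠ 0 := by simpa using hV0
  -- The constant is the mean over the kernel ball. Cauchy-Schwarz compares `w x` with this mean
  -- through the differences `w x - w y`, and also bounds the mean itself.
  refine ⟨V⁻¹ * ∫ y in B, w y, ?_, ?_⟩
  · have hpt : ∀ x, ENNReal.ofReal V * ‖w x - V⁻¹ * ∫ y in B, w y‖ₑ ^ 2 ≤
        ∫⁻ y in B, ‖w x - w y‖ₑ ^ 2 := by
      intro x
      have h1 : ∫ y in B, (w x - w y) = V * (w x - V⁻¹ * ∫ y in B, w y) := by
        rw [integral_sub (integrable_const_iff.2 (Or.inr ⟨by simp [hvol]⟩)) hBint,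
          integral_const, hBreal, smul_eq_mul]
        field_simp
      have h2 := enorm_integral_sq_le (f := fun y => w x - w y)
        (aestronglyMeasurable_const.sub hBint.aestronglyMeasurable)
      rw [h1, hBuniv, enorm_mul, mul_pow, Real.enorm_of_nonneg hV0.le, sq, mul_assoc,
        ENNReal.mul_le_mul_iff_right hVne ENNReal.ofReal_ne_top] at h2
      exact h2
    have hI : ENNReal.ofReal V * ∫⁻ x in interior E, ‖w x - V⁻¹ * ∫ y in B, w y‖ₑ ^ 2 ≤
        8 * ENNReal.ofReal (Real.pi * h ^ 2) * ENNReal.ofReal (h ^ 2) *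
          ∫⁻ x in interior E, ‖fderiv ℝ w x‖ₑ ^ 2 := by
      rw [← lintegral_const_mul' _ _ ENNReal.ofReal_ne_top]
      refine (lintegral_mono fun x => hpt x).trans ((hE.lintegral_enorm_sub_sq_le hw).trans ?_)
      gcongr
      exact hE.volume_interior_le
    have e1 : ∫⁻ x in interior E, ‖w x - V⁻¹ * ∫ y in B, w y‖ₑ ^ 2 =
        ENNReal.ofReal (∫ x in interior E, (w x - V⁻¹ * ∫ y in B, w y) ^ 2) := by
      rw [ofReal_integral_eq_lintegral_ofReal
        (hE.integrableOn_of_continuousOn (by fun_prop)) (.of_forall fun x => sq_nonneg _)]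
      simp only [real_enorm_sq]
    have e2 : ∫⁻ x in interior E, ‖fderiv ℝ w x‖ₑ ^ 2 =
        ENNReal.ofReal (∫ x in interior E, ‖gradient w x‖ ^ 2) := by
      rw [ofReal_integral_eq_lintegral_ofReal hgrad (.of_forall fun x => sq_nonneg _)]
      simp only [enorm_sq_eq_ofReal, norm_gradient]
    have hD : 0 ≤ ∫ x in interior E, ‖gradient w x‖ ^ 2 := integral_nonneg fun x => sq_nonneg _
    rw [e1, e2, show (8 : ℝ≥0∞) = ENNReal.ofReal 8 by simp, ← ENNReal.ofReal_mul hV0.le,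
      ← ENNReal.ofReal_mul (by positivity), ← ENNReal.ofReal_mul (by positivity),
      ← ENNReal.ofReal_mul (by positivity), ENNReal.ofReal_le_ofReal_iff (by positivity)] at hI
    rw [← mul_le_mul_iff_right₀ hV0]
    refine hI.trans_eq ?_
    rw [hV]
    field_simp
  · have h2 := enorm_integral_sq_le hBint.aestronglyMeasurable
    rw [hBuniv] at h2
    have e1 : ∫⁻ x in B, ‖w x‖ₑ ^ 2 ≤ ENNReal.ofReal (∫ x in interior E, w x ^ 2) := by
      rw [ofReal_integral_eq_lintegral_ofReal
        (hE.integrableOn_of_continuousOn (by fun_prop)) (.of_forall fun x => sq_nonneg _)]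
      simp only [← real_enorm_sq]
      exact lintegral_mono_set hE.ball_subset_interior
    have hD : 0 ≤ ∫ x in interior E, w x ^ 2 := integral_nonneg fun x => sq_nonneg _
    have h3 := h2.trans (mul_le_mul_right e1 _)
    rw [real_enorm_sq, ← ENNReal.ofReal_mul hV0.le, ENNReal.ofReal_le_ofReal_iff (by positivity)]
      at h3
    rw [mul_pow, ← mul_le_mul_iff_right₀ hV0]
    refine le_trans (le_of_eq ?_) h3
    field_simp

end IsStarRegion

/-! ### The trace inequality on an edge -/

/-- Iterated integration in the skew coordinates `(s, t) ↦ a + s u + t d`. -/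
lemma lintegral_skew_le {f : Plane → ℝ≥0∞} (hf : Measurable f) (a u d : Plane) :
    ENNReal.ofReal |u 0 * d 1 - u 1 * d 0| * ∫⁻ s : ℝ, ∫⁻ t : ℝ, f (a + s • u + t • d) ≤
      ∫⁻ x, f x := by
  set M : Matrix (Fin 2) (Fin 2) ℝ := !![u 0, d 0; u 1, d 1] with hM
  have hdet : M.det = u 0 * d 1 - u 1 * d 0 := by rw [hM, Matrix.det_fin_two_of]; ring
  rw [← hdet]
  rcases eq_or_ne M.det 0 with h0 | h0
  · simp [h0]
  have hmap : Measurable (Matrix.toLin' M) :=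
    (LinearMap.continuous_of_finiteDimensional (Matrix.toLin' M)).measurable
  have hto : Measurable (WithLp.toLp 2 : (Fin 2 → ℝ) → Plane) :=
    (PiLp.volume_preserving_toLp (Fin 2)).measurable
  have hfa : Measurable fun p : Fin 2 → ℝ => f (a + WithLp.toLp 2 p) :=
    hf.comp (hto.const_add a)
  have e1 : ∫⁻ x, f x = ∫⁻ p : Fin 2 → ℝ, f (a + WithLp.toLp 2 p) := by
    rw [← lintegral_add_left_eq_self f a]
    exact ((PiLp.volume_preserving_toLp (Fin 2)).lintegral_comp
      (hf.comp (measurable_const_add a))).symm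
  have e2 : ∫⁻ p : Fin 2 → ℝ, f (a + WithLp.toLp 2 (Matrix.toLin' M p)) =
      ENNReal.ofReal |M.det⁻¹| * ∫⁻ p : Fin 2 → ℝ, f (a + WithLp.toLp 2 p) := by
    rw [← smul_eq_mul, ← lintegral_smul_measure,
      ← Real.map_matrix_volume_pi_eq_smul_volume_pi h0]
    exact (lintegral_map hfa hmap).symm
  have e3 : ∫⁻ p : Fin 2 → ℝ, f (a + WithLp.toLp 2 (Matrix.toLin' M p)) =
      ∫⁻ s : ℝ, ∫⁻ t : ℝ, f (a + s • u + t • d) := by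
    have hF : Measurable fun q : ℝ × ℝ => f (a + q.1 • u + q.2 • d) :=
      hf.comp (Continuous.measurable (by fun_prop))
    have := (volume_preserving_finTwoArrow ℝ).lintegral_comp hF
    rw [Measure.volume_eq_prod, lintegral_prod _ hF.aemeasurable] at this
    rw [← this]
    refine lintegral_congr fun p => ?_
    congr 1
    rw [add_assoc]
    congr 1
    ext i
    fin_cases i <;> simp [hM, Matrix.toLin'_apply, Matrix.mulVec, dotProduct, Fin.sum_univ_two,
      mul_comm]
  rw [← e3, e2, e1, ← mul_assoc, ← ENNReal.ofReal_mul (abs_nonneg _), ← abs_mul,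
    mul_inv_cancel₀ h0]
  simp

namespace IsStarRegion

variable {E : Set Plane} {c : Plane} {ρ h : ℝ}

/-- The line through a boundary edge keeps distance `ρ` from the center. -/
lemma mul_norm_le_abs_det (hE : IsStarRegion E c ρ h) {a u : Plane}
    (hfr : ∀ s ∈ Icc (0 : ℝ) 1, a + s • u ∈ frontier E) (s₀ : ℝ) :
    ρ * ‖u‖ ≤ |u 0 * (c - (a + s₀ • u)) 1 - u 1 * (c - (a + s₀ • u)) 0| := by
  rcases eq_or_ne u 0 with rfl | hu
  · simp
  have hu' := norm_pos_iff.2 hu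
  have hn2 : ‖u‖ ^ 2 = u 0 ^ 2 + u 1 ^ 2 := by
    rw [EuclideanSpace.norm_sq_eq]; simp [Fin.sum_univ_two]
  have hn2' : 0 < u 0 ^ 2 + u 1 ^ 2 := by rw [← hn2]; positivity
  by_contra! hlt
  -- The parameter of the foot of the perpendicular from `c`; if the claim failed, this foot would
  -- lie in the open kernel ball.
  set r : ℝ := ((c - a) 0 * u 0 + (c - a) 1 * u 1) / (u 0 ^ 2 + u 1 ^ 2) with hr
  have hy : a + r • u ∈ ball c ρ := by
    rw [mem_ball, dist_eq_norm]
    refine lt_of_pow_lt_pow_left₀ 2 hE.pos.le ?_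
    have h1 : ‖a + r • u - c‖ ^ 2 * ‖u‖ ^ 2 =
        (u 0 * (c - (a + s₀ • u)) 1 - u 1 * (c - (a + s₀ • u)) 0) ^ 2 := by
      rw [EuclideanSpace.norm_sq_eq, hn2]
      simp only [Fin.sum_univ_two, PiLp.sub_apply, PiLp.add_apply, PiLp.smul_apply, smul_eq_mul,
        Real.norm_eq_abs, sq_abs, hr]
      field_simp
      ring
    have h2 : (u 0 * (c - (a + s₀ • u)) 1 - u 1 * (c - (a + s₀ • u)) 0) ^ 2 <
        (ρ * ‖u‖) ^ 2 := by
      rw [← sq_abs]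
      exact pow_lt_pow_left₀ hlt (abs_nonneg _) two_ne_zero
    rw [← h1, mul_pow] at h2
    exact lt_of_mul_lt_mul_right h2 (by positivity)
  have hcl := hE.compact.isClosed
  -- The segment from the foot to the more distant endpoint of the edge is interior except at its
  -- end, yet it contains the boundary point with parameter `3 / 4` or `1 / 4`.
  rcases le_or_gt r (1 / 2) with hr1 | hr1
  · have h1 := hfr 1 (by norm_num)
    have h2 := hfr (3 / 4) (by norm_num)
    refine h2.2 ?_
    have hd : 0 < 1 - r := by linarith
    have := hE.segment_mem_interior (hcl.frontier_subset h1) hy (t := (3 / 4 - r) / (1 - r))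
      (div_nonneg (by linarith) hd.le) ((div_lt_one hd).2 (by linarith))
    convert this using 1
    have e : a + (1 : ℝ) • u - (a + r • u) = (1 - r) • u := by module
    rw [e, smul_smul, div_mul_cancel₀ _ hd.ne']
    module
  · have h1 := hfr 0 (by norm_num)
    have h2 := hfr (1 / 4) (by norm_num)
    refine h2.2 ?_
    have hd : 0 < r := by linarith
    have := hE.segment_mem_interior (hcl.frontier_subset h1) hy (t := (r - 1 / 4) / r)
      (div_nonneg (by linarith) hd.le) ((div_lt_one hd).2 (by linarith))
    convert this using 1
    have e : a + (0 : ℝ) • u - (a + r • u) = -(r • u) := by module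
    rw [e, smul_neg, smul_smul, div_mul_cancel₀ _ hd.ne']
    module

/-- The piece of edge is translated in the fixed direction `d` towards the centre. As `ℓ * ‖u‖ < ρ`,
every translate aims at a point of the kernel ball and so remains interior. In the coordinates `(s,
t)` the Jacobian is constant and at least `ρ * ‖u‖` by `mul_norm_le_abs_det`. The layer has relative
depth `τ`, which is what puts the factor `τ ^ 2` in front of the energy. -/
lemma trace_lintegral (hE : IsStarRegion E c ρ h) {w : Plane → ℝ} (hwc : ContinuousOn w E)
    (hw : ContDiffOn ℝ 1 w (interior E)) {a u : Plane}
    (hfr : ∀ s ∈ Icc (0 : ℝ) 1, a + s • u ∈ frontier E)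
    {s₀ s₁ ℓ τ β : ℝ} (hs₀ : 0 ≤ s₀) (hs₁ : s₁ ∈ Icc s₀ (s₀ + ℓ)) (hs₂ : s₀ + ℓ ≤ 1)
    (hℓ : ℓ * ‖u‖ < ρ) (hτ0 : 0 < τ) (hτ1 : τ < 1) (hβ : 0 ≤ β)
    (hwβ : ∀ s ∈ Icc s₀ (s₀ + ℓ), β ≤ |w (a + s • u)|) :
    ENNReal.ofReal (ρ * ‖u‖) * ENNReal.ofReal (ℓ * τ * β ^ 2) ≤
      2 * (∫⁻ x in interior E, ‖w x‖ₑ ^ 2) + 2 * ENNReal.ofReal (τ ^ 2 * h ^ 2) *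
        ∫⁻ x in interior E, ‖fderiv ℝ w x‖ₑ ^ 2 := by
  have hℓ0 : 0 ≤ ℓ := by linarith [hs₁.1.trans hs₁.2]
  have hh : 0 < h := hE.pos.trans_le hE.radius_le
  set Ω := interior E with hΩd
  have hΩ : IsOpen Ω := isOpen_interior
  have hcl := hE.compact.isClosed
  set d : Plane := c - (a + s₁ • u) with hd
  have hs₁' : s₁ ∈ Icc (0 : ℝ) 1 := ⟨hs₀.trans hs₁.1, hs₁.2.trans hs₂⟩
  have hdh : ‖d‖ ≤ h := by
    rw [hd, norm_sub_rev]
    exact hE.norm_sub_le (hcl.frontier_subset (hfr s₁ hs₁'))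
  set G : Plane → ℝ≥0∞ := Ω.indicator fun x => ‖fderiv ℝ w x‖ₑ ^ 2 with hGd
  set W : Plane → ℝ≥0∞ := Ω.indicator fun x => ‖w x‖ₑ ^ 2 with hWd
  have hG : Measurable G :=
    ((measurable_enorm_fderiv w).pow_const 2).indicator hΩ.measurableSet
  have hW : Measurable W := by
    classical
    have h1 : Measurable (Ω.piecewise w 0) :=
      (hwc.mono interior_subset).measurable_piecewise continuousOn_const hΩ.measurableSet
    have h2 : W = fun x => ‖Ω.piecewise w 0 x‖ₑ ^ 2 := by
      funext x
      by_cases hx : x ∈ Ω <;> simp [hWd, hx]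
    rw [h2]
    exact h1.enorm.pow_const 2
  have hmem : ∀ s ∈ Icc s₀ (s₀ + ℓ), ∀ t ∈ Ioo (0 : ℝ) 1, a + s • u + t • d ∈ Ω := by
    intro s hs t ht
    have hsE : a + s • u ∈ E :=
      hcl.frontier_subset (hfr s ⟨hs₀.trans hs.1, hs.2.trans hs₂⟩)
    have hy : c + (s - s₁) • u ∈ ball c ρ := by
      rw [mem_ball, dist_eq_norm, add_sub_cancel_left, norm_smul, Real.norm_eq_abs]
      refine lt_of_le_of_lt ?_ hℓ
      gcongr
      rw [abs_le]
      constructor <;> linarith [hs.1, hs.2, hs₁.1, hs₁.2]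
    have := hE.segment_mem_interior hsE hy (t := 1 - t) (by linarith [ht.2]) (by linarith [ht.1])
    convert this using 1
    rw [hd]
    module
  have step : ∀ s ∈ Icc s₀ (s₀ + ℓ), ENNReal.ofReal (τ * β ^ 2) ≤
      2 * (∫⁻ t : ℝ, W (a + s • u + t • d)) +
      2 * ENNReal.ofReal (τ ^ 2 * h ^ 2) * ∫⁻ t : ℝ, G (a + s • u + t • d) := by
    intro s hs
    set x := a + s • u with hx
    have hxE : x ∈ E := hcl.frontier_subset (hfr s ⟨hs₀.trans hs.1, hs.2.trans hs₂⟩)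
    set J : ℝ≥0∞ := ENNReal.ofReal (τ * h ^ 2) * ∫⁻ t : ℝ, G (x + t • d) with hJ
    have hinc : ∀ t ∈ Ioo 0 τ, ‖w x - w (x + t • d)‖ₑ ^ 2 ≤ J := by
      intro t ht
      have hev : ∀ᶠ δ in 𝓝[>] (0 : ℝ), ‖w (x + δ • d) - w (x + t • d)‖ₑ ^ 2 ≤ J := by
        filter_upwards [Ioo_mem_nhdsGT ht.1] with δ hδ
        have hseg : ∀ r ∈ Icc δ t, x + r • d ∈ Ω := fun r hr =>
          hmem s hs r ⟨hδ.1.trans_le hr.1, hr.2.trans_lt (ht.2.trans hτ1)⟩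
        have := enorm_sub_sq_le_lintegral_segment hΩ hw x d hδ.2.le hseg
        rw [← enorm_neg, neg_sub]
        refine this.trans ?_
        calc _ ≤ ENNReal.ofReal τ * ∫⁻ r in Icc δ t, G (x + r • d) * ENNReal.ofReal (h ^ 2) := by
              refine mul_le_mul' (ENNReal.ofReal_le_ofReal (by linarith [hδ.1, ht.2])) ?_
              refine setLIntegral_mono' measurableSet_Icc fun r hr => ?_
              simp only [hGd, indicator_of_mem (hseg r hr)]
              gcongr
              rw [enorm_sq_eq_ofReal]
              exact ENNReal.ofReal_le_ofReal (by gcongr)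
          _ ≤ ENNReal.ofReal τ * ∫⁻ r, G (x + r • d) * ENNReal.ofReal (h ^ 2) := by
              gcongr
              exact Measure.restrict_le_self
          _ = J := by
              rw [lintegral_mul_const' _ _ ENNReal.ofReal_ne_top, hJ, ENNReal.ofReal_mul hτ0.le]
              ring
      -- Differentiability holds in the interior only, so the fundamental theorem is used from `δ >
      -- 0` on; continuity of `w` up to the boundary permits `δ → 0`.
      have hlim : Tendsto (fun δ : ℝ => ‖w (x + δ • d) - w (x + t • d)‖ₑ ^ 2) (𝓝[>] 0)
          (𝓝 (‖w x - w (x + t • d)‖ₑ ^ 2)) := by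
        have h1 : Tendsto (fun δ : ℝ => x + δ • d) (𝓝[>] 0) (𝓝[E] x) := by
          refine tendsto_nhdsWithin_iff.2 ⟨?_, ?_⟩
          · have : Continuous fun δ : ℝ => x + δ • d := by fun_prop
            exact (this.tendsto' 0 x (by simp)).mono_left nhdsWithin_le_nhds
          · filter_upwards [Ioo_mem_nhdsGT (zero_lt_one' ℝ)] with δ hδ
            exact interior_subset (hmem s hs δ hδ)
        have h2 := (hwc x hxE).tendsto.comp h1
        have h3 : Tendsto (fun δ : ℝ => ‖w (x + δ • d) - w (x + t • d)‖ₑ) (𝓝[>] 0)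
          (𝓝 ‖w x - w (x + t • d)‖ₑ) := (h2.sub_const _).enorm
        exact ((ENNReal.continuous_pow 2).tendsto _).comp h3
      exact le_of_tendsto hlim hev
    have hb : ∀ t ∈ Ioo 0 τ, ENNReal.ofReal (β ^ 2) ≤ 2 * W (x + t • d) + 2 * J := by
      intro t ht
      have h1 : ENNReal.ofReal (β ^ 2) ≤ ‖w x‖ₑ ^ 2 := by
        rw [real_enorm_sq]
        refine ENNReal.ofReal_le_ofReal ?_
        rw [← sq_abs (w x)]
        exact pow_le_pow_left₀ hβ (hwβ s hs) 2
      have h2 : W (x + t • d) = ‖w (x + t • d)‖ₑ ^ 2 :=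
        indicator_of_mem (hmem s hs t ⟨ht.1, ht.2.trans hτ1⟩) _
      rw [h2]
      refine h1.trans ((enorm_sub_sq_le (w x) (w (x + t • d))).trans ?_)
      gcongr
      exact hinc t ht
    calc ENNReal.ofReal (τ * β ^ 2) = ∫⁻ t in Ioo 0 τ, ENNReal.ofReal (β ^ 2) := by
          rw [setLIntegral_const, Real.volume_Ioo, sub_zero, ← ENNReal.ofReal_mul (by positivity),
            mul_comm]
      _ ≤ ∫⁻ t in Ioo 0 τ, (2 * W (x + t • d) + 2 * J) :=
          setLIntegral_mono' measurableSet_Ioo hb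
      _ = 2 * (∫⁻ t in Ioo 0 τ, W (x + t • d)) + 2 * J * ENNReal.ofReal τ := by
          rw [lintegral_add_right _ measurable_const,
            lintegral_const_mul' _ _ (by norm_num), setLIntegral_const, Real.volume_Ioo, sub_zero]
      _ ≤ 2 * (∫⁻ t : ℝ, W (x + t • d)) + 2 * J * ENNReal.ofReal τ := by
          gcongr
          exact Measure.restrict_le_self
      _ = _ := by
          have e : ENNReal.ofReal (τ ^ 2 * h ^ 2) =
              ENNReal.ofReal τ * ENNReal.ofReal (τ * h ^ 2) := by
            rw [← ENNReal.ofReal_mul hτ0.le]; congr 1; ring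
          rw [hJ, e]
          ring
  have hmW : Measurable fun s : ℝ => ∫⁻ t : ℝ, W (a + s • u + t • d) := by
    refine Measurable.lintegral_prod_right' (f := fun q : ℝ × ℝ => W (a + q.1 • u + q.2 • d)) ?_
    exact hW.comp (Continuous.measurable (by fun_prop))
  have hint : ENNReal.ofReal (ℓ * τ * β ^ 2) ≤
      2 * (∫⁻ s : ℝ, ∫⁻ t : ℝ, W (a + s • u + t • d)) +
      2 * ENNReal.ofReal (τ ^ 2 * h ^ 2) * ∫⁻ s : ℝ, ∫⁻ t : ℝ, G (a + s • u + t • d) := by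
    calc ENNReal.ofReal (ℓ * τ * β ^ 2) =
          ∫⁻ s in Icc s₀ (s₀ + ℓ), ENNReal.ofReal (τ * β ^ 2) := by
          rw [setLIntegral_const, Real.volume_Icc, add_sub_cancel_left, mul_assoc,
            ENNReal.ofReal_mul hℓ0, mul_comm]
      _ ≤ ∫⁻ s in Icc s₀ (s₀ + ℓ), (2 * (∫⁻ t : ℝ, W (a + s • u + t • d)) +
          2 * ENNReal.ofReal (τ ^ 2 * h ^ 2) * ∫⁻ t : ℝ, G (a + s • u + t • d)) :=
          setLIntegral_mono' measurableSet_Icc step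
      _ ≤ ∫⁻ s : ℝ, (2 * (∫⁻ t : ℝ, W (a + s • u + t • d)) +
          2 * ENNReal.ofReal (τ ^ 2 * h ^ 2) * ∫⁻ t : ℝ, G (a + s • u + t • d)) :=
          setLIntegral_le_lintegral _ _
      _ = _ := by
          rw [lintegral_add_left (hmW.const_mul 2), lintegral_const_mul' _ _ (by norm_num),
            lintegral_const_mul' _ _ (ENNReal.mul_ne_top (by norm_num) ENNReal.ofReal_ne_top)]
  have hWi : ∫⁻ x, W x = ∫⁻ x in Ω, ‖w x‖ₑ ^ 2 := lintegral_indicator hΩ.measurableSet _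
  have hGi : ∫⁻ x, G x = ∫⁻ x in Ω, ‖fderiv ℝ w x‖ₑ ^ 2 := lintegral_indicator hΩ.measurableSet _
  rw [← hWi, ← hGi]
  have hdet := ENNReal.ofReal_le_ofReal (hE.mul_norm_le_abs_det hfr s₁)
  calc _ ≤ ENNReal.ofReal |u 0 * d 1 - u 1 * d 0| *
        (2 * (∫⁻ s : ℝ, ∫⁻ t : ℝ, W (a + s • u + t • d)) +
        2 * ENNReal.ofReal (τ ^ 2 * h ^ 2) * ∫⁻ s : ℝ, ∫⁻ t : ℝ, G (a + s • u + t • d)) := by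
        gcongr
    _ = 2 * (ENNReal.ofReal |u 0 * d 1 - u 1 * d 0| *
          ∫⁻ s : ℝ, ∫⁻ t : ℝ, W (a + s • u + t • d)) +
        2 * ENNReal.ofReal (τ ^ 2 * h ^ 2) * (ENNReal.ofReal |u 0 * d 1 - u 1 * d 0| *
          ∫⁻ s : ℝ, ∫⁻ t : ℝ, G (a + s • u + t • d)) := by ring
    _ ≤ _ := by
        gcongr
        · exact lintegral_skew_le hW a u d
        · exact lintegral_skew_le hG a u d

/-- The trace inequality: a function which is large on a piece of an edge has large `H¹` norm. -/
lemma trace_inequality (hE : IsStarRegion E c ρ h) {w : Plane → ℝ} (hwc : ContinuousOn w E)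
    (hw : ContDiffOn ℝ 1 w (interior E))
    (hgrad : IntegrableOn (fun x => ‖gradient w x‖ ^ 2) (interior E)) {a u : Plane}
    (hfr : ∀ s ∈ Icc (0 : ℝ) 1, a + s • u ∈ frontier E)
    {s₀ ℓ τ β : ℝ} (hs₀ : 0 ≤ s₀) (hℓ0 : 0 ≤ ℓ) (hs₂ : s₀ + ℓ ≤ 1)
    (hℓ : ℓ * ‖u‖ < ρ) (hτ0 : 0 < τ) (hτ1 : τ < 1) (hβ : 0 ≤ β)
    (hwβ : ∀ s ∈ Icc s₀ (s₀ + ℓ), β ≤ |w (a + s • u)|) :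
    ρ * ‖u‖ * (ℓ * τ * β ^ 2) ≤ 2 * (∫ x in interior E, w x ^ 2) +
      2 * (τ ^ 2 * h ^ 2) * ∫ x in interior E, ‖gradient w x‖ ^ 2 := by
  have hI := hE.trace_lintegral hwc hw hfr hs₀ (s₁ := s₀) ⟨le_rfl, by linarith⟩ hs₂ hℓ hτ0 hτ1
    hβ hwβ
  have hρ := hE.pos
  have e1 : ∫⁻ x in interior E, ‖w x‖ₑ ^ 2 = ENNReal.ofReal (∫ x in interior E, w x ^ 2) := by
    rw [ofReal_integral_eq_lintegral_ofReal
      (hE.integrableOn_of_continuousOn (by fun_prop)) (.of_forall fun x => sq_nonneg _)]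
    simp only [real_enorm_sq]
  have e2 : ∫⁻ x in interior E, ‖fderiv ℝ w x‖ₑ ^ 2 =
      ENNReal.ofReal (∫ x in interior E, ‖gradient w x‖ ^ 2) := by
    rw [ofReal_integral_eq_lintegral_ofReal hgrad (.of_forall fun x => sq_nonneg _)]
    simp only [enorm_sq_eq_ofReal, norm_gradient]
  have hD : 0 ≤ ∫ x in interior E, ‖gradient w x‖ ^ 2 := integral_nonneg fun x => sq_nonneg _
  have hD' : 0 ≤ ∫ x in interior E, w x ^ 2 := integral_nonneg fun x => sq_nonneg _
  rw [e1, e2] at hI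
  generalize ∫ x in interior E, ‖gradient w x‖ ^ 2 = Y at *
  generalize ∫ x in interior E, w x ^ 2 = X at *
  have hu := norm_nonneg u
  generalize ‖u‖ = U at *
  rwa [show (2 : ℝ≥0∞) = ENNReal.ofReal 2 by simp, ← ENNReal.ofReal_mul (by positivity),
    ← ENNReal.ofReal_mul (by positivity), ← ENNReal.ofReal_mul (by positivity),
    ← ENNReal.ofReal_mul (by positivity), ← ENNReal.ofReal_add (by positivity) (by positivity),
    ENNReal.ofReal_le_ofReal_iff (by positivity)] at hI

end IsStarRegion

/-! ### Green's formula with Lipschitz test functions -/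

/-- The line derivative of a continuous function vanishes almost everywhere on its zero set. -/
lemma ae_lineDeriv_eq_zero_of_eq_zero {f : Plane → ℝ} (hf : Continuous f) (v : Plane) :
    ∀ᵐ x, f x = 0 → lineDeriv ℝ f x v = 0 := by
  have hm : MeasurableSet {x | f x = 0 → lineDeriv ℝ f x v = 0} := by
    have h1 : MeasurableSet {x | f x = 0} := hf.measurable (measurableSet_singleton 0)
    have h2 : MeasurableSet {x | lineDeriv ℝ f x v = 0} :=
      (measurable_lineDeriv hf) (measurableSet_singleton 0)
    exact h1.imp h2
  refine ae_mem_of_ae_add_linearMap_mem (LinearMap.toSpanSingleton ℝ Plane v) volume volume hm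
    fun p => ?_
  set S : Set ℝ := {t | f (p + t • v) = 0} with hS
  -- By Fubini one line parallel to `v` suffices. On it only countably many zeros are isolated from
  -- the right; at any other zero the difference quotients vanish along a sequence of zeros, which
  -- forces a zero derivative.
  have hcount := (countable_setOfPred_isolated_right_within (s := S)).ae_notMem volume
  filter_upwards [hcount] with t ht
  simp only [LinearMap.toSpanSingleton_apply]
  intro hft
  by_cases hd : LineDifferentiableAt ℝ f (p + t • v) v
  swap
  · exact lineDeriv_zero_of_not_lineDifferentiableAt hd
  have hne : (𝓝[S ∩ Ioi t] t).NeBot := ⟨fun hbot => ht ⟨hft, hbot⟩⟩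
  have h1 : HasDerivAt (fun s : ℝ => f (p + s • v)) (lineDeriv ℝ f (p + t • v) v) t := by
    have h2 : HasDerivAt (fun s : ℝ => f (p + t • v + s • v)) (lineDeriv ℝ f (p + t • v) v) (t - t) := by
      rw [sub_self]; exact hd.hasLineDerivAt
    have h3 := h2.comp_sub_const t t
    refine h3.congr_of_eventuallyEq (.of_forall fun s => ?_)
    simp only
    congr 1
    module
  have h2 := hasDerivAt_iff_tendsto_slope.1 h1
  have hle : 𝓝[S ∩ Ioi t] t ≤ 𝓝[≠] t := nhdsWithin_mono _ fun s hs => ne_of_gt hs.2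
  have h3 := h2.mono_left hle
  refine tendsto_nhds_unique h3 (tendsto_const_nhds.congr' ?_)
  filter_upwards [self_mem_nhdsWithin] with s hs
  have h4 : f (p + s • v) = 0 := hs.1
  simp [slope_def_field, h4, hft]

/-- Integration by parts against the constant function `1`. -/
lemma integral_lineDeriv_eq_zero {f : Plane → ℝ} {C : ℝ≥0} (hf : LipschitzWith C f)
    (hs : HasCompactSupport f) (v : Plane) : ∫ x, lineDeriv ℝ f x v = 0 := by
  have := (LipschitzWith.const (1 : ℝ)).integral_lineDeriv_mul_eq (μ := (volume : Measure Plane))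
    hf hs (-v)
  simpa [lineDeriv] using this.symm

lemma lineDeriv_eq_zero_of_notMem_tsupport {f : Plane → ℝ} {x : Plane} (hx : x ∉ tsupport f)
    (v : Plane) : lineDeriv ℝ f x v = 0 := by
  have h := notMem_tsupport_iff_eventuallyEq.1 hx
  rw [h.lineDeriv_eq]
  simp [lineDeriv]

lemma integrable_lineDeriv {f : Plane → ℝ} {C : ℝ≥0} (hf : LipschitzWith C f)
    (hs : HasCompactSupport f) (v : Plane) : Integrable fun x => lineDeriv ℝ f x v := by
  have h1 := (hf.locallyIntegrable_lineDeriv (μ := (volume : Measure Plane)) v).integrableOn_isCompact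
    hs.isCompact
  refine (integrableOn_iff_integrable_of_support_subset fun x hx => ?_).1 h1
  by_contra hc
  exact hx (lineDeriv_eq_zero_of_notMem_tsupport hc v)

/-- Near the support, compactness of a thickening gives a Lipschitz constant. A point of the support
and a point outside the thickening have distance at least `1`, so there the sup bound of `f` serves.
-/
lemma exists_lipschitzWith_of_hasCompactSupport {f : Plane → ℝ} (hf : LocallyLipschitz f)
    (hs : HasCompactSupport f) : ∃ C : ℝ≥0, LipschitzWith C f := by
  have hK : IsCompact (cthickening 1 (tsupport f)) := hs.isCompact.cthickening
  obtain ⟨C, hC⟩ := hf.locallyLipschitzOn.exists_lipschitzOnWith_of_compact hK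
  obtain ⟨M, hM⟩ := hs.exists_bound_of_continuous hf.continuous
  have hM0 : 0 ≤ M := (norm_nonneg _).trans (hM 0)
  have key : ∀ x ∈ tsupport f, ∀ y, dist (f x) (f y) ≤ (C + M) * dist x y := by
    intro x hx y
    by_cases hy : y ∈ cthickening 1 (tsupport f)
    · refine (hC.dist_le_mul x (self_subset_cthickening _ hx) y hy).trans ?_
      gcongr
      linarith
    · have hy0 : f y = 0 := by
        by_contra hne
        exact hy (self_subset_cthickening _ (subset_tsupport f hne))
      have hd : 1 ≤ dist x y := by
        by_contra! hlt
        exact hy (mem_cthickening_of_dist_le y x 1 _ hx (by rw [dist_comm]; exact hlt.le))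
      rw [hy0, dist_zero_right]
      have : 0 ≤ (C : ℝ) := C.2
      calc ‖f x‖ ≤ M := hM x
        _ ≤ (C + M) * 1 := by linarith
        _ ≤ _ := by gcongr
  refine ⟨C + Real.toNNReal M, LipschitzWith.of_dist_le_mul fun x y => ?_⟩
  rw [NNReal.coe_add, Real.coe_toNNReal _ hM0]
  by_cases hx : x ∈ tsupport f
  · exact key x hx y
  by_cases hy : y ∈ tsupport f
  · rw [dist_comm, dist_comm x]; exact key y hy x
  · rw [image_eq_zero_of_notMem_tsupport hx, image_eq_zero_of_notMem_tsupport hy, dist_self]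
    have : 0 ≤ (C : ℝ) := C.2
    positivity

/-- The standard basis vectors. -/
noncomputable abbrev basisVec (i : Fin 2) : Plane := EuclideanSpace.single i (1 : ℝ)

lemma laplacian_eq_sum (z : Plane → ℝ) (x : Plane) :
    Laplacian.laplacian z x = ∑ i, fderiv ℝ (fderiv ℝ z) x (basisVec i) (basisVec i) := by
  have h := congrFun (InnerProductSpace.laplacian_eq_iteratedFDeriv_orthonormalBasis z
    (EuclideanSpace.basisFun (Fin 2) ℝ)) x
  refine h.trans ?_
  simp [iteratedFDeriv_two_apply, EuclideanSpace.basisFun_apply]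

lemma norm_gradient_sq (w : Plane → ℝ) (x : Plane) :
    ‖gradient w x‖ ^ 2 = ∑ i, fderiv ℝ w x (basisVec i) ^ 2 := by
  rw [EuclideanSpace.norm_sq_eq]
  refine Finset.sum_congr rfl fun i _ => ?_
  have : inner ℝ (gradient w x) (basisVec i) = fderiv ℝ w x (basisVec i) := by
    rw [gradient, InnerProductSpace.toDual_symm_apply]
  rw [← this, real_inner_comm, EuclideanSpace.inner_single_left]
  simp

lemma LipschitzOnWith.exists_mul {f g : Plane → ℝ} {x : Plane}
    (hf : ∃ K, ∃ t ∈ 𝓝 x, LipschitzOnWith K f t) (hg : ∃ K, ∃ t ∈ 𝓝 x, LipschitzOnWith K g t) :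
    ∃ K, ∃ t ∈ 𝓝 x, LipschitzOnWith K (fun y => f y * g y) t := by
  obtain ⟨Kf, t, ht, hf⟩ := hf
  obtain ⟨Kg, s, hs, hg⟩ := hg
  have hmul : ContDiffAt ℝ 1 (fun p : ℝ × ℝ => p.1 * p.2) (f x, g x) := by fun_prop
  obtain ⟨K, r, hr, hK⟩ := hmul.exists_lipschitzOnWith
  have hcf : ContinuousAt f x := hf.continuousOn.continuousAt ht
  have hcg : ContinuousAt g x := hg.continuousOn.continuousAt hs
  have hpre : (fun y => (f y, g y)) ⁻¹' r ∈ 𝓝 x := (hcf.prodMk hcg) hr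
  refine ⟨K * max Kf Kg, (t ∩ s) ∩ (fun y => (f y, g y)) ⁻¹' r,
    inter_mem (inter_mem ht hs) hpre, ?_⟩
  have h1 : LipschitzOnWith (max Kf Kg) (fun y => (f y, g y))
      ((t ∩ s) ∩ (fun y => (f y, g y)) ⁻¹' r) :=
    (hf.mono fun y hy => hy.1.1).prodMk (hg.mono fun y hy => hy.1.2)
  exact hK.comp h1 fun y hy => hy.2

/-- Green's formula for a `C²` function and a compactly supported Lipschitz function. -/
lemma green {Ω : Set Plane} (hΩ : IsOpen Ω) {z ψ : Plane → ℝ} (hz : ContDiffOn ℝ 2 z Ω)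
    {C : ℝ≥0} (hψ : LipschitzWith C ψ) (hs : HasCompactSupport ψ) (hsub : tsupport ψ ⊆ Ω) :
    Integrable (fun x => ∑ i, fderiv ℝ z x (basisVec i) * lineDeriv ℝ ψ x (basisVec i)) ∧
    ∫ x, ∑ i, fderiv ℝ z x (basisVec i) * lineDeriv ℝ ψ x (basisVec i) =
      -∫ x, Laplacian.laplacian z x * ψ x := by
  have hz1 : ContDiffOn ℝ 1 (fderiv ℝ z) Ω := hz.fderiv_of_isOpen hΩ (by norm_num)
  have hzi : ∀ i, ContDiffOn ℝ 1 (fun x => fderiv ℝ z x (basisVec i)) Ω := fun i =>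
    hz1.clm_apply contDiffOn_const
  have hz2 : ∀ i, ContinuousOn (fun x => fderiv ℝ (fderiv ℝ z) x (basisVec i) (basisVec i)) Ω :=
    fun i => ((hz1.continuousOn_fderiv_of_isOpen hΩ le_rfl).clm_apply
      continuousOn_const).clm_apply continuousOn_const
  -- The products `∂ᵢz ψ` are compactly supported and Lipschitz, so their line derivatives integrate
  -- to zero; the product rule, valid almost everywhere, then yields Green's formula.
  set H : Fin 2 → Plane → ℝ := fun i x => fderiv ℝ z x (basisVec i) * ψ x with hH
  have hHsub : ∀ i, tsupport (H i) ⊆ tsupport ψ := fun i =>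
    tsupport_mul_subset_right (f := fun x => fderiv ℝ z x (basisVec i)) (g := ψ)
  have hHs : ∀ i, HasCompactSupport (H i) := fun i => hs.mul_left
  have hHloc : ∀ i, LocallyLipschitz (H i) := by
    intro i x
    by_cases hx : x ∈ Ω
    · exact LipschitzOnWith.exists_mul
        ((hzi i).contDiffAt (hΩ.mem_nhds hx)).exists_lipschitzOnWith
        ⟨C, univ, univ_mem, hψ.lipschitzOnWith⟩
    · have h0 := notMem_tsupport_iff_eventuallyEq.1 fun hc => hx (hsub (hHsub i hc))
      refine ⟨0, _, h0, LipschitzOnWith.of_dist_le_mul fun y hy w hw => ?_⟩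
      have e1 : H i y = 0 := hy
      have e2 : H i w = 0 := hw
      simp [e1, e2]
  choose D hD using fun i => exists_lipschitzWith_of_hasCompactSupport (hHloc i) (hHs i)
  set P : Fin 2 → Plane → ℝ := fun i x =>
    fderiv ℝ (fderiv ℝ z) x (basisVec i) (basisVec i) * ψ x with hP
  have hPi : ∀ i, Integrable (P i) := by
    intro i
    have hc : ContinuousOn (P i) (tsupport ψ) :=
      ((hz2 i).mono hsub).mul hψ.continuous.continuousOn
    refine (integrableOn_iff_integrable_of_support_subset fun x hx => ?_).1
      (hc.integrableOn_compact hs.isCompact)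
    exact subset_tsupport ψ (right_ne_zero_of_mul hx)
  have hae : ∀ i, ∀ᵐ x, fderiv ℝ z x (basisVec i) * lineDeriv ℝ ψ x (basisVec i) =
      lineDeriv ℝ (H i) x (basisVec i) - P i x := by
    intro i
    filter_upwards [hψ.ae_lineDifferentiableAt (μ := (volume : Measure Plane)) (basisVec i)]
      with x hx
    by_cases hxs : x ∈ tsupport ψ
    · have h1 : HasFDerivAt (fderiv ℝ z) (fderiv ℝ (fderiv ℝ z) x) x :=
        ((hz1.contDiffAt (hΩ.mem_nhds (hsub hxs))).differentiableAt one_ne_zero).hasFDerivAt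
      have h2 : HasLineDerivAt ℝ (fun y => fderiv ℝ z y (basisVec i))
          (fderiv ℝ (fderiv ℝ z) x (basisVec i) (basisVec i)) x (basisVec i) := by
        have := (h1.clm_apply (hasFDerivAt_const (basisVec i) x)).hasLineDerivAt (basisVec i)
        simpa using this
      have h3 : HasLineDerivAt ℝ (H i) _ x (basisVec i) := HasDerivAt.mul h2 hx.hasLineDerivAt
      rw [h3.lineDeriv]
      simp [hP]
    · have hxs' : x ∉ tsupport (H i) := fun hc => hxs (hHsub i hc)
      rw [lineDeriv_eq_zero_of_notMem_tsupport hxs, lineDeriv_eq_zero_of_notMem_tsupport hxs', hP]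
      simp [image_eq_zero_of_notMem_tsupport hxs]
  have hint : ∀ i, Integrable fun x =>
      fderiv ℝ z x (basisVec i) * lineDeriv ℝ ψ x (basisVec i) := fun i =>
    (((integrable_lineDeriv (hD i) (hHs i) _).sub (hPi i)).congr
      ((hae i).mono fun x hx => hx.symm))
  refine ⟨integrable_finsetSum _ fun i _ => hint i, ?_⟩
  rw [integral_finsetSum _ fun i _ => hint i]
  have hone : ∀ i, ∫ x, fderiv ℝ z x (basisVec i) * lineDeriv ℝ ψ x (basisVec i) =
      -∫ x, P i x := by
    intro i
    rw [integral_congr_ae (hae i), integral_sub (integrable_lineDeriv (hD i) (hHs i) _) (hPi i),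
      integral_lineDeriv_eq_zero (hD i) (hHs i), zero_sub]
  simp_rw [hone]
  rw [Finset.sum_neg_distrib, ← integral_finsetSum _ fun i _ => hPi i]
  congr 1
  refine integral_congr_ae (.of_forall fun x => ?_)
  simp only [hP, laplacian_eq_sum, Finset.sum_mul]

/-! ### The energy estimate -/

/-- The part of `t` exceeding `ε` in absolute value. -/
noncomputable def excess (ε t : ℝ) : ℝ := t - max (-ε) (min t ε)

lemma excess_eq_zero {ε t : ℝ} (ht : |t| ≤ ε) : excess ε t = 0 := by
  rw [abs_le] at ht
  rw [excess, min_eq_left ht.2, max_eq_right ht.1, sub_self]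

lemma abs_excess_sub_le {ε : ℝ} (hε : 0 ≤ ε) (t : ℝ) : |excess ε t - t| ≤ ε := by
  rw [excess, sub_sub_cancel_left, abs_neg, abs_le]
  exact ⟨le_max_left _ _, max_le (by linarith) (min_le_right _ _)⟩

lemma lipschitzWith_excess (ε : ℝ) : LipschitzWith 2 (excess ε) := by
  have h := LipschitzWith.id.sub ((LipschitzWith.id.min_const ε).const_max (-ε) : LipschitzWith 1 _)
  rw [one_add_one_eq_two] at h
  exact h

lemma hasDerivAt_excess {ε t : ℝ} (hε : 0 ≤ ε) (ht : ε < |t|) : HasDerivAt (excess ε) 1 t := by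
  rcases lt_abs.1 ht with h | h
  · refine ((hasDerivAt_id t).sub_const ε).congr_of_eventuallyEq ?_
    filter_upwards [lt_mem_nhds h] with s hs
    rw [excess, min_eq_right hs.le, max_eq_right (by linarith)]
    rfl
  · refine ((hasDerivAt_id t).sub_const (-ε)).congr_of_eventuallyEq ?_
    filter_upwards [gt_mem_nhds (show t < -ε by linarith)] with s hs
    rw [excess, min_eq_left (by linarith), max_eq_left hs.le]
    rfl

lemma IsStarRegion.measure_interior_lt_top {E : Set Plane} {c : Plane} {ρ h : ℝ}
    (hE : IsStarRegion E c ρ h) : volume (interior E) < ⊤ :=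
  (measure_mono interior_subset).trans_lt hE.compact.measure_lt_top

/-- Since `z - g` vanishes on the boundary, its excess over `ε` has compact support in the interior
and is admissible in Green's formula. Where `|z - g| > ε` its gradient is `∇z - ∇g`, and Young's
inequality bounds `|∇z|²`. Where `z - g = 0`, almost everywhere `∇z = ∇g`. Outside the set of
integration the excess vanishes and its derivative is zero almost everywhere. Replacing the excess
by `z - g` in the source term costs the summand with `ε`. -/
lemma IsStarRegion.energy_excess_le {E : Set Plane} {c : Plane} {ρ h : ℝ}
    (hE : IsStarRegion E c ρ h) {z p g : Plane → ℝ} {Λ : ℝ≥0} (hzc : ContinuousOn z E)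
    (hz : ContDiffOn ℝ 2 z (interior E))
    (hgrad : IntegrableOn (fun x => ‖gradient z x‖ ^ 2) (interior E)) (hp : Continuous p)
    (hlap : ∀ x ∈ interior E, Laplacian.laplacian z x = p x) (hg : LipschitzWith Λ g)
    (hgz : ∀ x ∈ frontier E, g x = z x) {ε : ℝ} (hε : 0 < ε) :
    ∫ x in {x ∈ interior E | z x - g x = 0 ∨ ε < |z x - g x|}, ‖gradient z x‖ ^ 2 ≤
      2 * Λ ^ 2 * volume.real (interior E) - 2 * (∫ x in interior E, p x * (z x - g x)) +
        2 * ε * ∫ x in interior E, |p x| := by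
  set Ω := interior E with hΩd
  have hΩ : IsOpen Ω := isOpen_interior
  have hVfin := hE.measure_interior_lt_top
  have hcl := hE.compact.isClosed
  set F : Plane → ℝ := E.indicator fun x => z x - g x with hFd
  have hFΩ : ∀ x ∈ Ω, F x = z x - g x := fun x hx => indicator_of_mem (interior_subset hx) _
  have hFoff : ∀ x, x ∉ Ω → F x = 0 := by
    intro x hx
    by_cases hxE : x ∈ E
    · have hxf : x ∈ frontier E := ⟨subset_closure hxE, hx⟩
      simp [hFd, indicator_of_mem hxE, hgz x hxf]
    · exact indicator_of_notMem hxE _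
  have hFc : Continuous F := by
    refine continuous_indicator (fun x hx => by simp [hgz x hx]) ?_
    rw [hcl.closure_eq]
    exact hzc.sub hg.continuous.continuousOn
  set ψ : Plane → ℝ := fun x => excess ε (F x) with hψd
  have hψc : Continuous ψ := (lipschitzWith_excess ε).continuous.comp hFc
  have hts : tsupport ψ ⊆ {x | ε ≤ |F x|} := by
    refine closure_minimal (fun x hx => ?_) (isClosed_le continuous_const hFc.abs)
    by_contra hlt
    exact hx (excess_eq_zero (not_le.1 hlt).le)
  have htsΩ : tsupport ψ ⊆ Ω := by
    intro x hx
    by_contra hc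
    have h1 : ε ≤ |F x| := hts hx
    rw [hFoff x hc, abs_zero] at h1
    linarith
  have hψs : HasCompactSupport ψ :=
    hE.compact.of_isClosed_subset (isClosed_tsupport ψ) (htsΩ.trans interior_subset)
  have hz1 : ∀ x ∈ Ω, ContDiffAt ℝ 2 z x := fun x hx => hz.contDiffAt (hΩ.mem_nhds hx)
  have hFz : ∀ x ∈ Ω, F =ᶠ[𝓝 x] fun y => z y - g y := fun x hx => by
    filter_upwards [hΩ.mem_nhds hx] with y hy using hFΩ y hy
  have hψloc : LocallyLipschitz ψ := by
    intro x
    by_cases hx : x ∈ Ω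
    · obtain ⟨K, t, ht, hK⟩ := ((hz1 x hx).of_le (by norm_num)).exists_lipschitzOnWith
      refine ⟨2 * (K + Λ), t ∩ Ω, inter_mem ht (hΩ.mem_nhds hx), ?_⟩
      have h1 : LipschitzOnWith (K + Λ) F (t ∩ Ω) := by
        have h2 := (hK.mono (inter_subset_left (t := Ω))).sub (hg.lipschitzOnWith (s := t ∩ Ω))
        intro y hy w hw
        rw [hFΩ y hy.2, hFΩ w hw.2]
        exact h2 hy hw
      exact (lipschitzWith_excess ε).comp_lipschitzOnWith h1
    · have h0 := notMem_tsupport_iff_eventuallyEq.1 fun hc => hx (htsΩ hc)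
      refine ⟨0, _, h0, LipschitzOnWith.of_dist_le_mul fun y hy w hw => ?_⟩
      have e1 : ψ y = 0 := hy
      have e2 : ψ w = 0 := hw
      simp [e1, e2]
  obtain ⟨C, hψl⟩ := exists_lipschitzWith_of_hasCompactSupport hψloc hψs
  obtain ⟨hSint, hgreen⟩ := green hΩ hz hψl hψs htsΩ
  set σf : Plane → ℝ := fun x => ∑ i, fderiv ℝ z x (basisVec i) * lineDeriv ℝ ψ x (basisVec i)
    with hsf
  set S : Set Plane := {x ∈ Ω | z x - g x = 0 ∨ ε < |z x - g x|} with hSd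
  have hSm : MeasurableSet S := by
    have e : S = Ω ∩ ({x | F x = 0} ∪ {x | ε < |F x|}) := by
      ext x
      constructor
      · rintro ⟨hx, hx'⟩
        refine ⟨hx, ?_⟩
        simpa [hFΩ x hx] using hx'
      · rintro ⟨hx, hx'⟩
        refine ⟨hx, ?_⟩
        simpa [hFΩ x hx] using hx'
    rw [e]
    exact hΩ.measurableSet.inter ((hFc.measurable (measurableSet_singleton 0)).union
      (isOpen_lt continuous_const hFc.abs).measurableSet)
  have hSΩ : S ⊆ Ω := fun x hx => hx.1
  have hglip : ∀ x i, lineDeriv ℝ g x (basisVec i) ^ 2 ≤ (Λ : ℝ) ^ 2 := by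
    intro x i
    have := norm_lineDeriv_le_of_lipschitz ℝ hg (x₀ := x) (v := basisVec i)
    rw [← sq_abs]
    refine pow_le_pow_left₀ (abs_nonneg _) ?_ 2
    simpa using this
  have hae1 : ∀ᵐ x, x ∈ S → ‖gradient z x‖ ^ 2 ≤ 2 * (Λ : ℝ) ^ 2 + 2 * σf x := by
    have A : ∀ᵐ x, ∀ i, LineDifferentiableAt ℝ g x (basisVec i) :=
      ae_all_iff.2 fun i => hg.ae_lineDifferentiableAt (basisVec i)
    have B : ∀ᵐ x, ∀ i, F x = 0 → lineDeriv ℝ F x (basisVec i) = 0 :=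
      ae_all_iff.2 fun i => ae_lineDeriv_eq_zero_of_eq_zero hFc (basisVec i)
    have D : ∀ᵐ x, ∀ i, ψ x = 0 → lineDeriv ℝ ψ x (basisVec i) = 0 :=
      ae_all_iff.2 fun i => ae_lineDeriv_eq_zero_of_eq_zero hψc (basisVec i)
    filter_upwards [A, B, D] with x hA hB hD hxS
    have hx := hSΩ hxS
    have hFd' : ∀ i, HasLineDerivAt ℝ F
        (fderiv ℝ z x (basisVec i) - lineDeriv ℝ g x (basisVec i)) x (basisVec i) := by
      intro i
      have h1 : HasLineDerivAt ℝ z (fderiv ℝ z x (basisVec i)) x (basisVec i) :=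
        ((hz1 x hx).differentiableAt (by norm_num)).hasFDerivAt.hasLineDerivAt _
      have h2 : HasLineDerivAt ℝ (fun y => z y - g y) _ x (basisVec i) :=
        HasDerivAt.sub h1 (hA i).hasLineDerivAt
      exact h2.congr_of_eventuallyEq (hFz x hx)
    have hsum := norm_gradient_sq z x
    rw [Fin.sum_univ_two] at hsum
    have g0 := hglip x 0
    have g1 := hglip x 1
    rcases hxS.2 with h0 | hgt
    · have hF0 : F x = 0 := by rw [hFΩ x hx, h0]
      have hψ0 : ψ x = 0 := by simp only [hψd]; exact excess_eq_zero (by simp [hF0, hε.le])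
      have e0 := (hFd' 0).lineDeriv.symm.trans (hB 0 hF0)
      have e1 := (hFd' 1).lineDeriv.symm.trans (hB 1 hF0)
      rw [sub_eq_zero] at e0 e1
      have hsf0 : σf x = 0 := by simp [hsf, hD _ hψ0]
      rw [hsum, hsf0, e0, e1]
      linarith
    · rw [← hFΩ x hx] at hgt
      have hψ' : ∀ i, lineDeriv ℝ ψ x (basisVec i) =
          fderiv ℝ z x (basisVec i) - lineDeriv ℝ g x (basisVec i) := by
        intro i
        have h1 : HasDerivAt (excess ε) 1 (F (x + (0 : ℝ) • basisVec i)) := by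
          simpa using hasDerivAt_excess hε.le hgt
        have h2 : HasDerivAt (fun t : ℝ => excess ε (F (x + t • basisVec i)))
            (1 * (fderiv ℝ z x (basisVec i) - lineDeriv ℝ g x (basisVec i))) 0 :=
          have h0 : HasDerivAt (fun t : ℝ => F (x + t • basisVec i))
            (fderiv ℝ z x (basisVec i) - lineDeriv ℝ g x (basisVec i)) 0 := hFd' i
          HasDerivAt.comp (h₂ := excess ε) (h := fun t : ℝ => F (x + t • basisVec i)) (0 : ℝ) h1 h0
        have h3 : HasLineDerivAt ℝ ψ _ x (basisVec i) := h2
        rw [h3.lineDeriv, one_mul]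
      have hsfx : σf x = ∑ i, fderiv ℝ z x (basisVec i) *
          (fderiv ℝ z x (basisVec i) - lineDeriv ℝ g x (basisVec i)) := by
        simp only [hsf, hψ']
      rw [hsum, hsfx, Fin.sum_univ_two]
      nlinarith [sq_nonneg (fderiv ℝ z x (basisVec 0) - lineDeriv ℝ g x (basisVec 0)),
        sq_nonneg (fderiv ℝ z x (basisVec 1) - lineDeriv ℝ g x (basisVec 1))]
  have hae2 : ∀ᵐ x, x ∉ S → σf x = 0 := by
    have D : ∀ᵐ x, ∀ i, ψ x = 0 → lineDeriv ℝ ψ x (basisVec i) = 0 :=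
      ae_all_iff.2 fun i => ae_lineDeriv_eq_zero_of_eq_zero hψc (basisVec i)
    filter_upwards [D] with x hD hxS
    have hψ0 : ψ x = 0 := by
      by_cases hx : x ∈ Ω
      · simp only [hψd]
        refine excess_eq_zero ?_
        rw [hFΩ x hx]
        by_contra hlt
        exact hxS ⟨hx, Or.inr (not_le.1 hlt)⟩
      · exact image_eq_zero_of_notMem_tsupport fun hc => hx (htsΩ hc)
    simp [hsf, hD _ hψ0]
  have hSsf : ∫ x in S, σf x = ∫ x, σf x := by
    rw [← integral_indicator hSm]
    refine integral_congr_ae ?_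
    filter_upwards [hae2] with x hx
    by_cases hxS : x ∈ S
    · rw [indicator_of_mem hxS]
    · rw [indicator_of_notMem hxS, hx hxS]
  have hVS : volume S < ⊤ := (measure_mono hSΩ).trans_lt hVfin
  have hpcont : ∀ f : Plane → ℝ, ContinuousOn f E → IntegrableOn f Ω :=
    fun f hf => hE.integrableOn_of_continuousOn hf
  have hrhs : -∫ x, Laplacian.laplacian z x * ψ x ≤
      -(∫ x in Ω, p x * (z x - g x)) + ε * ∫ x in Ω, |p x| := by
    have e1 : ∫ x, Laplacian.laplacian z x * ψ x = ∫ x in Ω, p x * ψ x := by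
      rw [← integral_indicator hΩ.measurableSet]
      refine integral_congr_ae (.of_forall fun x => ?_)
      by_cases hx : x ∈ Ω
      · simp only [indicator_of_mem hx, hlap x hx]
      · have : ψ x = 0 := image_eq_zero_of_notMem_tsupport fun hc => hx (htsΩ hc)
        simp only [indicator_of_notMem hx, this, mul_zero]
    have i1 : IntegrableOn (fun x => p x * ψ x) Ω :=
      hpcont _ (hp.mul hψc).continuousOn
    have i2 : IntegrableOn (fun x => p x * (z x - g x)) Ω :=
      hpcont _ (hp.continuousOn.mul (hzc.sub hg.continuous.continuousOn))
    have i2' : IntegrableOn (fun x => -(p x * (z x - g x))) Ω := i2.neg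
    have i3 : IntegrableOn (fun x => |p x|) Ω := hpcont _ hp.abs.continuousOn
    rw [e1, ← integral_const_mul, ← integral_neg, ← integral_neg,
      ← integral_add i2' (i3.const_mul ε)]
    refine setIntegral_mono_on i1.neg (i2'.add (i3.const_mul ε)) hΩ.measurableSet fun x hx => ?_
    have h1 := abs_excess_sub_le hε.le (F x)
    have h2 : -(p x * (ψ x - F x)) ≤ |p x| * ε := by
      refine (neg_le_abs _).trans ?_
      rw [abs_mul]
      gcongr
    rw [hFΩ x hx] at h2
    linarith
  have i4 : IntegrableOn (fun _ : Plane => 2 * (Λ : ℝ) ^ 2) S := integrableOn_const hVS.ne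
  have i5 : IntegrableOn (fun x => 2 * σf x) S := hSint.integrableOn.const_mul 2
  calc ∫ x in S, ‖gradient z x‖ ^ 2 ≤ ∫ x in S, (2 * (Λ : ℝ) ^ 2 + 2 * σf x) := by
        refine setIntegral_mono_on_ae (hgrad.mono_set hSΩ) (i4.add i5) hSm hae1
    _ = 2 * (Λ : ℝ) ^ 2 * volume.real S + 2 * ∫ x, σf x := by
        rw [integral_add i4 i5,
          integral_const_mul (2 : ℝ) σf, hSsf, setIntegral_const, smul_eq_mul, mul_comm]
    _ ≤ 2 * (Λ : ℝ) ^ 2 * volume.real Ω + 2 * (-(∫ x in Ω, p x * (z x - g x)) +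
          ε * ∫ x in Ω, |p x|) := by
        rw [hgreen]
        gcongr
        exact hVfin.ne
    _ = _ := by ring

/-- The energy estimate for Poisson's equation with a Lipschitz extension `g` of the boundary
values. -/
lemma IsStarRegion.energy_le {E : Set Plane} {c : Plane} {ρ h : ℝ}
    (hE : IsStarRegion E c ρ h) {z p g : Plane → ℝ} {Λ : ℝ≥0} (hzc : ContinuousOn z E)
    (hz : ContDiffOn ℝ 2 z (interior E))
    (hgrad : IntegrableOn (fun x => ‖gradient z x‖ ^ 2) (interior E)) (hp : Continuous p)
    (hlap : ∀ x ∈ interior E, Laplacian.laplacian z x = p x) (hg : LipschitzWith Λ g)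
    (hgz : ∀ x ∈ frontier E, g x = z x) :
    ∫ x in interior E, ‖gradient z x‖ ^ 2 ≤
      2 * Λ ^ 2 * volume.real (interior E) - 2 * ∫ x in interior E, p x * (z x - g x) := by
  set A := 2 * (Λ : ℝ) ^ 2 * volume.real (interior E) -
    2 * ∫ x in interior E, p x * (z x - g x) with hA
  set ε : ℕ → ℝ := fun n => 1 / ((n : ℝ) + 1) with hεd
  have hε : ∀ n, 0 < ε n := fun n => by positivity
  have hε0 : Tendsto ε atTop (𝓝 0) := tendsto_one_div_add_atTop_nhds_zero_nat
  set S : ℕ → Set Plane :=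
    fun n => {x ∈ interior E | z x - g x = 0 ∨ ε n < |z x - g x|} with hS
  have hc : ContinuousOn (fun x => z x - g x) (interior E) :=
    (hzc.sub hg.continuous.continuousOn).mono interior_subset
  have hSm : ∀ n, MeasurableSet (S n) := by
    intro n
    obtain ⟨U, hU, hUe⟩ := (_root_.continuousOn_iff'.1 hc.abs) (Ioi (ε n)) isOpen_Ioi
    obtain ⟨V, hV, hVe⟩ := (_root_.continuousOn_iff'.1 hc) {0}ᶜ isOpen_compl_singleton
    have e : S n = (interior E \ (V ∩ interior E)) ∪ (U ∩ interior E) := by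
      rw [← hUe, ← hVe]
      ext x
      by_cases hx : x ∈ interior E
      · simp [hS, hx]
      · simp [hS, hx]
    rw [e]
    exact (isOpen_interior.measurableSet.diff (hV.inter isOpen_interior).measurableSet).union
      (hU.inter isOpen_interior).measurableSet
  have hmono : Monotone S := by
    intro n m hnm x hx
    refine ⟨hx.1, hx.2.imp_right fun h => lt_of_le_of_lt ?_ h⟩
    exact one_div_le_one_div_of_le (by positivity) (by gcongr)
  have hU : ⋃ n, S n = interior E := by
    refine Subset.antisymm (iUnion_subset fun n x hx => hx.1) fun x hx => ?_
    by_cases h0 : z x - g x = 0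
    · exact mem_iUnion.2 ⟨0, hx, Or.inl h0⟩
    · obtain ⟨n, hn⟩ := exists_nat_one_div_lt (abs_pos.2 h0)
      exact mem_iUnion.2 ⟨n, hx, Or.inr hn⟩
  -- These sets exhaust the interior as `ε → 0`; the zero set of `z - g` would be missed in the
  -- limit had it not been included in each of them.
  have hlim := tendsto_setIntegral_of_monotone (f := fun x => ‖gradient z x‖ ^ 2) hSm hmono
    (μ := volume) (by rw [hU]; exact hgrad)
  rw [hU] at hlim
  have hlim2 : Tendsto (fun n => A + 2 * ε n * ∫ x in interior E, |p x|) atTop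
      (𝓝 (A + 2 * 0 * ∫ x in interior E, |p x|)) :=
    tendsto_const_nhds.add ((hε0.const_mul 2).mul_const _)
  rw [mul_zero, zero_mul, add_zero] at hlim2
  exact le_of_tendsto_of_tendsto' hlim hlim2 fun n =>
    hE.energy_excess_le hzc hz hgrad hp hlap hg hgz (hε n)

/-! ### Polynomials on an edge -/

/-- Rolle's theorem between consecutive points of `S`. -/
lemma exists_roots_derivative (p : ℝ[X]) {n : ℕ} (S : Finset ℝ) (hS : ∀ t ∈ S, t ∈ Icc (0 : ℝ) 1)
    (hp : ∀ t ∈ S, p.eval t = 0) (hn : S.card = n + 1) :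
    ∃ S' : Finset ℝ, (∀ t ∈ S', t ∈ Ioo (0 : ℝ) 1) ∧ (∀ t ∈ S', (derivative p).eval t = 0) ∧
      S'.card = n := by
  set s := S.orderEmbOfFin hn with hs
  have hmem : ∀ i, s i ∈ S := fun i => S.orderEmbOfFin_mem hn i
  have h : ∀ i : Fin n, ∃ t ∈ Ioo (s i.castSucc) (s i.succ), (derivative p).eval t = 0 := by
    intro i
    obtain ⟨t, ht, ht'⟩ := exists_deriv_eq_zero (f := fun x => p.eval x)
      (s.strictMono i.castSucc_lt_succ) p.continuous.continuousOn
      (by simp only [hp _ (hmem _)])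
    exact ⟨t, ht, by simpa using ht'⟩
  choose t ht ht' using h
  have hmono : StrictMono t := by
    intro i j hij
    have h1 : s i.succ ≤ s j.castSucc := s.monotone (Fin.succ_le_castSucc_iff.2 hij)
    exact (ht i).2.trans_le (h1.trans (ht j).1.le)
  refine ⟨Finset.univ.image t, ?_, ?_, ?_⟩
  · intro x hx
    obtain ⟨i, -, rfl⟩ := Finset.mem_image.1 hx
    exact ⟨(hS _ (hmem _)).1.trans_lt (ht i).1, (ht i).2.trans_le (hS _ (hmem _)).2⟩
  · intro x hx
    obtain ⟨i, -, rfl⟩ := Finset.mem_image.1 hx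
    exact ht' i
  · rw [Finset.card_image_of_injective _ hmono.injective]
    simp

/-- As long as `j < n`, both endpoints are still roots of the `j`-th derivative. With the `j`
interior roots this makes `j + 2` points, between which Rolle's theorem yields `j + 1` interior
roots of the next derivative. -/
lemma exists_roots_rodrigues (n : ℕ) : ∀ j ≤ n, ∃ S : Finset ℝ, (∀ t ∈ S, t ∈ Ioo (0 : ℝ) 1) ∧
    (∀ t ∈ S, (derivative^[j] (X ^ n * (1 - X) ^ n : ℝ[X])).eval t = 0) ∧ S.card = j := by
  intro j
  induction j with
  | zero => intro _; exact ⟨∅, by simp, by simp, by simp⟩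
  | succ j ih =>
    intro hj
    obtain ⟨S, hS, hroot, hcard⟩ := ih (by omega)
    have hne : n - j ≠ 0 := by omega
    have h0 : (derivative^[j] (X ^ n * (1 - X) ^ n : ℝ[X])).eval 0 = 0 := by
      obtain ⟨r, hr⟩ := pow_sub_dvd_iterate_derivative_of_pow_dvd (p := (X ^ n * (1 - X) ^ n : ℝ[X]))
        (q := X) (n := n) j (dvd_mul_right _ _)
      rw [hr]; simp [hne]
    have h1 : (derivative^[j] (X ^ n * (1 - X) ^ n : ℝ[X])).eval 1 = 0 := by
      obtain ⟨r, hr⟩ := pow_sub_dvd_iterate_derivative_of_pow_dvd (p := (X ^ n * (1 - X) ^ n : ℝ[X]))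
        (q := 1 - X) (n := n) j (dvd_mul_left _ _)
      rw [hr]; simp [hne]
    have hn1 : (1 : ℝ) ∉ S := fun hc => absurd (hS 1 hc).2 (lt_irrefl _)
    have hn0 : (0 : ℝ) ∉ insert 1 S := by
      simp only [Finset.mem_insert, zero_ne_one, false_or]
      exact fun hc => absurd (hS 0 hc).1 (lt_irrefl _)
    obtain ⟨S', hS', hr', hc'⟩ := exists_roots_derivative
      (derivative^[j] (X ^ n * (1 - X) ^ n : ℝ[X])) (n := j + 1) (insert 0 (insert 1 S))
      (by
        intro t ht
        simp only [Finset.mem_insert] at ht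
        rcases ht with rfl | rfl | ht
        · simp
        · simp
        · exact Ioo_subset_Icc_self (hS t ht))
      (by
        intro t ht
        simp only [Finset.mem_insert] at ht
        rcases ht with rfl | rfl | ht
        · exact h0
        · exact h1
        · exact hroot t ht)
      (by rw [Finset.card_insert_of_notMem hn0, Finset.card_insert_of_notMem hn1, hcard])
    exact ⟨S', hS', fun t ht => by rw [Function.iterate_succ_apply']; exact hr' t ht, hc'⟩

/-- The Gauss-Lobatto nodes of degree `k`. -/
lemma exists_gaussLobatto_nodes {k : ℕ} (hk : 1 ≤ k) : ∃ N : Finset ℝ, N.card = k + 1 ∧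
    ∀ t ∈ N, t ∈ Icc (0 : ℝ) 1 ∧ (t = 0 ∨ t = 1 ∨
      (t ∈ Ioo (0 : ℝ) 1 ∧ aeval t (derivative (shiftedLegendre k)) = 0)) := by
  obtain ⟨S, hS, hroot, hcard⟩ := exists_roots_rodrigues k k le_rfl
  -- Rodrigues' formula: the shifted Legendre polynomial has `k` distinct zeros in `(0, 1)`, so its
  -- derivative has `k - 1` of them. The two endpoints complete the `k + 1` nodes.
  have hmap : ((k.factorial : ℝ[X])) * (shiftedLegendre k).map (Int.castRingHom ℝ) =
      derivative^[k] (X ^ k * (1 - X) ^ k : ℝ[X]) := by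
    have := congrArg (Polynomial.map (Int.castRingHom ℝ)) (factorial_mul_shiftedLegendre_eq k)
    rw [← iterate_derivative_map] at this
    simpa using this
  have hleg : ∀ t ∈ S, ((shiftedLegendre k).map (Int.castRingHom ℝ)).eval t = 0 := by
    intro t ht
    have := hroot t ht
    rw [← hmap, eval_mul] at this
    simpa [Nat.factorial_ne_zero] using this
  obtain ⟨S', hS', hr', hc'⟩ := exists_roots_derivative _ (n := k - 1) S
    (fun t ht => Ioo_subset_Icc_self (hS t ht)) hleg (by omega)
  have hn1 : (1 : ℝ) ∉ S' := fun hc => absurd (hS' 1 hc).2 (lt_irrefl _)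
  have hn0 : (0 : ℝ) ∉ insert 1 S' := by
    simp only [Finset.mem_insert, zero_ne_one, false_or]
    exact fun hc => absurd (hS' 0 hc).1 (lt_irrefl _)
  refine ⟨insert 0 (insert 1 S'), ?_, ?_⟩
  · rw [Finset.card_insert_of_notMem hn0, Finset.card_insert_of_notMem hn1, hc']
    omega
  · intro t ht
    simp only [Finset.mem_insert] at ht
    rcases ht with rfl | rfl | ht
    · simp
    · simp
    · refine ⟨Ioo_subset_Icc_self (hS' t ht), Or.inr (Or.inr ⟨hS' t ht, ?_⟩)⟩
      have := hr' t ht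
      rw [derivative_map, eval_map] at this
      rw [aeval_def]
      exact this

/-- A polynomial of degree `k` on `[0,1]` and its Lipschitz constant are controlled by the values
at the Gauss-Lobatto nodes. -/
lemma exists_edge_bound {k : ℕ} (hk : 1 ≤ k) : ∃ C : ℝ, 1 ≤ C ∧ ∀ q : ℝ[X], q.natDegree ≤ k →
    ∀ b : ℝ, |q.eval 0| ≤ b → |q.eval 1| ≤ b →
      (∀ t ∈ Ioo (0 : ℝ) 1, aeval t (derivative (shiftedLegendre k)) = 0 → |q.eval t| ≤ b) →
      (∀ t ∈ Icc (0 : ℝ) 1, |q.eval t| ≤ C * b) ∧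
      ∀ s ∈ Icc (0 : ℝ) 1, ∀ t ∈ Icc (0 : ℝ) 1, |q.eval s - q.eval t| ≤ C * b * |s - t| := by
  obtain ⟨N, hcard, hN⟩ := exists_gaussLobatto_nodes hk
  have hB : ∀ r : ℝ[X], ∃ M : ℝ, 0 ≤ M ∧ ∀ t ∈ Icc (0 : ℝ) 1, |r.eval t| ≤ M := by
    intro r
    obtain ⟨M, hM⟩ := isCompact_Icc.exists_bound_of_continuousOn
      (s := Icc (0 : ℝ) 1) r.continuous.continuousOn
    exact ⟨M, (norm_nonneg _).trans (hM 0 (by simp)), hM⟩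
  choose M hM0 hM using hB
  -- `k + 1` nodes determine a polynomial of degree `k`. The constant collects the sup norms on `[0,
  -- 1]` of the Lagrange basis and of its derivatives; the extra `1` ensures that it is at least
  -- `1`.
  set ℓ : ℝ → ℝ[X] := Lagrange.basis N id with hℓ
  set A := ∑ t ∈ N, M (ℓ t) with hA
  set A' := ∑ t ∈ N, M (derivative (ℓ t)) with hA'
  have hA0 : 0 ≤ A := Finset.sum_nonneg fun t _ => hM0 _
  have hA0' : 0 ≤ A' := Finset.sum_nonneg fun t _ => hM0 _
  refine ⟨1 + A + A', by linarith, fun q hq b hb0 hb1 hb => ?_⟩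
  have hbnn : 0 ≤ b := (abs_nonneg _).trans hb0
  have hnode : ∀ t ∈ N, |q.eval t| ≤ b := by
    intro t ht
    rcases (hN t ht).2 with rfl | rfl | h
    · exact hb0
    · exact hb1
    · exact hb t h.1 h.2
  have hqe : q = ∑ t ∈ N, C (q.eval t) * ℓ t := by
    have := Lagrange.eq_interpolate (s := N) (v := id) (f := q) (injOn_id _) (by
      rw [hcard]
      exact (degree_le_of_natDegree_le hq).trans_lt (by exact_mod_cast Nat.lt_succ_self k))
    rwa [Lagrange.interpolate_apply] at this
  have hval : ∀ t ∈ Icc (0 : ℝ) 1, |q.eval t| ≤ A * b := by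
    intro t ht
    rw [hqe, eval_finsetSum, hA, Finset.sum_mul]
    refine (Finset.abs_sum_le_sum_abs _ _).trans (Finset.sum_le_sum fun s hs => ?_)
    rw [eval_mul, eval_C, abs_mul, mul_comm]
    exact mul_le_mul (hM _ t ht) (hnode s hs) (abs_nonneg _) (hM0 _)
  have hder : ∀ t ∈ Icc (0 : ℝ) 1, |(derivative q).eval t| ≤ A' * b := by
    intro t ht
    rw [hqe, derivative_sum, eval_finsetSum, hA', Finset.sum_mul]
    refine (Finset.abs_sum_le_sum_abs _ _).trans (Finset.sum_le_sum fun s hs => ?_)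
    rw [derivative_C_mul, eval_mul, eval_C, abs_mul, mul_comm]
    exact mul_le_mul (hM _ t ht) (hnode s hs) (abs_nonneg _) (hM0 _)
  refine ⟨fun t ht => (hval t ht).trans (by gcongr; linarith), fun s hs t ht => ?_⟩
  have := Convex.norm_image_sub_le_of_norm_deriv_le (f := fun x => q.eval x) (s := Icc (0 : ℝ) 1)
    (C := A' * b) (fun x _ => q.differentiableAt) (fun x hx => by simpa using hder x hx)
    (convex_Icc 0 1) ht hs
  refine this.trans ?_
  rw [Real.norm_eq_abs]
  gcongr
  linarith

/-! ### Polynomials in two variables -/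

/-- The polynomial function on the plane given by `p`. -/
noncomputable def polyFun (p : MvPolynomial (Fin 2) ℝ) (x : Plane) : ℝ :=
  MvPolynomial.eval (fun i => x i) p

lemma contDiff_polyFun {n : WithTop ℕ∞} (p : MvPolynomial (Fin 2) ℝ) :
    ContDiff ℝ n (polyFun p) := by
  induction p using MvPolynomial.induction_on with
  | C a =>
    have : polyFun (MvPolynomial.C a) = fun _ => a := by ext; simp [polyFun]
    rw [this]; exact contDiff_const
  | add p q hp hq =>
    have : polyFun (p + q) = fun x => polyFun p x + polyFun q x := by ext; simp [polyFun]
    rw [this]; exact hp.add hq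
  | mul_X p i hp =>
    have : polyFun (p * MvPolynomial.X i) = fun x => polyFun p x * x i := by ext; simp [polyFun]
    rw [this]
    exact hp.mul (by fun_prop)

lemma continuous_polyFun (p : MvPolynomial (Fin 2) ℝ) : Continuous (polyFun p) :=
  (contDiff_polyFun (n := 1) p).continuous

lemma polyFun_add (p q : MvPolynomial (Fin 2) ℝ) (x : Plane) :
    polyFun (p + q) x = polyFun p x + polyFun q x := by simp [polyFun]

lemma polyFun_smul (a : ℝ) (p : MvPolynomial (Fin 2) ℝ) (x : Plane) :
    polyFun (a • p) x = a * polyFun p x := by simp [polyFun]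

/-- An affine substitution does not raise the degree, so estimates on the unit ball carry over to
all centres and scales. -/
lemma exists_polyFun_comp_affine (p : MvPolynomial (Fin 2) ℝ) (c : Plane) (h : ℝ) :
    ∃ q : MvPolynomial (Fin 2) ℝ, q.totalDegree ≤ p.totalDegree ∧
      ∀ y, polyFun q y = polyFun p (c + h • y) := by
  set f : Fin 2 → MvPolynomial (Fin 2) ℝ := fun i =>
    MvPolynomial.C (c i) + MvPolynomial.C h * MvPolynomial.X i with hf
  have hfd : ∀ i, (f i).totalDegree ≤ 1 := by
    intro i
    refine (MvPolynomial.totalDegree_add _ _).trans (max_le (by simp) ?_)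
    refine (MvPolynomial.totalDegree_mul _ _).trans ?_
    simp
  refine ⟨MvPolynomial.aeval f p, ?_, fun y => ?_⟩
  · conv_lhs => rw [p.as_sum, map_sum]
    refine MvPolynomial.totalDegree_finsetSum_le fun d hd => ?_
    rw [MvPolynomial.aeval_monomial]
    refine (MvPolynomial.totalDegree_mul _ _).trans ?_
    rw [MvPolynomial.algebraMap_eq, MvPolynomial.totalDegree_C, zero_add]
    refine (MvPolynomial.totalDegree_finsetProd _ _).trans ?_
    refine le_trans ?_ (MvPolynomial.le_totalDegree hd)
    refine Finset.sum_le_sum fun i _ => ?_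
    refine (MvPolynomial.totalDegree_pow _ _).trans ?_
    calc d i * (f i).totalDegree ≤ d i * 1 := Nat.mul_le_mul_left _ (hfd i)
      _ = d i := mul_one _
  · simp only [polyFun]
    induction p using MvPolynomial.induction_on with
    | C a => simp
    | add p q hp hq => rw [map_add, map_add, hp, hq, map_add]
    | mul_X p i hp =>
      rw [map_mul, map_mul, hp, MvPolynomial.aeval_X, map_mul]
      simp [hf]

/-- The ball contains a product of two nondegenerate intervals, and a polynomial vanishing on a
product of infinite sets is zero. -/
lemma eq_zero_of_polyFun_eq_zero {p : MvPolynomial (Fin 2) ℝ} {r : ℝ} (hr : 0 < r)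
    (h : ∀ x ∈ ball (0 : Plane) r, polyFun p x = 0) : p = 0 := by
  refine MvPolynomial.funext_set (fun _ => Ioo (0 : ℝ) (r / 2)) (fun _ => Ioo_infinite (by linarith))
    fun x hx => ?_
  rw [map_zero]
  have hx0 := hx 0 (mem_univ _)
  have hx1 := hx 1 (mem_univ _)
  refine h (WithLp.toLp 2 x) ?_
  rw [mem_ball_zero_iff]
  refine lt_of_pow_lt_pow_left₀ 2 hr.le ?_
  rw [EuclideanSpace.norm_sq_eq]
  simp only [Fin.sum_univ_two, Real.norm_eq_abs, sq_abs]
  nlinarith [hx0.1, hx0.2, hx1.1, hx1.2]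

/-- In finite dimensions, coordinates are bounded by any positive definite quadratic form. -/
lemma exists_coord_sq_le {V : Type*} [AddCommGroup V] [Module ℝ V] {ι : Type*} [Fintype ι]
    (b : Module.Basis ι ℝ V) (B : V →ₗ[ℝ] V →ₗ[ℝ] ℝ) (hB : ∀ v, v ≠ 0 → 0 < B v v) :
    ∃ C : ℝ, 0 ≤ C ∧ ∀ v i, b.repr v i ^ 2 ≤ C * B v v := by
  classical
  set Q : (ι → ℝ) → ℝ := fun x => B (b.equivFun.symm x) (b.equivFun.symm x) with hQ
  have hQc : Continuous Q := by
    have : Q = fun x => ∑ i, ∑ j, x i * x j * B (b i) (b j) := by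
      funext x
      simp only [hQ, Module.Basis.equivFun_symm_apply, map_sum, map_smul, LinearMap.sum_apply,
        LinearMap.smul_apply, smul_eq_mul, Finset.mul_sum]
      rw [Finset.sum_comm]
      refine Finset.sum_congr rfl fun i _ => Finset.sum_congr rfl fun j _ => ?_
      ring
    rw [this]
    fun_prop
  have hQs : ∀ (a : ℝ) x, Q (a • x) = a ^ 2 * Q x := by
    intro a x
    simp only [hQ, map_smul, LinearMap.smul_apply, smul_eq_mul]
    ring
  have hQpos : ∀ x, x ≠ 0 → 0 < Q x := fun x hx =>
    hB _ ((b.equivFun.symm.map_ne_zero_iff).2 hx)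
  -- The minimum of the form on the unit sphere; in dimension zero the sphere is empty and any
  -- positive number works.
  obtain ⟨m, hm, hmin⟩ : ∃ m : ℝ, 0 < m ∧ ∀ x ∈ sphere (0 : ι → ℝ) 1, m ≤ Q x := by
    rcases (sphere (0 : ι → ℝ) 1).eq_empty_or_nonempty with he | hne
    · exact ⟨1, one_pos, by simp [he]⟩
    · obtain ⟨x, hx, hxm⟩ := (isCompact_sphere (0 : ι → ℝ) 1).exists_isMinOn hne hQc.continuousOn
      refine ⟨Q x, hQpos x ?_, fun y hy => hxm hy⟩
      rintro rfl
      simp at hx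
  refine ⟨m⁻¹, by positivity, fun v i => ?_⟩
  set x := b.equivFun v with hx
  have hv : B v v = Q x := by simp only [hQ, hx, LinearEquiv.symm_apply_apply]
  have hxi : b.repr v i = x i := rfl
  rw [hv, hxi]
  rcases eq_or_ne x 0 with h0 | h0
  · rw [h0]; simp [hQ]
  · have hn : 0 < ‖x‖ := norm_pos_iff.2 h0
    have h1 := hmin (‖x‖⁻¹ • x) (by simp [norm_smul, hn.ne'])
    rw [hQs] at h1
    have h2 : x i ^ 2 ≤ ‖x‖ ^ 2 := by
      rw [← sq_abs]
      exact pow_le_pow_left₀ (abs_nonneg _) (norm_le_pi_norm x i) 2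
    have h3 : m * ‖x‖ ^ 2 ≤ Q x := by
      have h4 : ‖x‖ ^ 2 * m ≤ ‖x‖ ^ 2 * (‖x‖⁻¹ ^ 2 * Q x) := by gcongr
      have h5 : ‖x‖ ^ 2 * (‖x‖⁻¹ ^ 2 * Q x) = Q x := by field_simp
      linarith
    rw [inv_mul_eq_div, le_div_iff₀ hm]
    nlinarith

/-! ### Bubble functions and the bound for the Laplacian -/

/-- The form `∫ η p q` is positive definite on the finite-dimensional space of polynomials of degree
at most `n`, because `η` is positive on a ball. Hence it dominates the squares of point values on
the whole unit ball, also outside the support of `η`, and of derivatives of `η p`. -/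
lemma exists_bubble_unit (n : ℕ) (η : ContDiffBump (0 : Plane)) :
    ∃ C : ℝ, 0 ≤ C ∧ ∀ p : MvPolynomial (Fin 2) ℝ, p.totalDegree ≤ n →
      (∀ y ∈ closedBall (0 : Plane) 1, polyFun p y ^ 2 ≤ C * ∫ x, η x * polyFun p x ^ 2) ∧
      ∀ y i, fderiv ℝ (fun x => η x * polyFun p x) y (basisVec i) ^ 2 ≤
        C * ∫ x, η x * polyFun p x ^ 2 := by
  set V := MvPolynomial.restrictTotalDegree (Fin 2) ℝ n with hV
  have hint : ∀ p q : MvPolynomial (Fin 2) ℝ,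
      Integrable fun x => η x * (polyFun p x * polyFun q x) := fun p q =>
    (η.continuous.mul ((continuous_polyFun p).mul
      (continuous_polyFun q))).integrable_of_hasCompactSupport η.hasCompactSupport.mul_right
  set B : V →ₗ[ℝ] V →ₗ[ℝ] ℝ := LinearMap.mk₂ ℝ
    (fun p q => ∫ x, η x * (polyFun (p : MvPolynomial (Fin 2) ℝ) x *
      polyFun (q : MvPolynomial (Fin 2) ℝ) x))
    (fun p p' q => by
      rw [← integral_add (hint _ _) (hint _ _)]
      congr 1; ext x
      rw [Submodule.coe_add, polyFun_add]; ring)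
    (fun a p q => by
      rw [smul_eq_mul, ← integral_const_mul]
      congr 1; ext x
      rw [Submodule.coe_smul, polyFun_smul]; ring)
    (fun p q q' => by
      rw [← integral_add (hint _ _) (hint _ _)]
      congr 1; ext x
      rw [Submodule.coe_add, polyFun_add]; ring)
    (fun a p q => by
      rw [smul_eq_mul, ← integral_const_mul]
      congr 1; ext x
      rw [Submodule.coe_smul, polyFun_smul]; ring) with hBd
  have hBv : ∀ p : V, B p p = ∫ x, η x * polyFun (p : MvPolynomial (Fin 2) ℝ) x ^ 2 := by
    intro p
    simp only [hBd, LinearMap.mk₂_apply, sq]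
  have hB : ∀ p : V, p ≠ 0 → 0 < B p p := by
    intro p hp
    rw [hBv]
    obtain ⟨x, hx, hxne⟩ : ∃ x ∈ ball (0 : Plane) η.rOut,
        polyFun (p : MvPolynomial (Fin 2) ℝ) x ≠ 0 := by
      by_contra! hcon
      exact hp (Subtype.ext (eq_zero_of_polyFun_eq_zero η.rOut_pos hcon))
    refine Continuous.integral_pos_of_hasCompactSupport_nonneg_nonzero (x := x)
      (η.continuous.mul ((continuous_polyFun _).pow 2)) η.hasCompactSupport.mul_right
      (fun y => mul_nonneg η.nonneg (sq_nonneg _)) ?_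
    exact mul_ne_zero (η.pos_of_mem_ball hx).ne' (pow_ne_zero 2 hxne)
  set b := Module.finBasis ℝ V with hb
  obtain ⟨C, hC0, hC⟩ := exists_coord_sq_le b B hB
  have hsm : ∀ p, ContDiff ℝ 1 fun x => η x * polyFun p x := fun p =>
    η.contDiff.mul (contDiff_polyFun p)
  have hM : ∀ j, ∃ M : ℝ, 0 ≤ M ∧
      (∀ y ∈ closedBall (0 : Plane) 1, |polyFun (b j : MvPolynomial (Fin 2) ℝ) y| ≤ M) ∧
      ∀ y i, |fderiv ℝ (fun x => η x * polyFun (b j : MvPolynomial (Fin 2) ℝ) x) y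
        (basisVec i)| ≤ M := by
    intro j
    obtain ⟨M₁, hM₁⟩ := (isCompact_closedBall (0 : Plane) 1).exists_bound_of_continuousOn
      (continuous_polyFun (b j : MvPolynomial (Fin 2) ℝ)).continuousOn
    have hcs : HasCompactSupport fun x => η x * polyFun (b j : MvPolynomial (Fin 2) ℝ) x :=
      η.hasCompactSupport.mul_right
    obtain ⟨M₂, hM₂⟩ := (hcs.fderiv ℝ).exists_bound_of_continuous
      ((hsm (b j)).continuous_fderiv one_ne_zero)
    refine ⟨max M₁ M₂, ?_, fun y hy => (hM₁ y hy).trans (le_max_left _ _), fun y i => ?_⟩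
    · exact (norm_nonneg _).trans ((hM₁ 0 (by simp)).trans (le_max_left _ _))
    · have h1 := (fderiv ℝ (fun x => η x * polyFun (b j : MvPolynomial (Fin 2) ℝ) x) y).le_opNorm
        (basisVec i)
      have h2 : ‖basisVec i‖ = 1 := by simp [basisVec]
      rw [h2, mul_one, Real.norm_eq_abs] at h1
      exact (h1.trans (hM₂ y)).trans (le_max_right M₁ M₂)
  choose M hM0 hM1 hM2 using hM
  -- A linear functional whose values on the basis are bounded by `M j` is controlled by the form,
  -- by Cauchy-Schwarz in coordinates and `exists_coord_sq_le`.
  have hfunc : ∀ (p : V) (ℓ : Fin (Module.finrank ℝ V) → ℝ),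
      (∀ j, |ℓ j| ≤ M j) → (∑ j, b.repr p j * ℓ j) ^ 2 ≤
        (Fintype.card (Fin (Module.finrank ℝ V)) * C * ∑ j, M j ^ 2) * B p p := by
    intro p ℓ hℓ
    calc (∑ j, b.repr p j * ℓ j) ^ 2 ≤ (∑ j, b.repr p j ^ 2) * ∑ j, ℓ j ^ 2 :=
          Finset.sum_mul_sq_le_sq_mul_sq _ _ _
      _ ≤ (∑ _j : Fin (Module.finrank ℝ V), C * B p p) * ∑ j, M j ^ 2 := by
          refine mul_le_mul (Finset.sum_le_sum fun j _ => hC p j)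
            (Finset.sum_le_sum fun j _ => ?_) (Finset.sum_nonneg fun j _ => sq_nonneg _)
            (Finset.sum_nonneg fun j _ => (sq_nonneg _).trans (hC p j))
          rw [← sq_abs]
          exact pow_le_pow_left₀ (abs_nonneg _) (hℓ j) 2
      _ = _ := by
          rw [Finset.sum_const, nsmul_eq_mul, Finset.card_univ]
          ring
  refine ⟨Fintype.card (Fin (Module.finrank ℝ V)) * C * ∑ j, M j ^ 2,
    mul_nonneg (by positivity) (Finset.sum_nonneg fun j _ => sq_nonneg _), fun p hp => ?_⟩
  set pv : V := ⟨p, (MvPolynomial.mem_restrictTotalDegree _ _ _).2 hp⟩ with hpv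
  have hrep : ∀ y, polyFun p y = ∑ j, b.repr pv j * polyFun (b j : MvPolynomial (Fin 2) ℝ) y := by
    intro y
    have h1 : p = ∑ j, b.repr pv j • (b j : MvPolynomial (Fin 2) ℝ) := by
      have h2 := congrArg (Submodule.subtype V) (b.sum_repr pv)
      rw [map_sum] at h2
      exact h2.symm
    conv_lhs => rw [h1]
    simp [polyFun, map_sum]
  have hBp : B pv pv = ∫ x, η x * polyFun p x ^ 2 := hBv pv
  rw [← hBp]
  refine ⟨fun y hy => ?_, fun y i => ?_⟩
  · rw [hrep y]
    exact hfunc pv _ fun j => hM1 j y hy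
  · have h1 : (fun x => η x * polyFun p x) =
        fun x => ∑ j, b.repr pv j * (η x * polyFun (b j : MvPolynomial (Fin 2) ℝ) x) := by
      funext x
      rw [hrep x, Finset.mul_sum]
      exact Finset.sum_congr rfl fun j _ => by ring
    have h2 : HasFDerivAt (fun x => ∑ j, b.repr pv j *
        (η x * polyFun (b j : MvPolynomial (Fin 2) ℝ) x))
        (∑ j, b.repr pv j • fderiv ℝ (fun x => η x * polyFun (b j : MvPolynomial (Fin 2) ℝ) x) y)
        y :=
      HasFDerivAt.fun_sum fun j _ =>
        ((((hsm (b j)).differentiable one_ne_zero) y).hasFDerivAt).const_mul _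
    rw [h1, h2.fderiv]
    simp only [_root_.sum_apply, _root_.smul_apply, smul_eq_mul]
    exact hfunc pv _ fun j => hM2 j y i

/-- The unit estimates rescaled by `y = (x - c) / h`: the integral gains `h ^ 2`, and the squared
derivative gains `h ^ (-2)`, whence the powers `2` and `4`. The bubble lives on the ball of radius
`r * h`, but controls `p` on the ball of radius `h`, large enough to contain an element of diameter
at most `h`. -/
lemma exists_bubble (n : ℕ) {r : ℝ} (hr : 0 < r) : ∃ C : ℝ, 0 ≤ C ∧
    ∀ p : MvPolynomial (Fin 2) ℝ, p.totalDegree ≤ n → ∀ (c : Plane) (h : ℝ), 0 < h →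
      ∃ (ψ : Plane → ℝ) (K : ℝ≥0), LipschitzWith K ψ ∧ HasCompactSupport ψ ∧
        tsupport ψ ⊆ closedBall c (r * h) ∧
        (∀ x ∈ closedBall c h, polyFun p x ^ 2 * h ^ 2 ≤ C * ∫ x, polyFun p x * ψ x) ∧
        ∀ x i, lineDeriv ℝ ψ x (basisVec i) ^ 2 * h ^ 4 ≤ C * ∫ x, polyFun p x * ψ x := by
  let η : ContDiffBump (0 : Plane) := ⟨r / 2, r, by linarith, by linarith⟩
  obtain ⟨C, hC0, hC⟩ := exists_bubble_unit n η
  refine ⟨C, hC0, fun p hp c h hh => ?_⟩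
  obtain ⟨q, hqd, hq⟩ := exists_polyFun_comp_affine p c h
  obtain ⟨hC1, hC2⟩ := hC q (hqd.trans hp)
  set W : Plane → ℝ := fun y => η y * polyFun q y with hW
  have hWsm : ContDiff ℝ 1 W := η.contDiff.mul (contDiff_polyFun q)
  set A : Plane → Plane := fun x => h⁻¹ • (x - c) with hA
  have hAinv : ∀ x, c + h • A x = x := by
    intro x
    rw [hA]
    simp only
    rw [smul_smul, mul_inv_cancel₀ hh.ne', one_smul, add_sub_cancel]
  have hqA : ∀ x, polyFun q (A x) = polyFun p x := by
    intro x; rw [hq, hAinv]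
  have hAsm : ContDiff ℝ 1 A := by fun_prop
  set ψ : Plane → ℝ := fun x => W (A x) with hψ
  have hψsm : ContDiff ℝ 1 ψ := hWsm.comp hAsm
  have hsupp : tsupport ψ ⊆ closedBall c (r * h) := by
    refine closure_minimal (fun x hx => ?_) isClosed_closedBall
    have h1 : η (A x) ≠ 0 := left_ne_zero_of_mul (hx : W (A x) ≠ 0)
    have h2 : A x ∈ ball (0 : Plane) r := by
      have : A x ∈ Function.support η := h1
      rwa [η.support_eq] at this
    rw [mem_ball_zero_iff, hA] at h2
    simp only [norm_smul, norm_inv, Real.norm_of_nonneg hh.le] at h2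
    rw [inv_mul_lt_iff₀ hh] at h2
    rw [mem_closedBall, dist_eq_norm]
    linarith
  have hcs : HasCompactSupport ψ :=
    (isCompact_closedBall c (r * h)).of_isClosed_subset (isClosed_tsupport ψ) hsupp
  have hS : ∫ x, polyFun p x * ψ x = h ^ 2 * ∫ x, η x * polyFun q x ^ 2 := by
    have h1 : ∀ x, polyFun p x * ψ x =
        (fun y => η y * polyFun q y ^ 2) (h⁻¹ • (x - c)) := by
      intro x
      have : polyFun q (h⁻¹ • (x - c)) = polyFun p x := hqA x
      simp only [hψ, hW, hA, this]
      ring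
    simp_rw [h1]
    rw [integral_sub_right_eq_self (fun x => (fun y => η y * polyFun q y ^ 2) (h⁻¹ • x)) c,
      Measure.integral_comp_inv_smul_of_nonneg volume (fun y => η y * polyFun q y ^ 2) hh.le,
      finrank_euclideanSpace_fin, smul_eq_mul]
  obtain ⟨K, hK⟩ := exists_lipschitzWith_of_hasCompactSupport hψsm.locallyLipschitz hcs
  refine ⟨ψ, K, hK, hcs, hsupp, fun x hx => ?_, fun x i => ?_⟩
  · have hy : A x ∈ closedBall (0 : Plane) 1 := by
      rw [mem_closedBall_zero_iff, hA]
      simp only [norm_smul, norm_inv, Real.norm_of_nonneg hh.le]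
      rw [mem_closedBall, dist_eq_norm] at hx
      rw [inv_mul_le_iff₀ hh]
      linarith
    have := hC1 _ hy
    rw [hqA] at this
    rw [hS]
    calc _ ≤ (C * ∫ x, η x * polyFun q x ^ 2) * h ^ 2 := by gcongr
      _ = _ := by ring
  · have h1 : HasFDerivAt W (fderiv ℝ W (A x)) (A x) :=
      (hWsm.differentiable one_ne_zero (A x)).hasFDerivAt
    have h2 : HasFDerivAt A (h⁻¹ • ContinuousLinearMap.id ℝ Plane) x :=
      ((hasFDerivAt_id x).sub_const c).const_smul h⁻¹
    have h3 : HasFDerivAt ψ _ x := h1.comp x h2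
    rw [(h3.hasLineDerivAt (basisVec i)).lineDeriv, hS]
    have h4 := hC2 (A x) i
    simp only [ContinuousLinearMap.comp_apply, _root_.smul_apply,
      ContinuousLinearMap.id_apply, map_smul, smul_eq_mul]
    calc (h⁻¹ * fderiv ℝ W (A x) (basisVec i)) ^ 2 * h ^ 4 =
          fderiv ℝ W (A x) (basisVec i) ^ 2 * h ^ 2 := by field_simp
      _ ≤ (C * ∫ x, η x * polyFun q x ^ 2) * h ^ 2 := by gcongr
      _ = _ := by ring

/-- The `L²` norm of a polynomial Laplacian is bounded by the energy. -/
lemma exists_laplacian_bound (n : ℕ) {r : ℝ} (hr : 0 < r) : ∃ C : ℝ, 0 ≤ C ∧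
    ∀ (E : Set Plane) (c : Plane) (ρ h : ℝ), IsStarRegion E c ρ h → r * h < ρ →
    ∀ (z : Plane → ℝ) (p : MvPolynomial (Fin 2) ℝ), p.totalDegree ≤ n →
      ContDiffOn ℝ 2 z (interior E) →
      IntegrableOn (fun x => ‖gradient z x‖ ^ 2) (interior E) →
      (∀ x ∈ interior E, Laplacian.laplacian z x = polyFun p x) →
      h ^ 2 * ∫ x in interior E, polyFun p x ^ 2 ≤ C * ∫ x in interior E, ‖gradient z x‖ ^ 2 := by
  obtain ⟨C₀, hC₀, hbub⟩ := exists_bubble n hr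
  -- Adding `1` makes the constant positive, so that it can occur in the denominator of `α⁻¹`.
  set C := C₀ + 1 with hC
  have hC1 : 0 < C := by positivity
  refine ⟨2 * Real.pi ^ 2 * C ^ 2, by positivity, ?_⟩
  intro E c ρ h hE hrh z p hp hz hgrad hlap
  have hh : 0 < h := hE.pos.trans_le hE.radius_le
  obtain ⟨ψ, K, hψ, hcs, hsupp, hP, hD⟩ := hbub p hp c h hh
  have hsub : tsupport ψ ⊆ interior E := hsupp.trans fun x hx =>
    hE.ball_subset_interior (lt_of_le_of_lt hx hrh)
  set S := ∫ x, polyFun p x * ψ x with hSd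
  set G := ∫ x in interior E, ‖gradient z x‖ ^ 2 with hGd
  have hG0 : 0 ≤ G := integral_nonneg fun x => sq_nonneg _
  have hC0S : 0 ≤ C₀ * S := by
    have := hP c (mem_closedBall_self hh.le)
    exact le_trans (by positivity) this
  have hVfin := hE.measure_interior_lt_top
  have hVle : volume.real (interior E) ≤ Real.pi * h ^ 2 :=
    ENNReal.toReal_le_of_le_ofReal (by positivity) hE.volume_interior_le
  obtain ⟨hgi, hgreen⟩ := green isOpen_interior hz hψ hcs hsub
  have hSeq : ∫ x, Laplacian.laplacian z x * ψ x = S := by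
    refine integral_congr_ae (.of_forall fun x => ?_)
    by_cases hx : x ∈ interior E
    · simp only [hlap x hx]
    · have : ψ x = 0 := image_eq_zero_of_notMem_tsupport fun hc => hx (hsub hc)
      simp only [this, mul_zero]
  rw [hSeq] at hgreen
  by_cases hS0 : S ≤ 0
  · have hz0 : ∀ x ∈ interior E, polyFun p x ^ 2 = 0 := by
      intro x hx
      have h1 := hP x (by
        rw [mem_closedBall]; exact hE.dist_le x (interior_subset hx) c hE.center_mem)
      have h2 : C₀ * S ≤ 0 := mul_nonpos_of_nonneg_of_nonpos hC₀ hS0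
      have h3 : 0 < h ^ 2 := by positivity
      nlinarith [sq_nonneg (polyFun p x)]
    rw [setIntegral_congr_fun isOpen_interior.measurableSet hz0]
    simp only [integral_zero, mul_zero]
    positivity
  have hS0' : 0 < S := not_le.1 hS0
  have hCS : C₀ * S ≤ C * S := by rw [hC]; linarith
  -- The Young parameter for which the contribution of `∇ψ`, integrated over an area of at most `π
  -- h²`, is at most `S / 2` and can be absorbed on the left.
  set α : ℝ := 2 * Real.pi * C / h ^ 2 with hα
  have hα0 : 0 < α := by positivity
  have hpt : ∀ x ∈ interior E, -(∑ i, fderiv ℝ z x (basisVec i) * lineDeriv ℝ ψ x (basisVec i)) ≤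
      α / 2 * ‖gradient z x‖ ^ 2 + α⁻¹ * (C * S / h ^ 4) := by
    intro x _
    have hDi : ∀ i, lineDeriv ℝ ψ x (basisVec i) ^ 2 ≤ C * S / h ^ 4 := by
      intro i
      rw [le_div_iff₀ (by positivity)]
      exact (hD x i).trans hCS
    have hyoung : ∀ a b : ℝ, -(a * b) ≤ α / 2 * a ^ 2 + α⁻¹ / 2 * b ^ 2 := by
      intro a b
      have h1 : α / 2 * a ^ 2 + α⁻¹ / 2 * b ^ 2 + a * b = (α * a + b) ^ 2 / (2 * α) := by
        field_simp; ring
      have h2 : 0 ≤ (α * a + b) ^ 2 / (2 * α) := by positivity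
      linarith
    rw [norm_gradient_sq, Fin.sum_univ_two, Fin.sum_univ_two]
    have y0 := hyoung (fderiv ℝ z x (basisVec 0)) (lineDeriv ℝ ψ x (basisVec 0))
    have y1 := hyoung (fderiv ℝ z x (basisVec 1)) (lineDeriv ℝ ψ x (basisVec 1))
    have d0 := mul_le_mul_of_nonneg_left (hDi 0) (by positivity : 0 ≤ α⁻¹ / 2)
    have d1 := mul_le_mul_of_nonneg_left (hDi 1) (by positivity : 0 ≤ α⁻¹ / 2)
    linarith
  have hrestr : ∫ x, ∑ i, fderiv ℝ z x (basisVec i) * lineDeriv ℝ ψ x (basisVec i) =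
      ∫ x in interior E, ∑ i, fderiv ℝ z x (basisVec i) * lineDeriv ℝ ψ x (basisVec i) := by
    rw [setIntegral_eq_integral_of_forall_compl_eq_zero]
    intro x hx
    refine Finset.sum_eq_zero fun i _ => ?_
    rw [lineDeriv_eq_zero_of_notMem_tsupport fun hc => hx (hsub hc), mul_zero]
  have i1 : IntegrableOn (fun x => α / 2 * ‖gradient z x‖ ^ 2) (interior E) := hgrad.const_mul _
  have i2 : IntegrableOn (fun _ : Plane => α⁻¹ * (C * S / h ^ 4)) (interior E) :=
    integrableOn_const hVfin.ne
  have hSle : S ≤ α / 2 * G + α⁻¹ * (C * S / h ^ 4) * (Real.pi * h ^ 2) := by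
    calc S = ∫ x in interior E,
          -(∑ i, fderiv ℝ z x (basisVec i) * lineDeriv ℝ ψ x (basisVec i)) := by
          rw [integral_neg, ← hrestr, hgreen, neg_neg]
      _ ≤ ∫ x in interior E, (α / 2 * ‖gradient z x‖ ^ 2 + α⁻¹ * (C * S / h ^ 4)) :=
          setIntegral_mono_on hgi.integrableOn.neg (i1.add i2) isOpen_interior.measurableSet hpt
      _ = α / 2 * G + α⁻¹ * (C * S / h ^ 4) * volume.real (interior E) := by
          rw [integral_add i1 i2, integral_const_mul, setIntegral_const, smul_eq_mul, mul_comm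
            (volume.real _)]
      _ ≤ _ := by gcongr
  have hSle2 : h ^ 2 * S ≤ 2 * Real.pi * C * G := by
    have e1 : α⁻¹ * (C * S / h ^ 4) * (Real.pi * h ^ 2) = S / 2 := by
      rw [hα]; field_simp
    rw [e1] at hSle
    have e2 : h ^ 2 * (α / 2 * G) = Real.pi * C * G := by rw [hα]; field_simp
    have h3 : h ^ 2 * S ≤ h ^ 2 * (α / 2 * G + S / 2) := by gcongr
    rw [mul_add, e2] at h3
    linarith
  have hPint : ∫ x in interior E, polyFun p x ^ 2 ≤ C * S / h ^ 2 * (Real.pi * h ^ 2) := by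
    calc ∫ x in interior E, polyFun p x ^ 2 ≤ ∫ _x in interior E, C * S / h ^ 2 := by
          refine setIntegral_mono_on
            (hE.integrableOn_of_continuousOn ((continuous_polyFun p).pow 2).continuousOn)
            (integrableOn_const hVfin.ne) isOpen_interior.measurableSet fun x hx => ?_
          rw [le_div_iff₀ (by positivity)]
          refine (hP x ?_).trans hCS
          rw [mem_closedBall]
          exact hE.dist_le x (interior_subset hx) c hE.center_mem
      _ = C * S / h ^ 2 * volume.real (interior E) := by
          rw [setIntegral_const, smul_eq_mul, mul_comm]
      _ ≤ _ := by gcongr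
  calc h ^ 2 * ∫ x in interior E, polyFun p x ^ 2 ≤ h ^ 2 * (C * S / h ^ 2 * (Real.pi * h ^ 2)) := by
        gcongr
    _ = Real.pi * C * (h ^ 2 * S) := by field_simp
    _ ≤ Real.pi * C * (2 * Real.pi * C * G) := by gcongr
    _ = _ := by ring

/-! ### Gradients of linear combinations -/

lemma gradient_add_apply {f g : Plane → ℝ} {x : Plane} (hf : DifferentiableAt ℝ f x)
    (hg : DifferentiableAt ℝ g x) : gradient (f + g) x = gradient f x + gradient g x := by
  simp only [gradient, fderiv_add hf hg, map_add]

lemma gradient_const_smul_apply (a : ℝ) {f : Plane → ℝ} {x : Plane}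
    (hf : DifferentiableAt ℝ f x) : gradient (a • f) x = a • gradient f x := by
  simp only [gradient, fderiv_const_smul hf, map_smul]

lemma gradient_sum_apply {ι : Type*} (s : Finset ι) {f : ι → Plane → ℝ} {x : Plane}
    (hf : ∀ i ∈ s, DifferentiableAt ℝ (f i) x) :
    gradient (∑ i ∈ s, f i) x = ∑ i ∈ s, gradient (f i) x := by
  simp only [gradient, fderiv_sum hf, map_sum]

lemma measurable_gradient (w : Plane → ℝ) : Measurable (gradient w) :=
  (LinearIsometryEquiv.continuous _).measurable.comp (measurable_fderiv ℝ w)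

lemma norm_add_sq_le_two {F : Type*} [SeminormedAddCommGroup F] (a b : F) :
    ‖a + b‖ ^ 2 ≤ 2 * ‖a‖ ^ 2 + 2 * ‖b‖ ^ 2 := by
  have := norm_add_le a b
  nlinarith [norm_nonneg (a + b), norm_nonneg a, norm_nonneg b, sq_nonneg (‖a‖ - ‖b‖)]

lemma IsMomentPoly.add {k : ℕ} {p q : MvPolynomial (Fin 2) ℝ} (hp : IsMomentPoly k p)
    (hq : IsMomentPoly k q) : IsMomentPoly k (p + q) := by
  rcases hp with rfl | hp
  · rwa [zero_add]
  rcases hq with rfl | hq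
  · rw [add_zero]; exact Or.inr hp
  right
  have := MvPolynomial.totalDegree_add p q
  rcases le_total p.totalDegree q.totalDegree with h | h
  · rw [max_eq_right h] at this; omega
  · rw [max_eq_left h] at this; omega

lemma IsMomentPoly.smul {k : ℕ} {p : MvPolynomial (Fin 2) ℝ} (hp : IsMomentPoly k p) (a : ℝ) :
    IsMomentPoly k (a • p) := by
  rcases hp with rfl | hp
  · rw [smul_zero]; exact Or.inl rfl
  · right
    have := MvPolynomial.totalDegree_smul_le a p
    omega

lemma IsMomentPoly.totalDegree_le {k : ℕ} {p : MvPolynomial (Fin 2) ℝ} (hp : IsMomentPoly k p) :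
    p.totalDegree ≤ k := by
  rcases hp with rfl | hp
  · simp
  · omega

/-! ### The geometry of an element -/

namespace Element

variable (T : Element)

/-- The vector from the first to the second endpoint of an edge. -/
def edgeVec (a : Fin T.n) : Plane := T.poly (finRotate T.n a) - T.poly a

lemma edgePath_eq (a : Fin T.n) (t : ℝ) :
    T.poly.edgePath ℝ a t = T.poly a + t • T.edgeVec a := by
  rw [Polygon.edgePath, AffineMap.lineMap_apply, vsub_eq_sub, vadd_eq_add, add_comm, edgeVec]

lemma frontier_eq : frontier T.carrier = ⋃ a, T.poly.edgeSet ℝ a := T.frontier_carrier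

lemma edgePath_mem_frontier (a : Fin T.n) {t : ℝ} (ht : t ∈ Icc (0 : ℝ) 1) :
    T.poly.edgePath ℝ a t ∈ frontier T.carrier := by
  rw [frontier_eq]
  exact mem_iUnion.2 ⟨a, mem_image_of_mem _ ht⟩

lemma exists_edgePath {x : Plane} (hx : x ∈ frontier T.carrier) :
    ∃ a, ∃ t ∈ Icc (0 : ℝ) 1, T.poly.edgePath ℝ a t = x := by
  rw [frontier_eq] at hx
  obtain ⟨a, ha⟩ := mem_iUnion.1 hx
  obtain ⟨t, ht, h⟩ := ha
  exact ⟨a, t, ht, h⟩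

lemma edgePath_zero (a : Fin T.n) : T.poly.edgePath ℝ a 0 = T.poly a := by
  rw [edgePath_eq, zero_smul, add_zero]

lemma edgePath_one (a : Fin T.n) : T.poly.edgePath ℝ a 1 = T.poly (finRotate T.n a) := by
  rw [edgePath_eq, one_smul, edgeVec, add_sub_cancel]

lemma finRotate_ne (a : Fin T.n) : finRotate T.n a ≠ a := by
  obtain ⟨m, hm⟩ : ∃ m, T.n = m + 2 := ⟨T.n - 2, by have := T.three_le; omega⟩
  have key : ∀ (n : ℕ), n = m + 2 → ∀ a : Fin n, finRotate n a ≠ a := by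
    rintro n rfl a
    rw [finRotate_apply]
    simp
  exact key _ hm a

lemma vertex_mem_frontier (a : Fin T.n) : T.poly a ∈ frontier T.carrier := by
  rw [← edgePath_zero]
  exact T.edgePath_mem_frontier a ⟨le_rfl, zero_le_one⟩

lemma frontier_subset : frontier T.carrier ⊆ T.carrier :=
  T.isCompact_carrier.isClosed.frontier_subset

/-- Some edge; elements have at least three of them. -/
def someEdge : Fin T.n := ⟨0, by have := T.three_le; omega⟩

lemma isClosed_edgeSet (a : Fin T.n) : IsClosed (T.poly.edgeSet ℝ a) := by
  rw [Polygon.edgeSet_eq_image_edgePath]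
  refine (isCompact_Icc.image ?_).isClosed
  have h : ⇑(T.poly.edgePath ℝ a) = fun t => T.poly a + t • T.edgeVec a :=
    funext (T.edgePath_eq a)
  rw [h]
  fun_prop

/-- Each edge lies on a line, a proper affine subspace. Integrals over an element may therefore be
taken over its interior, where gradients and the coefficient are under control. -/
lemma volume_frontier : volume (frontier T.carrier) = 0 := by
  rw [frontier_eq]
  refine measure_iUnion_null fun a => ?_
  have hsub : T.poly.edgeSet ℝ a ⊆ (line[ℝ, T.poly a, T.poly (finRotate T.n a)] : Set Plane) := by
    rintro _ ⟨t, -, rfl⟩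
    exact AffineMap.lineMap_mem_affineSpan_pair _ _ _
  refine measure_mono_null hsub (Measure.addHaar_affineSubspace volume _ fun htop => ?_)
  have h1 := congrArg AffineSubspace.direction htop
  rw [direction_affineSpan, AffineSubspace.direction_top] at h1
  have h3 : Module.finrank ℝ (vectorSpan ℝ {T.poly a, T.poly (finRotate T.n a)}) ≤ 1 :=
    collinear_iff_finrank_le_one.1 (collinear_pair ℝ _ _)
  rw [h1] at h3
  simp at h3

lemma interior_ae_eq : interior T.carrier =ᵐ[volume] T.carrier := by
  refine (interior_subset.eventuallyLE).antisymm ?_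
  rw [ae_le_set]
  refine measure_mono_null ?_ T.volume_frontier
  rw [frontier, T.isCompact_carrier.isClosed.closure_eq]

lemma setIntegral_carrier (f : Plane → ℝ) :
    ∫ x in T.carrier, f x = ∫ x in interior T.carrier, f x :=
  setIntegral_congr_set T.interior_ae_eq.symm

variable {T}

lemma dist_le_diam {x y : Plane} (hx : x ∈ T.carrier) (hy : y ∈ T.carrier) :
    dist x y ≤ diam T.carrier :=
  Metric.dist_le_diam_of_mem T.isCompact_carrier.isBounded hx hy

variable (T)

lemma diam_pos : 0 < diam T.carrier := by
  have h1 : T.poly (finRotate T.n T.someEdge) ≠ T.poly T.someEdge := fun h =>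
    T.finRotate_ne T.someEdge (T.vertices_injective h)
  exact (dist_pos.2 h1).trans_le (dist_le_diam (T.frontier_subset (T.vertex_mem_frontier _))
    (T.frontier_subset (T.vertex_mem_frontier _)))

variable {T}

lemma norm_edgeVec_le (a : Fin T.n) : ‖T.edgeVec a‖ ≤ diam T.carrier := by
  rw [edgeVec, ← dist_eq_norm]
  exact dist_le_diam (T.frontier_subset (T.vertex_mem_frontier _))
    (T.frontier_subset (T.vertex_mem_frontier _))

lemma le_norm_edgeVec {γ : ℝ} (hT : T.IsShapeRegular γ) (a : Fin T.n) :
    γ * diam T.carrier ≤ ‖T.edgeVec a‖ := by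
  rw [edgeVec, ← dist_eq_norm]
  exact hT.2 _ _ (T.finRotate_ne a)

lemma IsShapeRegular.exists_isStarRegion {γ : ℝ} (hγ : 0 < γ) (hT : T.IsShapeRegular γ) :
    ∃ c, IsStarRegion T.carrier c (γ * diam T.carrier) (diam T.carrier) := by
  obtain ⟨c, hc, hstar⟩ := hT.1
  exact ⟨c, T.isCompact_carrier, mul_pos hγ T.diam_pos, hc, hstar,
    fun x hx y hy => dist_le_diam hx hy⟩

lemma IsShapeRegular.le_one {γ : ℝ} (hγ : 0 < γ) (hT : T.IsShapeRegular γ) : γ ≤ 1 := by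
  obtain ⟨c, hc⟩ := hT.exists_isStarRegion hγ
  have := hc.radius_le
  have := T.diam_pos
  by_contra! h
  nlinarith

/-! ### The local space as a submodule -/

lemma differentiableAt_of_mem {k : ℕ} {v : Plane → ℝ} (hv : v ∈ T.localSpace k) {x : Plane}
    (hx : x ∈ interior T.carrier) : DifferentiableAt ℝ v x :=
  (hv.2.1.contDiffAt (isOpen_interior.mem_nhds hx)).differentiableAt two_ne_zero

lemma add_mem_localSpace {k : ℕ} {v w : Plane → ℝ} (hv : v ∈ T.localSpace k)
    (hw : w ∈ T.localSpace k) : v + w ∈ T.localSpace k := by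
  refine ⟨hv.1.add hw.1, hv.2.1.add hw.2.1, ?_, ?_, fun a => ?_⟩
  · refine Integrable.mono' (g := fun x => 2 * ‖gradient v x‖ ^ 2 + 2 * ‖gradient w x‖ ^ 2)
      ((hv.2.2.1.const_mul 2).add (hw.2.2.1.const_mul 2))
      ((measurable_gradient _).norm.pow_const 2).aestronglyMeasurable ?_
    refine (ae_restrict_iff' isOpen_interior.measurableSet).2 (ae_of_all _ fun x hx => ?_)
    rw [Real.norm_of_nonneg (by positivity),
      gradient_add_apply (differentiableAt_of_mem hv hx) (differentiableAt_of_mem hw hx)]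
    exact norm_add_sq_le_two _ _
  · obtain ⟨p, hp, hpe⟩ := hv.2.2.2.1
    obtain ⟨q, hq, hqe⟩ := hw.2.2.2.1
    refine ⟨p + q, hp.add hq, fun x hx => ?_⟩
    have hx' := isOpen_interior.mem_nhds hx
    rw [(hv.2.1.contDiffAt hx').laplacian_add (hw.2.1.contDiffAt hx'), hpe x hx, hqe x hx, map_add]
  · obtain ⟨p, hp, hpe⟩ := hv.2.2.2.2 a
    obtain ⟨q, hq, hqe⟩ := hw.2.2.2.2 a
    refine ⟨p + q, natDegree_add_le_of_degree_le hp hq, fun t ht => ?_⟩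
    rw [Pi.add_apply, hpe t ht, hqe t ht, eval_add]

lemma smul_mem_localSpace {k : ℕ} {v : Plane → ℝ} (r : ℝ) (hv : v ∈ T.localSpace k) :
    r • v ∈ T.localSpace k := by
  refine ⟨hv.1.const_smul r, hv.2.1.const_smul r, ?_, ?_, fun a => ?_⟩
  · refine IntegrableOn.congr_fun (hv.2.2.1.const_mul (r ^ 2)) (fun x hx => ?_) isOpen_interior.measurableSet
    rw [gradient_const_smul_apply r (differentiableAt_of_mem hv hx), norm_smul, mul_pow,
      Real.norm_eq_abs, sq_abs]
  · obtain ⟨p, hp, hpe⟩ := hv.2.2.2.1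
    refine ⟨r • p, hp.smul r, fun x hx => ?_⟩
    have hx' := isOpen_interior.mem_nhds hx
    rw [InnerProductSpace.laplacian_smul r (hv.2.1.contDiffAt hx'), hpe x hx, MvPolynomial.smul_eval, smul_eq_mul]
  · obtain ⟨p, hp, hpe⟩ := hv.2.2.2.2 a
    refine ⟨r • p, (natDegree_smul_le r p).trans hp, fun t ht => ?_⟩
    rw [Pi.smul_apply, hpe t ht, eval_smul]

lemma const_mem_localSpace (k : ℕ) (T : Element) (r : ℝ) :
    (fun _ => r) ∈ T.localSpace k := by
  refine ⟨continuousOn_const, contDiffOn_const, ?_, ⟨0, Or.inl rfl, fun x _ => ?_⟩, fun a =>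
    ⟨C r, by simp, fun t _ => by simp⟩⟩
  · simp
  · simp

/-- The local virtual element space as a submodule of the space of functions. -/
def localSubmodule (k : ℕ) (T : Element) : Submodule ℝ (Plane → ℝ) where
  carrier := T.localSpace k
  add_mem' := add_mem_localSpace
  zero_mem' := const_mem_localSpace k T 0
  smul_mem' := fun r _ hv => smul_mem_localSpace r hv

/-- Membership depends only on the values on the element, since gradient and Laplacian are used at
interior points only. This allows a function to be set to zero outside a region. -/
lemma localSpace_congr {k : ℕ} {v w : Plane → ℝ} (hv : v ∈ T.localSpace k)
    (h : ∀ x ∈ T.carrier, w x = v x) : w ∈ T.localSpace k := by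
  have hev : ∀ x ∈ interior T.carrier, w =ᶠ[𝓝 x] v := fun x hx => by
    filter_upwards [isOpen_interior.mem_nhds hx] with y hy using h y (interior_subset hy)
  refine ⟨hv.1.congr h, hv.2.1.congr fun x hx => h x (interior_subset hx), ?_, ?_, fun a => ?_⟩
  · refine IntegrableOn.congr_fun hv.2.2.1 (fun x hx => ?_) isOpen_interior.measurableSet
    rw [(hev x hx).gradient_eq]
  · obtain ⟨p, hp, hpe⟩ := hv.2.2.2.1
    refine ⟨p, hp, fun x hx => ?_⟩
    rw [Filter.EventuallyEq.eq_of_nhds (InnerProductSpace.laplacian_congr_nhds (hev x hx)),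
      hpe x hx]
  · obtain ⟨p, hp, hpe⟩ := hv.2.2.2.2 a
    refine ⟨p, hp, fun t ht => ?_⟩
    rw [h _ (T.frontier_subset (T.edgePath_mem_frontier a ht)), hpe t ht]

end Element

/-! ### Stability of the local space with respect to its degrees of freedom -/

/-- Cauchy-Schwarz, from the discriminant of `t ↦ ∫ (t f + g)²`. -/
lemma sq_integral_mul_le {α : Type*} [MeasurableSpace α] {μ : Measure α} {f g : α → ℝ}
    (hf : Integrable (fun x => f x ^ 2) μ) (hg : Integrable (fun x => g x ^ 2) μ)
    (hfg : Integrable (fun x => f x * g x) μ) :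
    (∫ x, f x * g x ∂μ) ^ 2 ≤ (∫ x, f x ^ 2 ∂μ) * ∫ x, g x ^ 2 ∂μ := by
  have key : ∀ t : ℝ, 0 ≤ (∫ x, f x ^ 2 ∂μ) * (t * t) + (2 * ∫ x, f x * g x ∂μ) * t +
      ∫ x, g x ^ 2 ∂μ := by
    intro t
    have h1 : ∫ x, (t * f x + g x) ^ 2 ∂μ = (∫ x, f x ^ 2 ∂μ) * (t * t) +
        (2 * ∫ x, f x * g x ∂μ) * t + ∫ x, g x ^ 2 ∂μ := by
      have h2 : (fun x => (t * f x + g x) ^ 2) =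
          fun x => t ^ 2 * f x ^ 2 + 2 * t * (f x * g x) + g x ^ 2 := by
        funext x; ring
      have h3 := hf.const_mul (t ^ 2)
      have h4 := hfg.const_mul (2 * t)
      have h5 : Integrable (fun x => t ^ 2 * f x ^ 2 + 2 * t * (f x * g x)) μ := h3.add h4
      rw [h2, integral_add h5 hg, integral_add h3 h4, integral_const_mul, integral_const_mul]
      ring
    rw [← h1]
    exact integral_nonneg fun x => sq_nonneg _
  have := discrim_le_zero key
  rw [discrim] at this
  nlinarith

/-- Young's inequality in the form needed for absorption. With `G` the energy and `P` the squared
norm of the Laplacian, an integral `I` against the Laplacian costs only a quarter of the energy. -/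
lemma two_mul_abs_le_of_sq_le {C G P N I h : ℝ} (hC : 0 ≤ C) (hG : 0 ≤ G) (hN : 0 ≤ N)
    (hP : h ^ 2 * P ≤ C * G) (hI : I ^ 2 ≤ N * P) :
    2 * h ^ 2 * |I| ≤ h ^ 2 * G / 4 + 4 * (C + 1) * N := by
  refine abs_le_of_sq_le_sq' ?_ (by positivity) |>.2
  rw [mul_pow, sq_abs]
  have h1 : h ^ 4 * I ^ 2 ≤ h ^ 2 * N * (C * G) := by
    calc h ^ 4 * I ^ 2 ≤ h ^ 4 * (N * P) := by gcongr
      _ = h ^ 2 * N * (h ^ 2 * P) := by ring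
      _ ≤ h ^ 2 * N * (C * G) := by gcongr
  have h2 : 0 ≤ h ^ 2 * G * N := by positivity
  nlinarith [sq_nonneg (h ^ 2 * G / 4 - 4 * (C + 1) * N)]

namespace Element

variable {T : Element}

lemma integrableOn_interior {f : Plane → ℝ} (hf : ContinuousOn f T.carrier) :
    IntegrableOn f (interior T.carrier) :=
  (hf.integrableOn_compact T.isCompact_carrier).mono_set interior_subset

/-- A polynomial of degree at most `k` on an edge is controlled by its values at the endpoints
and at the interior Gauss-Lobatto nodes. -/
lemma exists_boundary_bound {k : ℕ} (hk : 1 ≤ k) : ∃ C : ℝ, 1 ≤ C ∧ ∀ T : Element,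
    ∀ z ∈ T.localSpace k, ∀ b : ℝ, (∀ a, |z (T.poly a)| ≤ b) →
      (∀ a, ∀ t ∈ Ioo (0 : ℝ) 1, aeval t (derivative (shiftedLegendre k)) = 0 →
        |z (T.poly.edgePath ℝ a t)| ≤ b) →
      (∀ x ∈ frontier T.carrier, |z x| ≤ C * b) ∧
      ∀ a, ∀ s ∈ Icc (0 : ℝ) 1, ∀ t ∈ Icc (0 : ℝ) 1,
        |z (T.poly.edgePath ℝ a s) - z (T.poly.edgePath ℝ a t)| ≤ C * b * |s - t| := by
  obtain ⟨C, hC1, hC⟩ := exists_edge_bound hk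
  refine ⟨C, hC1, fun T z hz b hv hn => ?_⟩
  have key : ∀ a, (∀ t ∈ Icc (0 : ℝ) 1, |z (T.poly.edgePath ℝ a t)| ≤ C * b) ∧
      ∀ s ∈ Icc (0 : ℝ) 1, ∀ t ∈ Icc (0 : ℝ) 1,
        |z (T.poly.edgePath ℝ a s) - z (T.poly.edgePath ℝ a t)| ≤ C * b * |s - t| := by
    intro a
    obtain ⟨q, hq, hqe⟩ := hz.2.2.2.2 a
    obtain ⟨h1, h2⟩ := hC q hq b
      (by rw [← hqe 0 ⟨le_rfl, zero_le_one⟩, edgePath_zero]; exact hv _)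
      (by rw [← hqe 1 ⟨zero_le_one, le_rfl⟩, edgePath_one]; exact hv _)
      (fun t ht h0 => by rw [← hqe t (Ioo_subset_Icc_self ht)]; exact hn a t ht h0)
    exact ⟨fun t ht => by rw [hqe t ht]; exact h1 t ht,
      fun s hs t ht => by rw [hqe s hs, hqe t ht]; exact h2 s hs t ht⟩
  refine ⟨fun x hx => ?_, fun a => (key a).2⟩
  obtain ⟨a, t, ht, rfl⟩ := T.exists_edgePath hx
  exact (key a).1 t ht

/-- Edges have length at least `γ * diam`, which turns a Lipschitz bound in the edge parameter into
one in the distance. -/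
lemma abs_sub_le_dist_of_edge {γ : ℝ} (hγ : 0 < γ) (hT : T.IsShapeRegular γ) {z : Plane → ℝ}
    {B : ℝ} (hB : 0 ≤ B) {a : Fin T.n} (h : ∀ s ∈ Icc (0 : ℝ) 1, ∀ t ∈ Icc (0 : ℝ) 1,
      |z (T.poly.edgePath ℝ a s) - z (T.poly.edgePath ℝ a t)| ≤ B * |s - t|) :
    ∀ x ∈ T.poly.edgeSet ℝ a, ∀ y ∈ T.poly.edgeSet ℝ a,
      |z x - z y| ≤ B / (γ * diam T.carrier) * dist x y := by
  have hρ : 0 < γ * diam T.carrier := mul_pos hγ T.diam_pos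
  rintro _ ⟨s, hs, rfl⟩ _ ⟨t, ht, rfl⟩
  refine (h s hs t ht).trans ?_
  have h1 : dist (T.poly.edgePath ℝ a s) (T.poly.edgePath ℝ a t) = |s - t| * ‖T.edgeVec a‖ := by
    rw [edgePath_eq, edgePath_eq, dist_add_left, dist_eq_norm, ← sub_smul, norm_smul,
      Real.norm_eq_abs]
  change _ ≤ B / (γ * diam T.carrier) * dist (T.poly.edgePath ℝ a s) (T.poly.edgePath ℝ a t)
  rw [h1, div_mul_eq_mul_div, le_div_iff₀ hρ]
  calc B * |s - t| * (γ * diam T.carrier) ≤ B * |s - t| * ‖T.edgeVec a‖ := by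
        have := le_norm_edgeVec hT a
        gcongr
    _ = _ := by ring

/-- An extension of the boundary values of a function in the local space. -/
lemma exists_extension {γ : ℝ} (hγ : 0 < γ) : ∃ A : ℝ, 0 ≤ A ∧ ∀ T : Element,
    T.IsShapeRegular γ → ∀ z : Plane → ℝ, ContinuousOn z (frontier T.carrier) → ∀ B : ℝ, 0 ≤ B →
      (∀ x ∈ frontier T.carrier, |z x| ≤ B) →
      (∀ a, ∀ s ∈ Icc (0 : ℝ) 1, ∀ t ∈ Icc (0 : ℝ) 1,
        |z (T.poly.edgePath ℝ a s) - z (T.poly.edgePath ℝ a t)| ≤ B * |s - t|) →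
      ∃ (Λ : ℝ≥0) (g : Plane → ℝ), LipschitzWith Λ g ∧ (Λ : ℝ) * diam T.carrier = A * B ∧
        (∀ x ∈ frontier T.carrier, g x = z x) ∧ ∀ x ∈ T.carrier, |g x| ≤ (A + 1) * B := by
  refine ⟨1 / γ * (2 / γ * (1 + 1 / γ)) + 4 / γ, by positivity, fun T hT z hz B hB hb hl => ?_⟩
  obtain ⟨c, hc⟩ := hT.exists_isStarRegion hγ
  have hd := T.diam_pos
  set d := diam T.carrier with hdd
  obtain ⟨g, hg, hgz⟩ := hc.exists_lipschitz_extension T.isClosed_edgeSet T.frontier_eq hz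
    (Λ := B / (γ * d)) (b := B) (by positivity)
    (fun a => abs_sub_le_dist_of_edge hγ hT hB (hl a)) hb
  have hΛ : ((Real.toNNReal (B / (γ * d) * (2 * d / (γ * d) * (1 + d / (γ * d))) +
      4 * B / (γ * d)) : ℝ≥0) : ℝ) * d =
      (1 / γ * (2 / γ * (1 + 1 / γ)) + 4 / γ) * B := by
    rw [Real.coe_toNNReal _ (by positivity)]
    field_simp
  refine ⟨_, g, hg, hΛ, hgz, fun x hx => ?_⟩
  have hv := T.vertex_mem_frontier T.someEdge
  have h1 := hg.dist_le_mul x (T.poly T.someEdge)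
  have h2 : dist x (T.poly T.someEdge) ≤ d := dist_le_diam hx (T.frontier_subset hv)
  have h3 := hb _ hv
  rw [← hgz _ hv] at h3
  rw [Real.dist_eq] at h1
  have h4 := h1.trans (mul_le_mul_of_nonneg_left h2 (NNReal.coe_nonneg _))
  rw [hΛ] at h4
  have h5 := abs_sub_abs_le_abs_sub (g x) (g (T.poly T.someEdge))
  linarith

/-- The energy of a function in the local space is controlled by its boundary values and
moments. -/
lemma exists_energy_bound (k : ℕ) {γ : ℝ} (hγ : 0 < γ) : ∃ C : ℝ, 0 ≤ C ∧ ∀ T : Element,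
    T.IsShapeRegular γ → ∀ z ∈ T.localSpace k, ∀ B N : ℝ, 0 ≤ B → 0 ≤ N →
      (∀ x ∈ frontier T.carrier, |z x| ≤ B) →
      (∀ a, ∀ s ∈ Icc (0 : ℝ) 1, ∀ t ∈ Icc (0 : ℝ) 1,
        |z (T.poly.edgePath ℝ a s) - z (T.poly.edgePath ℝ a t)| ≤ B * |s - t|) →
      (∀ p, IsMomentPoly k p → (∫ x in interior T.carrier, z x * polyFun p x) ^ 2 ≤
        N * ∫ x in interior T.carrier, polyFun p x ^ 2) →
      diam T.carrier ^ 2 * (∫ x in interior T.carrier, ‖gradient z x‖ ^ 2) ≤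
        C * (diam T.carrier ^ 2 * B ^ 2 + N) := by
  obtain ⟨A, hA, hext⟩ := exists_extension hγ
  -- The radius `γ / 2 * diam` of the bubble is strictly below the radius `γ * diam` of the kernel
  -- ball.
  obtain ⟨D, hD, hlap⟩ := exists_laplacian_bound k (half_pos hγ)
  refine ⟨4 * Real.pi * A ^ 2 + 8 * (D + 1) * (1 + (A + 1) ^ 2 * Real.pi), by positivity,
    fun T hT z hz B N hB hN hb hl hm => ?_⟩
  obtain ⟨c, hc⟩ := hT.exists_isStarRegion hγ
  obtain ⟨Λ, g, hg, hΛ, hgz, hgb⟩ := hext T hT z (hz.1.mono T.frontier_subset) B hB hb hl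
  obtain ⟨p, hp, hpe⟩ := hz.2.2.2.1
  have hd := T.diam_pos
  have hP := hlap T.carrier c _ _ hc (by nlinarith) z p hp.totalDegree_le hz.2.1 hz.2.2.1 hpe
  have hE := hc.energy_le hz.1 hz.2.1 hz.2.2.1 (continuous_polyFun p) hpe hg hgz
  have hV : volume.real (interior T.carrier) ≤ Real.pi * diam T.carrier ^ 2 :=
    ENNReal.toReal_le_of_le_ofReal (by positivity) hc.volume_interior_le
  have hV0 : 0 ≤ volume.real (interior T.carrier) := measureReal_nonneg
  have hG : 0 ≤ ∫ x in interior T.carrier, ‖gradient z x‖ ^ 2 :=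
    integral_nonneg fun x => sq_nonneg _
  have hpc : ContinuousOn (polyFun p) T.carrier := (continuous_polyFun p).continuousOn
  have hgc : ContinuousOn g T.carrier := hg.continuous.continuousOn
  -- The part with `z` is bounded by the moment hypothesis, the part with `g` by the size of `g`.
  -- Each costs a quarter of the energy, so half of it survives on the left and the constants
  -- double.
  have hsplit : ∫ x in interior T.carrier, polyFun p x * (z x - g x) =
      (∫ x in interior T.carrier, z x * polyFun p x) -
        ∫ x in interior T.carrier, g x * polyFun p x := by
    have h1 : IntegrableOn (fun x => z x * polyFun p x) (interior T.carrier) :=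
      integrableOn_interior (hz.1.mul hpc)
    have h2 : IntegrableOn (fun x => g x * polyFun p x) (interior T.carrier) :=
      integrableOn_interior (hgc.mul hpc)
    rw [← integral_sub h1 h2]
    congr 1; ext x; ring
  have hI1 := two_mul_abs_le_of_sq_le hD hG hN hP (hm p hp)
  have hN2 : ∫ x in interior T.carrier, g x ^ 2 ≤
      ((A + 1) * B) ^ 2 * (Real.pi * diam T.carrier ^ 2) := by
    calc ∫ x in interior T.carrier, g x ^ 2
        ≤ ∫ x in interior T.carrier, ((A + 1) * B) ^ 2 := by
          refine setIntegral_mono_on (integrableOn_interior (hgc.pow 2)) ?_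
            isOpen_interior.measurableSet fun x hx => ?_
          · exact integrableOn_interior continuousOn_const
          · rw [← sq_abs]
            exact pow_le_pow_left₀ (abs_nonneg _) (hgb x (interior_subset hx)) 2
      _ = ((A + 1) * B) ^ 2 * volume.real (interior T.carrier) := by
          rw [setIntegral_const, smul_eq_mul, mul_comm]
      _ ≤ _ := by gcongr
  have hI2 := two_mul_abs_le_of_sq_le (I := ∫ x in interior T.carrier, g x * polyFun p x) hD hG
    (by positivity : 0 ≤ ((A + 1) * B) ^ 2 * (Real.pi * diam T.carrier ^ 2)) hP (by
      refine (sq_integral_mul_le (integrableOn_interior (hgc.pow 2))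
        (integrableOn_interior (hpc.pow 2)) (integrableOn_interior (hgc.mul hpc))).trans ?_
      exact mul_le_mul_of_nonneg_right hN2 (integral_nonneg fun x => sq_nonneg _))
  change _ ≤ 2 * (Λ : ℝ) ^ 2 * _ - 2 * ∫ x in interior T.carrier, polyFun p x * (z x - g x) at hE
  rw [hsplit] at hE
  generalize (∫ x in interior T.carrier, g x * polyFun p x) = I2 at *
  generalize (∫ x in interior T.carrier, z x * polyFun p x) = I1 at *
  generalize (∫ x in interior T.carrier, ‖gradient z x‖ ^ 2) = G at *
  have h1 := mul_le_mul_of_nonneg_left hE (sq_nonneg (diam T.carrier))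
  have h2 : diam T.carrier ^ 2 * (2 * (Λ : ℝ) ^ 2 * volume.real (interior T.carrier)) ≤
      2 * (A * B) ^ 2 * (Real.pi * diam T.carrier ^ 2) := by
    rw [← hΛ]
    calc _ = 2 * ((Λ : ℝ) * diam T.carrier) ^ 2 * volume.real (interior T.carrier) := by ring
      _ ≤ _ := by gcongr
  have h3 : -(diam T.carrier ^ 2 * I1) ≤ diam T.carrier ^ 2 * |I1| := by
    rw [← mul_neg]; gcongr; exact neg_le_abs _
  have h4 : diam T.carrier ^ 2 * I2 ≤ diam T.carrier ^ 2 * |I2| := by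
    gcongr; exact le_abs_self _
  have h5 : 0 ≤ (4 * Real.pi * A ^ 2 + 8 * (D + 1) * ((A + 1) ^ 2 * Real.pi)) * N := by positivity
  have h6 : 0 ≤ 8 * (D + 1) * (diam T.carrier ^ 2 * B ^ 2) := by positivity
  nlinarith

/-- The trace inequality with `ℓ = γ / 2` and `τ = 1 / 2`, combined with the Poincaré inequality
`hS`; all powers of the diameter cancel. -/
lemma sq_le_of_trace {γ d u β S G : ℝ} (hγ : 0 < γ) (hd : 0 < d) (hu : γ * d ≤ u)
    (htr : γ * d * u * (γ / 2 * (1 / 2) * β ^ 2) ≤ 2 * S + 2 * ((1 / 2) ^ 2 * d ^ 2) * G)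
    (hS : S ≤ 8 * (1 / γ) ^ 2 * d ^ 2 * G) :
    β ^ 2 ≤ 4 / γ ^ 3 * (16 * (1 / γ) ^ 2 + 1) * G := by
  have h0 : 0 ≤ d ^ 2 * (γ ^ 3 * β ^ 2) := by positivity
  have h1 : γ * d * (γ * d) * (γ / 2 * (1 / 2) * β ^ 2) ≤
      γ * d * u * (γ / 2 * (1 / 2) * β ^ 2) := by gcongr
  have h2 : d ^ 2 * (γ ^ 3 / 4 * β ^ 2) ≤ d ^ 2 * ((16 * (1 / γ) ^ 2 + 1 / 2) * G) := by
    linarith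
  have h3 := le_of_mul_le_mul_left h2 (by positivity)
  have hG : 0 ≤ G := by
    have : 0 ≤ (16 * (1 / γ) ^ 2 + 1 / 2) * G := le_trans (by positivity) h3
    exact (mul_nonneg_iff_of_pos_left (by positivity)).1 this
  rw [div_mul_eq_mul_div, div_mul_eq_mul_div, le_div_iff₀ (by positivity)]
  linarith

/-- A Friedrichs inequality. -/
lemma exists_integral_sq_bound {γ : ℝ} (hγ : 0 < γ) : ∃ C : ℝ, 0 ≤ C ∧ ∀ T : Element,
    T.IsShapeRegular γ → ∀ z : Plane → ℝ, ContinuousOn z T.carrier →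
      ContDiffOn ℝ 1 z (interior T.carrier) →
      IntegrableOn (fun x => ‖gradient z x‖ ^ 2) (interior T.carrier) → ∀ B : ℝ, 0 ≤ B →
      (∀ x ∈ frontier T.carrier, |z x| ≤ B) →
      ∫ x in interior T.carrier, z x ^ 2 ≤ C * (diam T.carrier ^ 2 * B ^ 2 +
        diam T.carrier ^ 2 * ∫ x in interior T.carrier, ‖gradient z x‖ ^ 2) := by
  refine ⟨16 * (1 / γ) ^ 2 + 4 * Real.pi * (1 + 4 / γ ^ 3 * (16 * (1 / γ) ^ 2 + 1)), by positivity,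
    fun T hT z hzc hzd hzg B hB hb => ?_⟩
  obtain ⟨c, hc⟩ := hT.exists_isStarRegion hγ
  have hγ1 := hT.le_one hγ
  have hd := T.diam_pos
  obtain ⟨a, ha, -⟩ := hc.poincare hzc hzd hzg
  have hV : volume.real (interior T.carrier) ≤ Real.pi * diam T.carrier ^ 2 :=
    ENNReal.toReal_le_of_le_ofReal (by positivity) hc.volume_interior_le
  have hG : 0 ≤ ∫ x in interior T.carrier, ‖gradient z x‖ ^ 2 :=
    integral_nonneg fun x => sq_nonneg _
  have hr : diam T.carrier / (γ * diam T.carrier) = 1 / γ := by field_simp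
  rw [hr] at ha
  have hgr : ∀ x, gradient (fun y => z y - a) x = gradient z x := by
    intro x
    simp only [gradient, fderiv_sub_const]
  have hac : ContinuousOn (fun x => z x - a) T.carrier := hzc.sub continuousOn_const
  have hsq : ∫ x in interior T.carrier, z x ^ 2 ≤
      2 * (∫ x in interior T.carrier, (z x - a) ^ 2) +
        2 * a ^ 2 * volume.real (interior T.carrier) := by
    have h1 : IntegrableOn (fun x => 2 * (z x - a) ^ 2) (interior T.carrier) :=
      integrableOn_interior (continuousOn_const.mul (hac.pow 2))
    have h2 : IntegrableOn (fun _ : Plane => 2 * a ^ 2) (interior T.carrier) :=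
      integrableOn_interior continuousOn_const
    have h3 : ∫ x in interior T.carrier, z x ^ 2 ≤
        ∫ x in interior T.carrier, (2 * (z x - a) ^ 2 + 2 * a ^ 2) := by
      refine setIntegral_mono_on (integrableOn_interior (hzc.pow 2)) (h1.add h2)
        isOpen_interior.measurableSet fun x _ => ?_
      nlinarith [sq_nonneg (z x - 2 * a)]
    rw [integral_add h1 h2, integral_const_mul, setIntegral_const, smul_eq_mul] at h3
    linarith
  have hγ3 : 0 < γ ^ 3 := by positivity
  have haB : a ^ 2 ≤ 2 * B ^ 2 + 2 * (4 / γ ^ 3 * (16 * (1 / γ) ^ 2 + 1) *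
      ∫ x in interior T.carrier, ‖gradient z x‖ ^ 2) := by
    have hR : 0 ≤ 4 / γ ^ 3 * (16 * (1 / γ) ^ 2 + 1) *
      ∫ x in interior T.carrier, ‖gradient z x‖ ^ 2 := by positivity
    -- If the Poincaré constant `a` exceeds the boundary bound `B`, then `|z - a| ≥ |a| - B` along a
    -- whole edge, and the trace inequality bounds this excess by the energy.
    rcases le_total |a| B with h | h
    · have : a ^ 2 ≤ B ^ 2 := by
        rw [← sq_abs]; exact pow_le_pow_left₀ (abs_nonneg _) h 2
      nlinarith [sq_nonneg B]
    have hu := norm_edgeVec_le (T := T) T.someEdge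
    have hu' := le_norm_edgeVec hT T.someEdge
    have htr := hc.trace_inequality (w := fun x => z x - a) hac (hzd.sub contDiffOn_const)
      (by simpa only [hgr] using hzg) (a := T.poly T.someEdge) (u := T.edgeVec T.someEdge)
      (fun s hs => by rw [← edgePath_eq]; exact T.edgePath_mem_frontier _ hs)
      (s₀ := 0) (ℓ := γ / 2) (τ := 1 / 2) (β := |a| - B) le_rfl (by positivity) (by linarith)
      (by nlinarith) (by norm_num) (by norm_num) (by linarith) (fun s hs => by
        have h1 := hb _ (T.edgePath_mem_frontier T.someEdge (t := s)
          ⟨hs.1, by have := hs.2; linarith⟩)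
        rw [edgePath_eq] at h1
        have h2 := abs_sub_abs_le_abs_sub a (z (T.poly T.someEdge + s • T.edgeVec T.someEdge))
        rw [abs_sub_comm a] at h2
        linarith)
    simp only [hgr] at htr
    have h8 := sq_le_of_trace hγ hd hu' htr ha
    nlinarith [sq_nonneg (|a| - 2 * B), sq_abs a]
  generalize (∫ x in interior T.carrier, ‖gradient z x‖ ^ 2) = G at *
  have h9 : 2 * a ^ 2 * volume.real (interior T.carrier) ≤
      2 * (2 * B ^ 2 + 2 * (4 / γ ^ 3 * (16 * (1 / γ) ^ 2 + 1) * G)) *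
        (Real.pi * diam T.carrier ^ 2) := by gcongr
  have h10 : 0 ≤ 16 * (1 / γ) ^ 2 * (diam T.carrier ^ 2 * B ^ 2) := by positivity
  have h11 : 0 ≤ 4 * Real.pi * (diam T.carrier ^ 2 * G) := by positivity
  have h12 : 0 ≤ 4 * Real.pi * (4 / γ ^ 3 * (16 * (1 / γ) ^ 2 + 1)) *
    (diam T.carrier ^ 2 * B ^ 2) := by positivity
  linarith

end Element

/-! ### Inverse estimate and interpolation of products on an element -/

/-- The depth `τ` of the layer is chosen such that the part of the energy coming from the boundary
values, weighted with `τ ^ 2`, is at most half of the left side, which is only linear in `τ`. After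
absorption the `L²` term remains. -/
lemma exists_parameter {γ ℓ C₁ C₂ : ℝ} (hγ : 0 < γ) (hγ1 : γ ≤ 1) (hℓ : 0 < ℓ) (hℓ1 : ℓ ≤ 1)
    (hC₁ : 0 ≤ C₁) (hC₂ : 0 ≤ C₂) : ∃ τ C : ℝ, 0 < τ ∧ τ < 1 ∧ 0 ≤ C ∧
      ∀ d u b W G : ℝ, 0 < d → γ * d ≤ u → 0 ≤ W → d ^ 2 * G ≤ C₂ * (d ^ 2 * b ^ 2) + C₁ * W →
        γ * d * u * (ℓ * τ * (b / 2) ^ 2) ≤ 2 * W + 2 * (τ ^ 2 * d ^ 2) * G →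
        d ^ 2 * b ^ 2 ≤ C * W := by
  have hγ2 : γ ^ 2 ≤ 1 := pow_le_one₀ hγ.le hγ1
  have hprod : γ ^ 2 * ℓ ≤ 1 := mul_le_one₀ hγ2 hℓ.le hℓ1
  set τ := γ ^ 2 * ℓ / (16 * (C₂ + 1)) with hτ
  have hτ0 : 0 < τ := by positivity
  have hτe : τ * (16 * (C₂ + 1)) = γ ^ 2 * ℓ := by rw [hτ]; field_simp
  have hτ1 : τ < 1 := by
    rw [hτ, div_lt_one (by positivity)]
    linarith
  refine ⟨τ, 8 * (2 + 2 * C₁) / (γ ^ 2 * ℓ * τ), hτ0, hτ1, by positivity,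
    fun d u b W G hd hu hW hG htr => ?_⟩
  have h1 : γ * d * (γ * d) * (ℓ * τ * (b / 2) ^ 2) ≤ γ * d * u * (ℓ * τ * (b / 2) ^ 2) := by
    gcongr
  have h2 : τ ^ 2 * (d ^ 2 * G) ≤ τ ^ 2 * (C₂ * (d ^ 2 * b ^ 2) + C₁ * W) := by gcongr
  have h3 : τ ^ 2 * (C₁ * W) ≤ 1 * (C₁ * W) := by
    gcongr
    exact pow_le_one₀ hτ0.le hτ1.le
  have h4 : τ ^ 2 * (C₂ * (d ^ 2 * b ^ 2)) ≤ τ * (γ ^ 2 * ℓ) / 16 * (d ^ 2 * b ^ 2) := by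
    rw [← hτe]
    have : 0 ≤ τ ^ 2 * (d ^ 2 * b ^ 2) := by positivity
    nlinarith
  rw [div_mul_eq_mul_div, le_div_iff₀ (by positivity)]
  nlinarith

namespace Element

lemma sq_integral_mul_polyFun_le {T : Element} {w : Plane → ℝ} (hw : ContinuousOn w T.carrier)
    (p : MvPolynomial (Fin 2) ℝ) : (∫ x in interior T.carrier, w x * polyFun p x) ^ 2 ≤
      (∫ x in interior T.carrier, w x ^ 2) * ∫ x in interior T.carrier, polyFun p x ^ 2 := by
  have hpc : ContinuousOn (polyFun p) T.carrier := (continuous_polyFun p).continuousOn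
  exact sq_integral_mul_le (integrableOn_interior (hw.pow 2)) (integrableOn_interior (hpc.pow 2))
    (integrableOn_interior (hw.mul hpc))

/-- The boundary values of a function in the local space are controlled by its `L²`-norm. -/
lemma exists_inverse_bound {k : ℕ} (hk : 1 ≤ k) {γ : ℝ} (hγ : 0 < γ) : ∃ C : ℝ, 0 ≤ C ∧
    ∀ T : Element, T.IsShapeRegular γ → ∀ w ∈ T.localSpace k, ∀ x ∈ frontier T.carrier,
      diam T.carrier ^ 2 * w x ^ 2 ≤ C * ∫ y in interior T.carrier, w y ^ 2 := by
  -- A kernel ball has radius at most the diameter, so there are no shape-regular elements for `γ >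
  -- 1`.
  by_cases hγ1 : γ ≤ 1
  swap
  · exact ⟨0, le_rfl, fun T hT => absurd (hT.le_one hγ) hγ1⟩
  obtain ⟨Ce, hCe, hbd⟩ := exists_boundary_bound hk
  obtain ⟨C₁, hC₁, hen⟩ := exists_energy_bound k hγ
  -- `Ce * ℓ ≤ 1 / 2` keeps at least half of the maximum `b` on the whole piece of edge; `ℓ ≤ γ / 2`
  -- makes the piece short compared with the kernel ball.
  set ℓ := min (γ / 2) (1 / (2 * Ce)) with hℓ
  have hℓ0 : 0 < ℓ := lt_min (by positivity) (by positivity)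
  have hℓγ : ℓ ≤ γ / 2 := min_le_left _ _
  have hℓC : Ce * ℓ ≤ 1 / 2 := by
    calc Ce * ℓ ≤ Ce * (1 / (2 * Ce)) := by gcongr; exact min_le_right _ _
      _ = 1 / 2 := by field_simp
  obtain ⟨τ, C, hτ0, hτ1, hC, hpar⟩ := exists_parameter (C₂ := C₁ * Ce ^ 2) hγ hγ1 hℓ0
    (by linarith) hC₁ (by positivity)
  refine ⟨C, hC, fun T hT w hw x hx => ?_⟩
  obtain ⟨c, hc⟩ := hT.exists_isStarRegion hγ
  have hd := T.diam_pos
  have hcomp : IsCompact (frontier T.carrier) :=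
    T.isCompact_carrier.of_isClosed_subset isClosed_frontier T.frontier_subset
  obtain ⟨x₀, hx₀, hmax⟩ := hcomp.exists_isMaxOn ⟨x, hx⟩ (hw.1.mono T.frontier_subset).abs
  have hb : ∀ y ∈ frontier T.carrier, |w y| ≤ |w x₀| := fun y hy => hmax hy
  set b := |w x₀| with hbdef
  have hb0 : 0 ≤ b := abs_nonneg _
  obtain ⟨hbd1, hbd2⟩ := hbd T w hw b (fun a => hb _ (T.vertex_mem_frontier a))
    (fun a t ht _ => hb _ (T.edgePath_mem_frontier a (Ioo_subset_Icc_self ht)))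
  have hW : 0 ≤ ∫ y in interior T.carrier, w y ^ 2 := integral_nonneg fun y => sq_nonneg _
  -- The moments of `w` are bounded by its own `L²` norm, so the energy is controlled by `b` and
  -- that norm.
  have hG := hen T hT w hw (Ce * b) _ (by positivity) hW hbd1 hbd2
    fun p _ => sq_integral_mul_polyFun_le hw.1 p
  obtain ⟨a, t₀, ht₀, rfl⟩ := T.exists_edgePath hx₀
  -- The interval of length `ℓ` starts or ends at the maximum point, on the side where it fits into
  -- `[0, 1]`.
  obtain ⟨s₀, hs₀, hs₁, hst⟩ : ∃ s₀, 0 ≤ s₀ ∧ s₀ + ℓ ≤ 1 ∧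
      ∀ s ∈ Icc s₀ (s₀ + ℓ), |s - t₀| ≤ ℓ := by
    rcases le_total t₀ (1 / 2) with h | h
    · refine ⟨t₀, ht₀.1, by linarith, fun s hs => ?_⟩
      rw [abs_le]; constructor <;> linarith [hs.1, hs.2]
    · refine ⟨t₀ - ℓ, by linarith, by linarith [ht₀.2], fun s hs => ?_⟩
      rw [abs_le]; constructor <;> linarith [hs.1, hs.2]
  have hu := norm_edgeVec_le a
  have hu' := le_norm_edgeVec hT a
  have htr := hc.trace_inequality hw.1 (hw.2.1.of_le one_le_two) hw.2.2.1
    (a := T.poly a) (u := T.edgeVec a)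
    (fun s hs => by rw [← edgePath_eq]; exact T.edgePath_mem_frontier _ hs)
    (s₀ := s₀) (ℓ := ℓ) (τ := τ) (β := b / 2) hs₀ hℓ0.le hs₁ (by nlinarith) hτ0 hτ1 (by positivity)
    (fun s hs => by
      have h1 := hbd2 a t₀ ht₀ s ⟨hs₀.trans hs.1, hs.2.trans hs₁⟩
      rw [abs_sub_comm t₀] at h1
      have h2 := abs_sub_abs_le_abs_sub (w (T.poly.edgePath ℝ a t₀)) (w (T.poly.edgePath ℝ a s))
      have h3 : Ce * b * |s - t₀| ≤ Ce * b * ℓ := by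
        have := hst s hs
        gcongr
      have h4 : Ce * ℓ * b ≤ 1 / 2 * b := by gcongr
      rw [← edgePath_eq]
      linarith)
  have hfin := hpar _ _ b _ _ hd hu' hW (by linarith) htr
  refine le_trans ?_ hfin
  have h5 : w x ^ 2 ≤ b ^ 2 := by
    rw [← sq_abs]
    exact pow_le_pow_left₀ (abs_nonneg _) (hb x hx) 2
  gcongr

/-- Cauchy-Schwarz together with `∑ χ_i² ≤ ∑ χ_i = 1`. The bound thus does not depend on the number
of terms. -/
lemma sq_sum_mul_le_sum_sq {ι : Type*} {s : Finset ι} {χ w : ι → ℝ} (h0 : ∀ i ∈ s, 0 ≤ χ i)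
    (h1 : ∑ i ∈ s, χ i = 1) : (∑ i ∈ s, χ i * w i) ^ 2 ≤ ∑ i ∈ s, w i ^ 2 := by
  have hle : ∀ i ∈ s, χ i ≤ 1 := fun i hi => by
    rw [← h1]; exact Finset.single_le_sum h0 hi
  calc (∑ i ∈ s, χ i * w i) ^ 2 ≤ (∑ i ∈ s, χ i ^ 2) * ∑ i ∈ s, w i ^ 2 :=
        Finset.sum_mul_sq_le_sq_mul_sq _ _ _
    _ ≤ 1 * ∑ i ∈ s, w i ^ 2 := by
        refine mul_le_mul_of_nonneg_right ?_ (Finset.sum_nonneg fun i _ => sq_nonneg _)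
        rw [← h1]
        refine Finset.sum_le_sum fun i hi => ?_
        nlinarith [h0 i hi, hle i hi]
    _ = _ := one_mul _

/-- The interpolant of a convex combination `∑ χ_i w_i` with discrete `w_i` is stable in `L²`,
together with an inverse estimate. -/
lemma exists_interpolant_bound {k : ℕ} (hk : 1 ≤ k) {γ : ℝ} (hγ : 0 < γ) : ∃ C : ℝ, 0 ≤ C ∧
    ∀ T : Element, T.IsShapeRegular γ → ∀ {ι : Type} (s : Finset ι) (χ w : ι → Plane → ℝ)
      (z : Plane → ℝ), (∀ i ∈ s, ContinuousOn (χ i) T.carrier) →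
      (∀ i ∈ s, ∀ x ∈ T.carrier, 0 ≤ χ i x) → (∀ x ∈ T.carrier, ∑ i ∈ s, χ i x = 1) →
      (∀ i ∈ s, w i ∈ T.localSpace k) → z ∈ T.localSpace k →
      T.SameDofs k (fun x => ∑ i ∈ s, χ i x * w i x) z →
      (∫ x in interior T.carrier, z x ^ 2) ≤
          C * ∑ i ∈ s, ∫ x in interior T.carrier, w i x ^ 2 ∧
        diam T.carrier ^ 2 * (∫ x in interior T.carrier, ‖gradient z x‖ ^ 2) ≤
          C * ∑ i ∈ s, ∫ x in interior T.carrier, w i x ^ 2 := by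
  obtain ⟨Ce, hCe, hbd⟩ := exists_boundary_bound hk
  obtain ⟨Ci, hCi, hinv⟩ := exists_inverse_bound hk hγ
  obtain ⟨C₁, hC₁, hen⟩ := exists_energy_bound k hγ
  obtain ⟨C₂, hC₂, hfr⟩ := exists_integral_sq_bound hγ
  have hA : 0 ≤ C₁ * (Ce ^ 2 * Ci + 1) := by positivity
  refine ⟨C₂ * (Ce ^ 2 * Ci + C₁ * (Ce ^ 2 * Ci + 1)) + C₁ * (Ce ^ 2 * Ci + 1), by positivity,
    fun T hT ι s χ w z hχc hχ0 hχ1 hw hz hdof => ?_⟩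
  have hd := T.diam_pos
  set S := ∑ i ∈ s, ∫ x in interior T.carrier, w i x ^ 2 with hS
  have hS0 : 0 ≤ S := Finset.sum_nonneg fun i _ => integral_nonneg fun x => sq_nonneg _
  set f : Plane → ℝ := fun x => ∑ i ∈ s, χ i x * w i x with hf
  have hfc : ContinuousOn f T.carrier :=
    continuousOn_finsetSum _ fun i hi => (hχc i hi).mul (hw i hi).1
  have hfsq : ∀ x ∈ T.carrier, f x ^ 2 ≤ ∑ i ∈ s, w i x ^ 2 := fun x hx =>
    sq_sum_mul_le_sum_sq (fun i hi => hχ0 i hi x hx) (hχ1 x hx)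
  -- The bound that the inverse estimate for the `w i` gives for `f` on the boundary. The degrees of
  -- freedom of `z` are values of `f` there and moments of `f`, so `b` and `S` control all of them.
  set b := √(Ci * S) / diam T.carrier with hb
  have hb0 : 0 ≤ b := by positivity
  have hbsq : diam T.carrier ^ 2 * b ^ 2 = Ci * S := by
    rw [hb, div_pow, Real.sq_sqrt (by positivity)]
    field_simp
  have hfb : ∀ x ∈ frontier T.carrier, |f x| ≤ b := by
    intro x hx
    have h1 : diam T.carrier ^ 2 * f x ^ 2 ≤ Ci * S := by
      calc diam T.carrier ^ 2 * f x ^ 2 ≤ diam T.carrier ^ 2 * ∑ i ∈ s, w i x ^ 2 := by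
            gcongr; exact hfsq x (T.frontier_subset hx)
        _ ≤ ∑ i ∈ s, Ci * ∫ x in interior T.carrier, w i x ^ 2 := by
            rw [Finset.mul_sum]
            exact Finset.sum_le_sum fun i hi => hinv T hT _ (hw i hi) x hx
        _ = Ci * S := by rw [hS, Finset.mul_sum]
    rw [← hbsq] at h1
    exact abs_le_of_sq_le_sq (le_of_mul_le_mul_left h1 (by positivity)) hb0
  obtain ⟨hb1, hb2⟩ := hbd T z hz b
    (fun a => by rw [hdof.1 a]; exact hfb _ (T.vertex_mem_frontier a))
    (fun a t ht h0 => by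
      rw [hdof.2.1 a t ht h0]
      exact hfb _ (T.edgePath_mem_frontier a (Ioo_subset_Icc_self ht)))
  have hfS : ∫ x in interior T.carrier, f x ^ 2 ≤ S := by
    have hi : ∀ i ∈ s, IntegrableOn (fun x => w i x ^ 2) (interior T.carrier) := fun i hi =>
      integrableOn_interior ((hw i hi).1.pow 2)
    rw [hS, ← integral_finsetSum _ hi]
    exact setIntegral_mono_on (integrableOn_interior (hfc.pow 2)) (integrable_finsetSum _ hi)
      isOpen_interior.measurableSet fun x hx => hfsq x (interior_subset hx)
  have hG := hen T hT z hz (Ce * b) S (by positivity) hS0 hb1 hb2 fun p hp => by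
    have h1 := hdof.2.2 p hp
    rw [T.setIntegral_carrier, T.setIntegral_carrier] at h1
    calc (∫ x in interior T.carrier, z x * polyFun p x) ^ 2
        = (∫ x in interior T.carrier, f x * polyFun p x) ^ 2 := congrArg (· ^ 2) h1
      _ ≤ _ := sq_integral_mul_polyFun_le hfc p
      _ ≤ _ := by
          refine mul_le_mul_of_nonneg_right hfS (integral_nonneg fun x => sq_nonneg _)
  have hL := hfr T hT z hz.1 (hz.2.1.of_le one_le_two) hz.2.2.1 (Ce * b) (by positivity) hb1
  have h1 : diam T.carrier ^ 2 * (Ce * b) ^ 2 = Ce ^ 2 * Ci * S := by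
    rw [mul_pow]; linear_combination Ce ^ 2 * hbsq
  rw [h1] at hG hL
  constructor
  · have h2 := hL.trans (mul_le_mul_of_nonneg_left (add_le_add_right hG _) hC₂)
    have h3 : 0 ≤ C₁ * (Ce ^ 2 * Ci + 1) * S := by positivity
    linarith
  · have h3 : 0 ≤ C₂ * (Ce ^ 2 * Ci + C₁ * (Ce ^ 2 * Ci + 1)) * S := by positivity
    linarith

/-- The interpolant of a convex combination `∑ χ_i w_i` with discrete `w_i` is stable in the
energy norm. -/
lemma exists_interpolant_energy_bound {k : ℕ} (hk : 1 ≤ k) {γ : ℝ} (hγ : 0 < γ) (m : ℕ) :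
    ∃ C : ℝ, 0 ≤ C ∧
    ∀ T : Element, T.IsShapeRegular γ → ∀ {ι : Type} (s : Finset ι) (χ w : ι → Plane → ℝ)
      (z : Plane → ℝ) (R : ℝ), s.card ≤ m → (∀ i ∈ s, χ i ∈ T.localSpace k) →
      (∀ i ∈ s, ∀ x ∈ interior T.carrier, ‖gradient (χ i) x‖ ≤ R) →
      (∀ i ∈ s, ∀ x ∈ T.carrier, 0 ≤ χ i x) → (∀ x ∈ T.carrier, ∑ i ∈ s, χ i x = 1) →
      (∀ i ∈ s, w i ∈ T.localSpace k) → z ∈ T.localSpace k →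
      T.SameDofs k (fun x => ∑ i ∈ s, χ i x * w i x) z →
      (∫ x in interior T.carrier, ‖gradient z x‖ ^ 2) ≤
          C * ((∑ i ∈ s, ∫ x in interior T.carrier, ‖gradient (w i) x‖ ^ 2) +
            R ^ 2 * ∑ i ∈ s, ∫ x in interior T.carrier, w i x ^ 2) := by
  obtain ⟨C₁, hC₁, hint⟩ := exists_interpolant_bound hk hγ
  refine ⟨2 * (C₁ * (8 * (1 / γ) ^ 2)) + 2 * m * (1 / γ ^ 2), by positivity,
    fun T hT ι s χ w z R hm hχ hR hχ0 hχ1 hw hz hdof => ?_⟩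
  obtain ⟨c, hc⟩ := hT.exists_isStarRegion hγ
  have hd := T.diam_pos
  -- Each `w i` gets its mean over the kernel ball. The second bound is needed for the gradient of
  -- `∑ a_i χ_i`.
  have hpoin : ∀ i, ∃ a : ℝ, i ∈ s → (∫ x in interior T.carrier, (w i x - a) ^ 2) ≤
      8 * (1 / γ) ^ 2 * diam T.carrier ^ 2 * (∫ x in interior T.carrier, ‖gradient (w i) x‖ ^ 2) ∧
      a ^ 2 * (Real.pi * (γ * diam T.carrier) ^ 2) ≤ ∫ x in interior T.carrier, w i x ^ 2 := by
    intro i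
    by_cases hi : i ∈ s
    · have hr : diam T.carrier / (γ * diam T.carrier) = 1 / γ := by field_simp
      obtain ⟨a, ha⟩ := hc.poincare (hw i hi).1 ((hw i hi).2.1.of_le one_le_two) (hw i hi).2.2.1
      rw [hr] at ha
      exact ⟨a, fun _ => ha⟩
    · exact ⟨0, fun h => absurd h hi⟩
  choose a ha using hpoin
  -- `y` lies in the local space, so `z - y` is the interpolant of `∑ χ_i (w_i - a_i)`. The factor
  -- `diam ^ (-2)` of the inverse estimate for `z - y` is compensated by the Poincaré inequality,
  -- and `∇y` is bounded through `R`. No gradient of a product is ever estimated.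
  set y : Plane → ℝ := ∑ i ∈ s, a i • χ i with hy
  have hymem : y ∈ T.localSpace k :=
    (T.localSubmodule k).sum_mem fun i hi => smul_mem_localSpace (a i) (hχ i hi)
  have hyx : ∀ x, y x = ∑ i ∈ s, a i * χ i x := fun x => by
    simp [hy, Finset.sum_apply]
  have hz' : z - y ∈ T.localSpace k := (T.localSubmodule k).sub_mem hz hymem
  have hw' : ∀ i ∈ s, (fun x => w i x - a i) ∈ T.localSpace k := fun i hi =>
    (T.localSubmodule k).sub_mem (hw i hi) (const_mem_localSpace k T (a i))
  have hsum : ∀ x, ∑ i ∈ s, χ i x * (w i x - a i) = (∑ i ∈ s, χ i x * w i x) - y x := by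
    intro x
    rw [hyx, ← Finset.sum_sub_distrib]
    exact Finset.sum_congr rfl fun i _ => by ring
  have hfc : ContinuousOn (fun x => ∑ i ∈ s, χ i x * w i x) T.carrier :=
    continuousOn_finsetSum _ fun i hi => (hχ i hi).1.mul (hw i hi).1
  have hdof' : T.SameDofs k (fun x => ∑ i ∈ s, χ i x * (w i x - a i)) (z - y) := by
    simp only [hsum]
    refine ⟨fun e => ?_, fun e t ht h0 => ?_, fun p hp => ?_⟩
    · rw [Pi.sub_apply, hdof.1 e]
    · rw [Pi.sub_apply, hdof.2.1 e t ht h0]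
    · have hpc : ContinuousOn (polyFun p) T.carrier := (continuous_polyFun p).continuousOn
      have key : ∀ g : Plane → ℝ, ContinuousOn g T.carrier →
          ∫ x in T.carrier, (g x - y x) * polyFun p x =
            (∫ x in T.carrier, g x * polyFun p x) - ∫ x in T.carrier, y x * polyFun p x := by
        intro g hg
        have h1 : IntegrableOn (fun x => g x * polyFun p x) T.carrier :=
          (hg.mul hpc).integrableOn_compact T.isCompact_carrier
        have h2 : IntegrableOn (fun x => y x * polyFun p x) T.carrier :=
          (hymem.1.mul hpc).integrableOn_compact T.isCompact_carrier
        rw [← integral_sub h1 h2]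
        congr 1; ext x; ring
      have h3 := hdof.2.2 p hp
      change ∫ x in T.carrier, (z x - y x) * polyFun p x =
        ∫ x in T.carrier, ((∑ i ∈ s, χ i x * w i x) - y x) * polyFun p x
      rw [key z hz.1, key _ hfc]
      exact congrArg (· - ∫ x in T.carrier, y x * polyFun p x) h3
  have hmain := (hint T hT s χ (fun i x => w i x - a i) (z - y) (fun i hi => (hχ i hi).1) hχ0 hχ1
    hw' hz' hdof').2
  set SG := ∑ i ∈ s, ∫ x in interior T.carrier, ‖gradient (w i) x‖ ^ 2 with hSG
  set SW := ∑ i ∈ s, ∫ x in interior T.carrier, w i x ^ 2 with hSW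
  have hSG0 : 0 ≤ SG := Finset.sum_nonneg fun i _ => integral_nonneg fun x => sq_nonneg _
  have hSW0 : 0 ≤ SW := Finset.sum_nonneg fun i _ => integral_nonneg fun x => sq_nonneg _
  have hE' : (∫ x in interior T.carrier, ‖gradient (z - y) x‖ ^ 2) ≤
      C₁ * (8 * (1 / γ) ^ 2) * SG := by
    refine le_of_mul_le_mul_left (hmain.trans ?_) (by positivity : 0 < diam T.carrier ^ 2)
    calc C₁ * ∑ i ∈ s, ∫ x in interior T.carrier, (w i x - a i) ^ 2
        ≤ C₁ * ∑ i ∈ s, 8 * (1 / γ) ^ 2 * diam T.carrier ^ 2 *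
            ∫ x in interior T.carrier, ‖gradient (w i) x‖ ^ 2 := by
          gcongr with i hi
          exact (ha i hi).1
      _ = _ := by rw [← Finset.mul_sum]; ring
  have hV : volume.real (interior T.carrier) ≤ Real.pi * diam T.carrier ^ 2 :=
    ENNReal.toReal_le_of_le_ofReal (by positivity) hc.volume_interior_le
  have haS : (∑ i ∈ s, a i ^ 2) * volume.real (interior T.carrier) ≤ 1 / γ ^ 2 * SW := by
    calc (∑ i ∈ s, a i ^ 2) * volume.real (interior T.carrier)
        ≤ (∑ i ∈ s, a i ^ 2) * (Real.pi * diam T.carrier ^ 2) := by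
          have : 0 ≤ ∑ i ∈ s, a i ^ 2 := Finset.sum_nonneg fun i _ => sq_nonneg _
          gcongr
      _ = 1 / γ ^ 2 * ∑ i ∈ s, a i ^ 2 * (Real.pi * (γ * diam T.carrier) ^ 2) := by
          rw [← Finset.sum_mul]; field_simp
      _ ≤ 1 / γ ^ 2 * SW := by
          gcongr
          exact Finset.sum_le_sum fun i hi => (ha i hi).2
  have hpt : ∀ x ∈ interior T.carrier, ‖gradient z x‖ ^ 2 ≤
      2 * ‖gradient (z - y) x‖ ^ 2 + 2 * (m * R ^ 2 * ∑ i ∈ s, a i ^ 2) := by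
    intro x hx
    have h1 : gradient z x = gradient (z - y) x + ∑ i ∈ s, a i • gradient (χ i) x := by
      have h2 : ∀ i ∈ s, DifferentiableAt ℝ (a i • χ i) x := fun i hi =>
        (differentiableAt_of_mem (hχ i hi) hx).const_smul _
      conv_lhs => rw [← sub_add_cancel z y]
      rw [gradient_add_apply (differentiableAt_of_mem hz' hx) (differentiableAt_of_mem hymem hx),
        hy, gradient_sum_apply s h2]
      exact congrArg _ (Finset.sum_congr rfl fun i hi =>
        gradient_const_smul_apply _ (differentiableAt_of_mem (hχ i hi) hx))
    rw [h1]
    refine (norm_add_sq_le_two _ _).trans ?_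
    gcongr
    calc ‖∑ i ∈ s, a i • gradient (χ i) x‖ ^ 2 ≤ (∑ i ∈ s, ‖a i • gradient (χ i) x‖) ^ 2 := by
          gcongr; exact norm_sum_le _ _
      _ ≤ s.card * ∑ i ∈ s, ‖a i • gradient (χ i) x‖ ^ 2 := sq_sum_le_card_mul_sum_sq
      _ ≤ m * ∑ i ∈ s, a i ^ 2 * R ^ 2 := by
          gcongr with i hi
          rw [norm_smul, mul_pow, Real.norm_eq_abs, sq_abs]
          have := hR i hi x hx
          gcongr
      _ = _ := by rw [← Finset.sum_mul]; ring
  have hconst : IntegrableOn (fun _ : Plane => 2 * (m * R ^ 2 * ∑ i ∈ s, a i ^ 2))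
      (interior T.carrier) := integrableOn_interior continuousOn_const
  have hfin := setIntegral_mono_on hz.2.2.1 ((hz'.2.2.1.const_mul 2).add hconst)
    isOpen_interior.measurableSet hpt
  have hsplit := integral_add (μ := volume.restrict (interior T.carrier))
    (hz'.2.2.1.const_mul 2) hconst
  simp only [Pi.add_apply] at hfin
  rw [hsplit, integral_const_mul, setIntegral_const, smul_eq_mul] at hfin
  have h4 : m * R ^ 2 * ((∑ i ∈ s, a i ^ 2) * volume.real (interior T.carrier)) ≤
      m * R ^ 2 * (1 / γ ^ 2 * SW) := by gcongr
  have h5 : 0 ≤ 2 * (C₁ * (8 * (1 / γ) ^ 2)) * (R ^ 2 * SW) := by positivity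
  have h6 : 0 ≤ 2 * m * (1 / γ ^ 2) * SG := by positivity
  linarith

end Element

/-! ### Degrees of freedom of sums -/

namespace Element

variable {T : Element} {k : ℕ}

lemma SameDofs.refl (f : Plane → ℝ) : T.SameDofs k f f :=
  ⟨fun _ => rfl, fun _ _ _ _ => rfl, fun _ _ => rfl⟩

lemma SameDofs.congr {f f' g : Plane → ℝ} (h : T.SameDofs k f g)
    (hf : ∀ x ∈ T.carrier, f' x = f x) : T.SameDofs k f' g := by
  refine ⟨fun a => ?_, fun a t ht h0 => ?_, fun p hp => ?_⟩
  · rw [h.1 a, hf _ (T.frontier_subset (T.vertex_mem_frontier a))]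
  · rw [h.2.1 a t ht h0,
      hf _ (T.frontier_subset (T.edgePath_mem_frontier a (Ioo_subset_Icc_self ht)))]
  · rw [h.2.2 p hp]
    refine setIntegral_congr_fun T.isCompact_carrier.isClosed.measurableSet fun x hx => ?_
    simp only [hf x hx]

lemma integrableOn_mul_polyFun {f : Plane → ℝ} (hf : ContinuousOn f T.carrier)
    (p : MvPolynomial (Fin 2) ℝ) :
    IntegrableOn (fun x => f x * MvPolynomial.eval (fun i => x i) p) T.carrier :=
  (hf.mul (continuous_polyFun p).continuousOn).integrableOn_compact T.isCompact_carrier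

lemma SameDofs.sub {f f' g g' : Plane → ℝ} (h : T.SameDofs k f g) (h' : T.SameDofs k f' g')
    (hf : ContinuousOn f T.carrier) (hf' : ContinuousOn f' T.carrier)
    (hg : ContinuousOn g T.carrier) (hg' : ContinuousOn g' T.carrier) :
    T.SameDofs k (f - f') (g - g') := by
  refine ⟨fun a => ?_, fun a t ht h0 => ?_, fun p hp => ?_⟩
  · simp only [Pi.sub_apply, h.1 a, h'.1 a]
  · simp only [Pi.sub_apply, h.2.1 a t ht h0, h'.2.1 a t ht h0]
  · simp only [Pi.sub_apply, sub_mul]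
    rw [integral_sub (integrableOn_mul_polyFun hg p) (integrableOn_mul_polyFun hg' p),
      integral_sub (integrableOn_mul_polyFun hf p) (integrableOn_mul_polyFun hf' p),
      h.2.2 p hp, h'.2.2 p hp]

lemma SameDofs.sum {ι : Type*} {s : Finset ι} {f g : ι → Plane → ℝ}
    (h : ∀ i ∈ s, T.SameDofs k (f i) (g i)) (hf : ∀ i ∈ s, ContinuousOn (f i) T.carrier)
    (hg : ∀ i ∈ s, ContinuousOn (g i) T.carrier) :
    T.SameDofs k (∑ i ∈ s, f i) (∑ i ∈ s, g i) := by
  refine ⟨fun a => ?_, fun a t ht h0 => ?_, fun p hp => ?_⟩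
  · simp only [Finset.sum_apply]
    exact Finset.sum_congr rfl fun i hi => (h i hi).1 a
  · simp only [Finset.sum_apply]
    exact Finset.sum_congr rfl fun i hi => (h i hi).2.1 a t ht h0
  · simp only [Finset.sum_apply, Finset.sum_mul]
    rw [integral_finsetSum _ fun i hi => integrableOn_mul_polyFun (hg i hi) p,
      integral_finsetSum _ fun i hi => integrableOn_mul_polyFun (hf i hi) p]
    exact Finset.sum_congr rfl fun i hi => (h i hi).2.2 p hp

lemma integrableOn_mul_of_mem {u w : Plane → ℝ} (hu : u ∈ T.localSpace k)
    (hw : w ∈ T.localSpace k) : IntegrableOn (fun x => u x * w x) (interior T.carrier) :=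
  integrableOn_interior (hu.1.mul hw.1)

lemma integrableOn_inner_of_mem {u w : Plane → ℝ} (hu : u ∈ T.localSpace k)
    (hw : w ∈ T.localSpace k) :
    IntegrableOn (fun x => inner ℝ (gradient u x) (gradient w x)) (interior T.carrier) := by
  refine Integrable.mono' (g := fun x => ‖gradient u x‖ ^ 2 + ‖gradient w x‖ ^ 2)
    (Integrable.add (μ := volume.restrict (interior T.carrier)) hu.2.2.1 hw.2.2.1)
    ((measurable_gradient _).inner (measurable_gradient _)).aestronglyMeasurable ?_
  refine ae_of_all _ fun x => (norm_inner_le_norm _ _).trans ?_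
  nlinarith [sq_nonneg (‖gradient u x‖ - ‖gradient w x‖), sq_nonneg ‖gradient u x‖,
    sq_nonneg ‖gradient w x‖]

end Element

/-! ### Integrals over unions of elements -/

namespace FineMesh

variable {M : FineMesh}

lemma carrier_subset_region {S : Set (Fin M.num)} {j : Fin M.num} (hj : j ∈ S) :
    (M.elem j).carrier ⊆ M.region S := subset_biUnion_of_mem (u := fun j => (M.elem j).carrier) hj

lemma region_mono {S S' : Set (Fin M.num)} (h : S ⊆ S') : M.region S ⊆ M.region S' :=
  biUnion_subset_biUnion_left h

lemma isClosed_region (S : Set (Fin M.num)) : IsClosed (M.region S) :=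
  S.toFinite.isClosed_biUnion fun j _ => (M.elem j).isCompact_carrier.isClosed

/-- An element is the closure of its interior, and an open set disjoint from a set is disjoint from
its closure. -/
lemma disjoint_interior_carrier {i j : Fin M.num} (h : i ≠ j) :
    Disjoint (interior (M.elem i).carrier) (M.elem j).carrier := by
  rw [← (M.elem j).closure_interior]
  exact (M.nonoverlapping i j h).closure_right isOpen_interior

/-- Boundaries of elements are null sets. Integrals over regions thus become sums over disjoint open
sets, on each of which `κ` is constant. -/
lemma region_ae_eq (S : Set (Fin M.num)) :
    M.region S =ᵐ[volume] ⋃ j ∈ S.toFinite.toFinset, interior (M.elem j).carrier := by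
  have h : M.region S = ⋃ j ∈ S.toFinite.toFinset, (M.elem j).carrier := by
    simp [region]
  rw [h]
  exact Filter.EventuallyEq.countable_bUnion (S.toFinite.toFinset.countable_toSet)
    fun j _ => (M.elem j).interior_ae_eq.symm

lemma ae_region {S : Set (Fin M.num)} {P : Plane → Prop}
    (h : ∀ j ∈ S, ∀ x ∈ interior (M.elem j).carrier, P x) :
    ∀ᵐ x ∂volume.restrict (M.region S), P x := by
  rw [Measure.restrict_congr_set (region_ae_eq S), ae_restrict_iff' (Finset.measurableSet_biUnion _
    fun j _ => isOpen_interior.measurableSet)]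
  refine ae_of_all _ fun x hx => ?_
  obtain ⟨j, hj, hxj⟩ := mem_iUnion₂.1 hx
  exact h j (S.toFinite.mem_toFinset.1 hj) x hxj

lemma integrableOn_region {S : Set (Fin M.num)} {f : Plane → ℝ}
    (hf : ∀ j ∈ S, IntegrableOn f (interior (M.elem j).carrier)) :
    IntegrableOn f (M.region S) := by
  rw [integrableOn_congr_set_ae (region_ae_eq S), integrableOn_finset_iUnion]
  exact fun j hj => hf j (S.toFinite.mem_toFinset.1 hj)

lemma setIntegral_region {S : Set (Fin M.num)} {f : Plane → ℝ}
    (hf : ∀ j ∈ S, IntegrableOn f (interior (M.elem j).carrier)) :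
    ∫ x in M.region S, f x = ∑ j ∈ S.toFinite.toFinset, ∫ x in interior (M.elem j).carrier, f x := by
  rw [setIntegral_congr_set (region_ae_eq S)]
  exact integral_biUnion_finset _ (fun j _ => isOpen_interior.measurableSet)
    (fun i _ j _ hij => M.nonoverlapping i j hij)
    fun j hj => hf j (S.toFinite.mem_toFinset.1 hj)

lemma integrableOn_coefficient_mul {κ : Plane → ℝ} (hκ : M.IsCoefficient κ) {S : Set (Fin M.num)} {f : Plane → ℝ}
    (hf : ∀ j ∈ S, IntegrableOn f (interior (M.elem j).carrier)) :
    IntegrableOn (fun x => κ x * f x) (M.region S) := by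
  refine integrableOn_region fun j hj => ?_
  obtain ⟨c, -, hc⟩ := hκ j
  refine IntegrableOn.congr_fun ((hf j hj).const_mul c) (fun x hx => ?_)
    isOpen_interior.measurableSet
  rw [hc x hx]

lemma setIntegral_coefficient_mul {κ : Plane → ℝ} {c : Fin M.num → ℝ}
    (hc : ∀ j, ∀ x ∈ interior (M.elem j).carrier, κ x = c j) {S : Set (Fin M.num)} {f : Plane → ℝ}
    (hf : ∀ j ∈ S, IntegrableOn f (interior (M.elem j).carrier)) :
    ∫ x in M.region S, κ x * f x =
      ∑ j ∈ S.toFinite.toFinset, c j * ∫ x in interior (M.elem j).carrier, f x := by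
  have h1 : ∀ j, EqOn (fun x => c j * f x) (fun x => κ x * f x) (interior (M.elem j).carrier) :=
    fun j x hx => by simp only [hc j x hx]
  rw [setIntegral_region fun j hj => IntegrableOn.congr_fun ((hf j hj).const_mul (c j)) (h1 j)
    isOpen_interior.measurableSet]
  refine Finset.sum_congr rfl fun j _ => ?_
  rw [← integral_const_mul]
  exact (setIntegral_congr_fun isOpen_interior.measurableSet (h1 j)).symm

lemma setIntegral_region_mono {κ : Plane → ℝ} (hκ : M.IsCoefficient κ) {S S' : Set (Fin M.num)}
    (hS : S ⊆ S') {f : Plane → ℝ} (hf0 : ∀ x, 0 ≤ f x)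
    (hf : ∀ j ∈ S', IntegrableOn f (interior (M.elem j).carrier)) :
    ∫ x in M.region S, κ x * f x ≤ ∫ x in M.region S', κ x * f x := by
  refine setIntegral_mono_set (integrableOn_coefficient_mul hκ hf) (ae_region fun j _ x hx => ?_)
    (region_mono hS).eventuallyLE
  obtain ⟨c, hc0, hc⟩ := hκ j
  rw [Pi.zero_apply]
  simp only [hc x hx]
  exact mul_nonneg hc0.le (hf0 x)

/-- The functions that belong to the local space on every element of `S`. -/
def brokenSpace (M : FineMesh) (k : ℕ) (S : Set (Fin M.num)) : Submodule ℝ (Plane → ℝ) where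
  carrier := {v | ∀ j ∈ S, v ∈ (M.elem j).localSpace k}
  add_mem' := fun hv hw j hj => Element.add_mem_localSpace (hv j hj) (hw j hj)
  zero_mem' := fun j _ => Element.const_mem_localSpace k (M.elem j) 0
  smul_mem' := fun r _ hv j hj => Element.smul_mem_localSpace r (hv j hj)

/-! ### The mass and energy forms as bilinear forms -/

variable {k : ℕ} {κ : Plane → ℝ} {S : Set (Fin M.num)}

lemma massForm_comm (R : Set Plane) (u w : Plane → ℝ) : massForm κ R u w = massForm κ R w u := by
  simp only [massForm, mul_comm]

lemma energyForm_comm (R : Set Plane) (u w : Plane → ℝ) :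
    energyForm κ R u w = energyForm κ R w u := by
  simp only [energyForm, real_inner_comm]

lemma integrableOn_massForm (hκ : M.IsCoefficient κ) {u w : Plane → ℝ} (hu : u ∈ M.brokenSpace k S)
    (hw : w ∈ M.brokenSpace k S) : IntegrableOn (fun x => κ x * (u x * w x)) (M.region S) :=
  integrableOn_coefficient_mul hκ fun j hj => Element.integrableOn_mul_of_mem (hu j hj) (hw j hj)

lemma integrableOn_energyForm (hκ : M.IsCoefficient κ) {u w : Plane → ℝ}
    (hu : u ∈ M.brokenSpace k S) (hw : w ∈ M.brokenSpace k S) :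
    IntegrableOn (fun x => κ x * inner ℝ (gradient u x) (gradient w x)) (M.region S) :=
  integrableOn_coefficient_mul hκ fun j hj => Element.integrableOn_inner_of_mem (hu j hj) (hw j hj)

lemma massForm_add_left (hκ : M.IsCoefficient κ) {u u' w : Plane → ℝ} (hu : u ∈ M.brokenSpace k S)
    (hu' : u' ∈ M.brokenSpace k S) (hw : w ∈ M.brokenSpace k S) :
    massForm κ (M.region S) (u + u') w =
      massForm κ (M.region S) u w + massForm κ (M.region S) u' w := by
  rw [massForm, massForm, massForm, ← integral_add (integrableOn_massForm hκ hu hw)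
    (integrableOn_massForm hκ hu' hw)]
  congr 1; ext x
  rw [Pi.add_apply]; ring

lemma massForm_smul_left (r : ℝ) (R : Set Plane) (u w : Plane → ℝ) :
    massForm κ R (r • u) w = r * massForm κ R u w := by
  rw [massForm, massForm, ← integral_const_mul]
  congr 1; ext x
  rw [Pi.smul_apply, smul_eq_mul]; ring

lemma energyForm_add_left (hκ : M.IsCoefficient κ) {u u' w : Plane → ℝ}
    (hu : u ∈ M.brokenSpace k S) (hu' : u' ∈ M.brokenSpace k S) (hw : w ∈ M.brokenSpace k S) :
    energyForm κ (M.region S) (u + u') w =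
      energyForm κ (M.region S) u w + energyForm κ (M.region S) u' w := by
  rw [energyForm, energyForm, energyForm, ← integral_add (integrableOn_energyForm hκ hu hw)
    (integrableOn_energyForm hκ hu' hw)]
  refine integral_congr_ae (ae_region fun j hj x hx => ?_)
  simp only
  rw [gradient_add_apply (Element.differentiableAt_of_mem (hu j hj) hx)
    (Element.differentiableAt_of_mem (hu' j hj) hx), inner_add_left]
  ring

lemma energyForm_smul_left (r : ℝ) {u : Plane → ℝ} (w : Plane → ℝ)
    (hu : u ∈ M.brokenSpace k S) :
    energyForm κ (M.region S) (r • u) w = r * energyForm κ (M.region S) u w := by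
  rw [energyForm, energyForm, ← integral_const_mul]
  refine integral_congr_ae (ae_region fun j hj x hx => ?_)
  simp only
  rw [gradient_const_smul_apply r (Element.differentiableAt_of_mem (hu j hj) hx),
    real_inner_smul_left]
  ring

/-- The mass form as a bilinear form on the broken space. -/
noncomputable def massBilin (hκ : M.IsCoefficient κ) (k : ℕ) (S : Set (Fin M.num)) :
    M.brokenSpace k S →ₗ[ℝ] M.brokenSpace k S →ₗ[ℝ] ℝ :=
  LinearMap.mk₂ ℝ (fun u w => massForm κ (M.region S) u w)
    (fun u u' w => massForm_add_left hκ u.2 u'.2 w.2)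
    (fun r u w => massForm_smul_left r _ _ _)
    (fun u w w' => by
      rw [massForm_comm, massForm_comm _ _ (w : Plane → ℝ), massForm_comm _ _ (w' : Plane → ℝ)]
      exact massForm_add_left hκ w.2 w'.2 u.2)
    (fun r u w => by
      rw [massForm_comm, massForm_comm _ _ (w : Plane → ℝ)]
      exact massForm_smul_left r _ _ _)

/-- The energy form as a bilinear form on the broken space. -/
noncomputable def energyBilin (hκ : M.IsCoefficient κ) (k : ℕ) (S : Set (Fin M.num)) :
    M.brokenSpace k S →ₗ[ℝ] M.brokenSpace k S →ₗ[ℝ] ℝ :=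
  LinearMap.mk₂ ℝ (fun u w => energyForm κ (M.region S) u w)
    (fun u u' w => energyForm_add_left hκ u.2 u'.2 w.2)
    (fun r u w => energyForm_smul_left r _ u.2)
    (fun u w w' => by
      rw [energyForm_comm, energyForm_comm _ _ (w : Plane → ℝ),
        energyForm_comm _ _ (w' : Plane → ℝ)]
      exact energyForm_add_left hκ w.2 w'.2 u.2)
    (fun r u w => by
      rw [energyForm_comm, energyForm_comm _ _ (w : Plane → ℝ)]
      exact energyForm_smul_left r _ w.2)

lemma energyForm_self_nonneg (hκ : M.IsCoefficient κ) (S : Set (Fin M.num)) (u : Plane → ℝ) :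
    0 ≤ energyForm κ (M.region S) u u := by
  refine integral_nonneg_of_ae (ae_region fun j _ x hx => ?_)
  obtain ⟨c, hc0, hc⟩ := hκ j
  rw [Pi.zero_apply]
  simp only [hc x hx]
  exact mul_nonneg hc0.le real_inner_self_nonneg

end FineMesh

/-! ### Truncated eigenfunction expansions -/

lemma bilin_sum_of_orthogonal {V ι : Type*} [AddCommGroup V] [Module ℝ V] [DecidableEq ι]
    (b : V →ₗ[ℝ] V →ₗ[ℝ] ℝ) {ψ : ι → V} {μ : ι → ℝ}
    (h : ∀ l m, b (ψ l) (ψ m) = if l = m then μ l else 0) (c : ι → ℝ) (s : Finset ι) :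
    b (∑ l ∈ s, c l • ψ l) (∑ l ∈ s, c l • ψ l) = ∑ l ∈ s, μ l * c l ^ 2 := by
  simp only [map_sum, LinearMap.sum_apply, map_smul, LinearMap.smul_apply, h, smul_eq_mul]
  refine Finset.sum_congr rfl fun l hl => ?_
  simp only [mul_ite, mul_zero, Finset.sum_ite_eq', if_pos hl]
  ring

/-- Both forms are diagonal in `ψ`, and the remainder contains only the modes with index at least
`L`. Counting from zero, `μ ⟨L, hL⟩` is the smallest of their eigenvalues; dropping modes does not
increase the energy. -/
lemma truncation_bounds {V : Type*} [AddCommGroup V] [Module ℝ V] (a b : V →ₗ[ℝ] V →ₗ[ℝ] ℝ)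
    {n : ℕ} {ψ : Fin n → V} {μ : Fin n → ℝ} (hμ : Monotone μ) (hμ0 : ∀ l, 0 ≤ μ l)
    (hb : ∀ l m, b (ψ l) (ψ m) = if l = m then 1 else 0)
    (ha : ∀ l m, a (ψ l) (ψ m) = if l = m then μ l else 0) (c : Fin n → ℝ) {L : ℕ} (hL : L < n)
    {v w : V} (hv : v = ∑ l, c l • ψ l)
    (hw : w = v - ∑ l : Fin n with l.val < L, c l • ψ l) :
    μ ⟨L, hL⟩ * b w w ≤ a w w ∧ a w w ≤ a v v := by
  have hw' : w = ∑ l : Fin n with ¬ l.val < L, c l • ψ l := by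
    rw [hw, hv, ← Finset.sum_filter_add_sum_filter_not Finset.univ (fun l : Fin n => l.val < L),
      add_sub_cancel_left]
  rw [hw', hv, bilin_sum_of_orthogonal a ha, bilin_sum_of_orthogonal a ha,
    bilin_sum_of_orthogonal b (μ := fun _ => 1) hb]
  constructor
  · rw [Finset.mul_sum]
    refine Finset.sum_le_sum fun l hl => ?_
    have h1 : μ ⟨L, hL⟩ ≤ μ l := hμ (not_lt.1 (Finset.mem_filter.1 hl).2)
    rw [one_mul]
    exact mul_le_mul_of_nonneg_right h1 (sq_nonneg _)
  · exact Finset.sum_le_sum_of_subset_of_nonneg (Finset.filter_subset _ _)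
      fun l _ _ => mul_nonneg (hμ0 l) (sq_nonneg _)

namespace Eigenbasis

variable {M : FineMesh} {κ : Plane → ℝ} {k : ℕ} {S : Set (Fin M.num)}
  (B : Eigenbasis κ (M.region S) (M.space₀ k S))

lemma psi_mem_brokenSpace (l : Fin B.n) : B.psi l ∈ M.brokenSpace k S := (B.mem l).1.2.2

lemma trunc_mem_brokenSpace (L : ℕ) (v : Plane → ℝ) : B.trunc L v ∈ M.brokenSpace k S :=
  (M.brokenSpace k S).sum_mem fun l _ =>
    (M.brokenSpace k S).smul_mem _ (B.psi_mem_brokenSpace l)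

lemma lam_nonneg (hκ : M.IsCoefficient κ) (l : Fin B.n) : 0 ≤ B.lam l := by
  have h := B.eigen l _ (B.mem l)
  rw [B.orthonormal, if_pos rfl, mul_one] at h
  rw [← h]
  exact FineMesh.energyForm_self_nonneg hκ S _

/-- Completeness expands `v` in the eigenfunctions, mass orthonormality identifies the coefficients
with those used in `trunc`, and the eigenvalue equation makes the energy form diagonal. -/
lemma error_bounds (hκ : M.IsCoefficient κ) {v : Plane → ℝ} (hv : v ∈ M.space₀ k S) {L : ℕ}
    (hL : L < B.n) :
    B.lam ⟨L, hL⟩ * massForm κ (M.region S) (v - B.trunc L v) (v - B.trunc L v) ≤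
        energyForm κ (M.region S) (v - B.trunc L v) (v - B.trunc L v) ∧
      energyForm κ (M.region S) (v - B.trunc L v) (v - B.trunc L v) ≤
        energyForm κ (M.region S) v v := by
  have hvb : v ∈ M.brokenSpace k S := hv.1.2.2
  obtain ⟨c, hc⟩ := (Submodule.mem_span_range_iff_exists_fun ℝ).1 (B.complete v hv)
  set ψ : Fin B.n → M.brokenSpace k S := fun l => ⟨B.psi l, B.psi_mem_brokenSpace l⟩ with hψ
  have hv' : (⟨v, hvb⟩ : M.brokenSpace k S) = ∑ l, c l • ψ l := by
    apply Subtype.ext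
    exact hc.symm.trans (map_sum (M.brokenSpace k S).subtype (fun l => c l • ψ l) _).symm
  have hb : ∀ l m, FineMesh.massBilin hκ k S (ψ l) (ψ m) = if l = m then 1 else 0 :=
    fun l m => B.orthonormal l m
  have ha : ∀ l m, FineMesh.energyBilin hκ k S (ψ l) (ψ m) = if l = m then B.lam l else 0 := by
    intro l m
    refine (B.eigen l _ (B.mem m)).trans ?_
    rw [B.orthonormal, mul_ite, mul_one, mul_zero]
  have hcoef : ∀ l, massForm κ (M.region S) v (B.psi l) = c l := by
    intro l
    change FineMesh.massBilin hκ k S ⟨v, hvb⟩ (ψ l) = c l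
    rw [hv', map_sum, LinearMap.sum_apply]
    simp only [map_smul, LinearMap.smul_apply, hb, smul_eq_mul, mul_ite, mul_one, mul_zero]
    simp
  have hw : (⟨v - B.trunc L v, (M.brokenSpace k S).sub_mem hvb (B.trunc_mem_brokenSpace L v)⟩ :
      M.brokenSpace k S) = ⟨v, hvb⟩ - ∑ l : Fin B.n with l.val < L, c l • ψ l := by
    apply Subtype.ext
    have ht : B.trunc L v = ∑ l : Fin B.n with l.val < L, c l • B.psi l :=
      Finset.sum_congr rfl fun l _ => by rw [hcoef]
    rw [Submodule.coe_sub]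
    simp only [ht]
    exact congrArg (v - ·) (map_sum (M.brokenSpace k S).subtype (fun l => c l • ψ l) _).symm
  exact truncation_bounds (FineMesh.energyBilin hκ k S) (FineMesh.massBilin hκ k S) B.ordered
    (B.lam_nonneg hκ) hb ha c hL hv' hw

end Eigenbasis

/-! ### The coarse interpolation on the fine elements -/

namespace FineMesh

variable {M : FineMesh} {k : ℕ}

/-- Members of the space on a region are zero outside it, so the restriction of `v` has to be
written as an indicator. The zero condition is imposed on `∂D` only, where `v` vanishes already. -/
lemma indicator_mem_space₀ {v : Plane → ℝ} (hv : v ∈ M.space₀ k univ) (S : Set (Fin M.num)) :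
    (M.region S).indicator v ∈ M.space₀ k S := by
  have hsub : M.region S ⊆ M.region univ := region_mono (subset_univ S)
  have heq : ∀ x ∈ M.region S, (M.region S).indicator v x = v x := fun x hx =>
    indicator_of_mem hx v
  refine ⟨⟨(hv.1.1.mono hsub).congr heq, fun x hx => indicator_of_notMem hx v, fun j hj => ?_⟩,
    fun x hx => ?_⟩
  · exact Element.localSpace_congr (hv.1.2.2 j (mem_univ j)) fun x hx =>
      heq x (carrier_subset_region hj hx)
  · rw [heq x hx.1]
    exact hv.2 x ⟨hsub hx.1, hx.2⟩

lemma massForm_indicator {κ : Plane → ℝ} {S : Set (Fin M.num)} (v w : Plane → ℝ) :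
    massForm κ (M.region S) ((M.region S).indicator v) w = massForm κ (M.region S) v w := by
  refine setIntegral_congr_fun (isClosed_region S).measurableSet fun x hx => ?_
  simp only [indicator_of_mem hx]

lemma trunc_indicator {κ : Plane → ℝ} {S : Set (Fin M.num)} {W : Set (Plane → ℝ)}
    (B : Eigenbasis κ (M.region S) W) (L : ℕ) (v : Plane → ℝ) :
    B.trunc L ((M.region S).indicator v) = B.trunc L v := by
  simp only [Eigenbasis.trunc, massForm_indicator]

lemma energyForm_indicator {κ : Plane → ℝ} {S : Set (Fin M.num)} (v : Plane → ℝ) :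
    energyForm κ (M.region S) ((M.region S).indicator v) ((M.region S).indicator v) =
      ∫ x in M.region S, κ x * ‖gradient v x‖ ^ 2 := by
  refine integral_congr_ae (ae_region fun j hj x hx => ?_)
  have h : (M.region S).indicator v =ᶠ[𝓝 x] v := by
    filter_upwards [isOpen_interior.mem_nhds hx] with y hy
    exact indicator_of_mem (carrier_subset_region hj (interior_subset hy)) v
  simp only
  rw [h.gradient_eq, real_inner_self_eq_norm_sq]

lemma indicator_error_bounds {κ : Plane → ℝ} (hκ : M.IsCoefficient κ) {S : Set (Fin M.num)}
    (B : Eigenbasis κ (M.region S) (M.space₀ k S)) {v : Plane → ℝ} (hv : v ∈ M.space₀ k univ)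
    {L : ℕ} (hL : L < B.n) {w : Plane → ℝ} (hw : w = (M.region S).indicator v - B.trunc L v) :
    B.lam ⟨L, hL⟩ * massForm κ (M.region S) w w ≤ energyForm κ (M.region S) w w ∧
      energyForm κ (M.region S) w w ≤ ∫ x in M.region S, κ x * ‖gradient v x‖ ^ 2 := by
  have h := B.error_bounds hκ (indicator_mem_space₀ hv S) hL
  rwa [trunc_indicator, energyForm_indicator, ← hw] at h

end FineMesh

namespace CoarseMesh

variable {M : FineMesh} {T : CoarseMesh M} {k : ℕ} {κ : Plane → ℝ}

lemma mem_nbhdElems {K : Fin T.num} {i : Fin T.numVert} (hi : T.y i ∈ T.region K)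
    {j : Fin M.num} (hj : j ∈ T.elems K) : j ∈ T.nbhdElems i := by
  change T.y i ∈ T.region (T.block j)
  rwa [show T.block j = K from hj]

lemma elemNbhd_eq (K : Fin T.num) :
    T.elemNbhd K = M.region (⋃ i ∈ {i | T.y i ∈ T.region K}, T.nbhdElems i) := by
  simp only [elemNbhd, nbhd, FineMesh.region, biUnion_iUnion]

/-- A coarse basis function vanishes on the coarse elements which do not contain its vertex. -/
lemma IsPartitionOfUnity.eq_zero {Cχ H : ℝ} {χ : Fin T.numVert → Plane → ℝ}
    (hχ : T.IsPartitionOfUnity k Cχ H χ) {K : Fin T.num} {i : Fin T.numVert}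
    (hi : T.y i ∉ T.region K) {j : Fin M.num} (hj : j ∈ T.elems K) :
    ∀ x ∈ (M.elem j).carrier, χ i x = 0 := by
  have h1 : EqOn (χ i) (fun _ => 0) (interior (M.elem j).carrier) := by
    intro x hx
    refine hχ.support i x fun hxn => ?_
    obtain ⟨j', hj', hxj'⟩ := mem_iUnion₂.1 hxn
    have hne : j ≠ j' := by
      rintro rfl
      have h2 : T.y i ∈ T.region (T.block j) := hj'
      rw [show T.block j = K from hj] at h2
      exact hi h2
    exact disjoint_left.1 (FineMesh.disjoint_interior_carrier hne) hx hxj'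
  have h2 := h1.of_subset_closure ((hχ.mem i).2.2 j (mem_univ j)).1 continuousOn_const
    interior_subset (M.elem j).closure_interior.ge
  exact fun x hx => h2 hx

variable {χ : Fin T.numVert → Plane → ℝ} {B : T.LocalEigenbases k κ} {L : Fin T.numVert → ℕ}
  {v u : Plane → ℝ}

/-- The error of the local truncated expansion. -/
noncomputable def localError (B : T.LocalEigenbases k κ) (L : Fin T.numVert → ℕ) (v : Plane → ℝ)
    (i : Fin T.numVert) : Plane → ℝ :=
  (T.nbhd i).indicator v - (B i).trunc (L i) v

lemma localError_mem (hv : v ∈ M.space₀ k univ) (i : Fin T.numVert) :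
    localError B L v i ∈ M.brokenSpace k (T.nbhdElems i) :=
  (M.brokenSpace k (T.nbhdElems i)).sub_mem
    (FineMesh.indicator_mem_space₀ hv (T.nbhdElems i)).1.2.2 ((B i).trunc_mem_brokenSpace _ _)

/-- The spectral input: the first bound chains the eigenvalue inequality for the remainder with the
decrease of the energy under truncation. -/
lemma localError_bounds (hκ : M.IsCoefficient κ) (hv : v ∈ M.space₀ k univ) (i : Fin T.numVert)
    (hL : L i < (B i).n) :
    (B i).lam ⟨L i, hL⟩ * (∫ x in T.nbhd i, κ x * localError B L v i x ^ 2) ≤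
        (∫ x in T.nbhd i, κ x * ‖gradient v x‖ ^ 2) ∧
      (∫ x in T.nbhd i, κ x * ‖gradient (localError B L v i) x‖ ^ 2) ≤
        ∫ x in T.nbhd i, κ x * ‖gradient v x‖ ^ 2 := by
  have h := FineMesh.indicator_error_bounds hκ (B i) hv hL
    (w := localError B L v i) rfl
  have hm : ∫ x in T.nbhd i, κ x * localError B L v i x ^ 2 =
      massForm κ (T.nbhd i) (localError B L v i) (localError B L v i) := by
    simp only [massForm, sq]
  have he : ∫ x in T.nbhd i, κ x * ‖gradient (localError B L v i) x‖ ^ 2 =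
      energyForm κ (T.nbhd i) (localError B L v i) (localError B L v i) := by
    simp only [energyForm, real_inner_self_eq_norm_sq]
  rw [hm, he]
  exact ⟨h.1.trans h.2, h.2⟩

lemma IsCoarseInterpolant.mem (hu : T.IsCoarseInterpolant χ B L v u) (j : Fin M.num) :
    u ∈ (M.elem j).localSpace k := by
  obtain ⟨w, hw, rfl⟩ := hu
  exact ((M.elem j).localSubmodule k).sum_mem fun i _ => (hw i).1.2.2 j (mem_univ j)

/-- On a fine element of `K` only the `χ i` with vertex in `K` survive and they sum to one. Hence `v
= ∑ χ_i v` there; as `v` is discrete it is its own interpolant, and linearity of the degrees of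
freedom gives the error representation. -/
lemma IsCoarseInterpolant.sameDofs {Cχ H : ℝ} (hχ : T.IsPartitionOfUnity k Cχ H χ)
    (hv : v ∈ M.space₀ k univ) (hu : T.IsCoarseInterpolant χ B L v u) {K : Fin T.num}
    {s : Finset (Fin T.numVert)} (hs : ∀ i, i ∈ s ↔ T.y i ∈ T.region K) {j : Fin M.num}
    (hj : j ∈ T.elems K) :
    (M.elem j).SameDofs k (fun x => ∑ i ∈ s, χ i x * localError B L v i x) (v - u) := by
  obtain ⟨w, hw, rfl⟩ := hu
  have hvj : v ∈ (M.elem j).localSpace k := hv.1.2.2 j (mem_univ j)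
  have hwc : ∀ i ∈ Finset.univ, ContinuousOn (w i) (M.elem j).carrier := fun i _ =>
    ((hw i).1.2.2 j (mem_univ j)).1
  have hz : ∀ i, i ∉ s → ∀ x ∈ (M.elem j).carrier, χ i x = 0 := fun i hi =>
    hχ.eq_zero (fun h => hi ((hs i).2 h)) hj
  have hjn : ∀ i ∈ s, j ∈ T.nbhdElems i := fun i hi => mem_nbhdElems ((hs i).1 hi) hj
  have hfc : ∀ i ∈ Finset.univ,
      ContinuousOn (χ i * (B i).trunc (L i) v) (M.elem j).carrier := by
    intro i _
    by_cases hi : i ∈ s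
    · exact ((hχ.mem i).2.2 j (mem_univ j)).1.mul
        (((B i).trunc_mem_brokenSpace (L i) v) j (hjn i hi)).1
    · refine continuousOn_const (c := (0 : ℝ)).congr fun x hx => ?_
      rw [Pi.mul_apply, hz i hi x hx, zero_mul]
  have hsum := Element.SameDofs.sum (fun i _ => (hw i).2 j) hfc hwc
  refine ((Element.SameDofs.refl v).sub hsum hvj.1 (by simpa only [Finset.sum_fn] using continuousOn_finsetSum _ hfc) hvj.1
    (by simpa only [Finset.sum_fn] using continuousOn_finsetSum _ hwc)).congr fun x hx => ?_
  have h1 : ∑ i, χ i x = ∑ i ∈ s, χ i x :=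
    (Finset.sum_subset (Finset.subset_univ s) fun i _ hi => hz i hi x hx).symm
  have h2 : ∑ i, χ i x * (B i).trunc (L i) v x = ∑ i ∈ s, χ i x * (B i).trunc (L i) v x :=
    (Finset.sum_subset (Finset.subset_univ s) fun i _ hi => by
      rw [hz i hi x hx, zero_mul]).symm
  have hxD : x ∈ M.closedDomain := FineMesh.carrier_subset_region (mem_univ j) hx
  rw [Pi.sub_apply, Finset.sum_apply]
  simp only [Pi.mul_apply]
  rw [h2]
  have h3 : v x = ∑ i ∈ s, χ i x * v x := by
    rw [← Finset.sum_mul, ← h1, hχ.sum_eq_one x hxD, one_mul]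
  conv_rhs => rw [h3]
  rw [← Finset.sum_sub_distrib]
  refine Finset.sum_congr rfl fun i hi => ?_
  have hxi : x ∈ T.nbhd i := FineMesh.carrier_subset_region (hjn i hi) hx
  rw [localError, Pi.sub_apply, indicator_of_mem hxi]
  ring

/-- This passage from single elements to `K` is what makes the final constant independent of the
contrast: an elementwise inequality is multiplied by the constant value of `κ` on that element
before summation. -/
lemma setIntegral_region_le_sum_nbhd (hκ : M.IsCoefficient κ) {K : Fin T.num}
    {s : Finset (Fin T.numVert)} (hs : ∀ i ∈ s, T.y i ∈ T.region K) {g : Plane → ℝ}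
    {f : Fin T.numVert → Plane → ℝ} {A : ℝ} (hA : 0 ≤ A)
    (hg : ∀ j ∈ T.elems K, IntegrableOn g (interior (M.elem j).carrier))
    (hf : ∀ i ∈ s, ∀ j ∈ T.nbhdElems i, IntegrableOn (f i) (interior (M.elem j).carrier))
    (hf0 : ∀ i x, 0 ≤ f i x)
    (h : ∀ j ∈ T.elems K, (∫ x in interior (M.elem j).carrier, g x) ≤
      A * ∑ i ∈ s, ∫ x in interior (M.elem j).carrier, f i x) :
    (∫ x in T.region K, κ x * g x) ≤ A * ∑ i ∈ s, ∫ x in T.nbhd i, κ x * f i x := by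
  choose c hc0 hc using hκ
  have hsub : ∀ i ∈ s, T.elems K ⊆ T.nbhdElems i := fun i hi j hj => mem_nbhdElems (hs i hi) hj
  calc (∫ x in T.region K, κ x * g x)
      = ∑ j ∈ (T.elems K).toFinite.toFinset, c j * ∫ x in interior (M.elem j).carrier, g x :=
        FineMesh.setIntegral_coefficient_mul hc hg
    _ ≤ ∑ j ∈ (T.elems K).toFinite.toFinset,
          c j * (A * ∑ i ∈ s, ∫ x in interior (M.elem j).carrier, f i x) := by
        refine Finset.sum_le_sum fun j hj => mul_le_mul_of_nonneg_left ?_ (hc0 j).le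
        exact h j ((T.elems K).toFinite.mem_toFinset.1 hj)
    _ = A * ∑ i ∈ s, ∑ j ∈ (T.elems K).toFinite.toFinset,
          c j * ∫ x in interior (M.elem j).carrier, f i x := by
        rw [Finset.sum_comm, Finset.mul_sum]
        refine Finset.sum_congr rfl fun j _ => ?_
        rw [← Finset.mul_sum]
        ring
    _ ≤ A * ∑ i ∈ s, ∫ x in T.nbhd i, κ x * f i x := by
        gcongr with i hi
        rw [← FineMesh.setIntegral_coefficient_mul hc fun j hj => hf i hi j (hsub i hi hj)]
        exact FineMesh.setIntegral_region_mono (fun j => ⟨c j, hc0 j, hc j⟩) (hsub i hi) (hf0 i)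
          (hf i hi)

lemma nextEigenvalue_le {K : Fin T.num} (hL : ∀ i, T.y i ∈ T.region K → L i < (B i).n)
    {i : Fin T.numVert} (hi : T.y i ∈ T.region K) :
    T.nextEigenvalue B L K hL ≤ (B i).lam ⟨L i, hL i hi⟩ :=
  ciInf_le (Set.finite_range fun i : {i // T.y i ∈ T.region K} =>
    (B i.1).lam ⟨L i.1, hL i.1 i.2⟩).bddBelow ⟨i, hi⟩

/-- The infimum of an empty family of reals is `0` by convention, so positivity forces `K` to have a
coarse vertex. Hence `K` is contained in its neighborhood. -/
lemma exists_mem_region {K : Fin T.num} {hL : ∀ i, T.y i ∈ T.region K → L i < (B i).n}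
    (h : 0 < T.nextEigenvalue B L K hL) : ∃ i, T.y i ∈ T.region K := by
  by_contra! hcon
  have : IsEmpty {i // T.y i ∈ T.region K} := ⟨fun i => hcon i.1 i.2⟩
  rw [nextEigenvalue, Real.iInf_of_isEmpty] at h
  exact h.false

lemma setIntegral_le_elemNbhd (hκ : M.IsCoefficient κ) {K : Fin T.num} {S : Set (Fin M.num)}
    (hS : S ⊆ ⋃ i ∈ {i | T.y i ∈ T.region K}, T.nbhdElems i) (hv : v ∈ M.space₀ k univ) :
    (∫ x in M.region S, κ x * ‖gradient v x‖ ^ 2) ≤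
      ∫ x in T.elemNbhd K, κ x * ‖gradient v x‖ ^ 2 := by
  rw [elemNbhd_eq]
  exact FineMesh.setIntegral_region_mono hκ hS (fun x => sq_nonneg _)
    fun j _ => (hv.1.2.2 j (mem_univ j)).2.2.1

lemma setIntegral_localError_le (hκ : M.IsCoefficient κ) (hv : v ∈ M.space₀ k univ)
    {K : Fin T.num} {hL : ∀ i, T.y i ∈ T.region K → L i < (B i).n}
    (hpos : 0 < T.nextEigenvalue B L K hL) {i : Fin T.numVert} (hi : T.y i ∈ T.region K) :
    (∫ x in T.nbhd i, κ x * localError B L v i x ^ 2) ≤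
        1 / T.nextEigenvalue B L K hL * ∫ x in T.elemNbhd K, κ x * ‖gradient v x‖ ^ 2 ∧
      (∫ x in T.nbhd i, κ x * ‖gradient (localError B L v i) x‖ ^ 2) ≤
        ∫ x in T.elemNbhd K, κ x * ‖gradient v x‖ ^ 2 := by
  obtain ⟨h1, h2⟩ := localError_bounds hκ hv i (hL i hi)
  have h3 : (∫ x in T.nbhd i, κ x * ‖gradient v x‖ ^ 2) ≤
      ∫ x in T.elemNbhd K, κ x * ‖gradient v x‖ ^ 2 :=
    setIntegral_le_elemNbhd hκ (subset_biUnion_of_mem (u := fun i => T.nbhdElems i) hi) hv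
  refine ⟨?_, h2.trans h3⟩
  have h4 : 0 ≤ ∫ x in T.nbhd i, κ x * localError B L v i x ^ 2 := by
    refine integral_nonneg_of_ae (FineMesh.ae_region fun j _ x hx => ?_)
    obtain ⟨c, hc0, hc⟩ := hκ j
    rw [Pi.zero_apply]
    simp only [hc x hx]
    positivity
  rw [one_div_mul_eq_div, le_div_iff₀ hpos, mul_comm]
  exact ((mul_le_mul_of_nonneg_right (nextEigenvalue_le hL hi) h4).trans h1).trans h3

end CoarseMesh

end SpectralCoarse

/-! ### Proof of the main theorem -/

theorem mainTheorem1 (k : ℕ) (hk : 1 ≤ k) (γ : ℝ) (hγ : 0 < γ) (m : ℕ) (Cχ : ℝ) :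
    ∃ C : ℝ, 0 < C ∧
      ∀ (M : SpectralCoarse.FineMesh) (_ : ∀ j, (M.elem j).IsShapeRegular γ)
        (κ : SpectralCoarse.Plane → ℝ) (_ : M.IsCoefficient κ)
        (T : SpectralCoarse.CoarseMesh M)
        (H : ℝ) (_ : 0 < H)
        (χ : Fin T.numVert → SpectralCoarse.Plane → ℝ) (_ : T.IsPartitionOfUnity k Cχ H χ)
        (B : T.LocalEigenbases k κ) (L : Fin T.numVert → ℕ)
        (K : Fin T.num) (_ : {i | T.y i ∈ T.region K}.ncard ≤ m)
        (hL : ∀ i, T.y i ∈ T.region K → L i < (B i).n)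
        (_ : 0 < T.nextEigenvalue B L K hL)
        (v : SpectralCoarse.Plane → ℝ) (_ : v ∈ M.space₀ k Set.univ)
        (u : SpectralCoarse.Plane → ℝ) (_ : T.IsCoarseInterpolant χ B L v u),
        (∫ x in T.region K, κ x * (v x - u x) ^ 2) ≤
            C * (1 / T.nextEigenvalue B L K hL) *
              ∫ x in T.elemNbhd K, κ x * ‖gradient v x‖ ^ 2 ∧
        (∫ x in T.region K, κ x * ‖gradient u x‖ ^ 2) ≤
            C * max 1 (1 / (H ^ 2 * T.nextEigenvalue B L K hL)) *
              ∫ x in T.elemNbhd K, κ x * ‖gradient v x‖ ^ 2 := by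
  obtain ⟨C₁, hC₁, hint⟩ := SpectralCoarse.Element.exists_interpolant_bound hk hγ
  obtain ⟨C₂, hC₂, hgrad⟩ := SpectralCoarse.Element.exists_interpolant_energy_bound hk hγ m
  -- One constant for both estimates: `C₁ * m` serves the first, the last bracket the second, and
  -- `1` guarantees positivity.
  refine ⟨1 + C₁ * m + (2 + 2 * (C₂ * (m * (1 + Cχ ^ 2)))), by positivity, ?_⟩
  intro M hM κ hκ T H hH χ hχ B L K hm hL hpos v hv u hu
  set s : Finset (Fin T.numVert) := (Set.toFinite {i | T.y i ∈ T.region K}).toFinset with hsdef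
  have hs : ∀ i, i ∈ s ↔ T.y i ∈ T.region K := fun i => by
    rw [hsdef, Set.Finite.mem_toFinset, Set.mem_ofPred_eq]
  have hcard : s.card ≤ m := by
    rwa [hsdef, ← Set.ncard_eq_toFinset_card]
  have hcard' : (s.card : ℝ) ≤ m := by exact_mod_cast hcard
  obtain ⟨i₀, hi₀⟩ := SpectralCoarse.CoarseMesh.exists_mem_region hpos
  have hKE : (∫ x in T.region K, κ x * ‖gradient v x‖ ^ 2) ≤
      ∫ x in T.elemNbhd K, κ x * ‖gradient v x‖ ^ 2 :=
    SpectralCoarse.CoarseMesh.setIntegral_le_elemNbhd hκ (fun j hj =>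
      Set.mem_biUnion (x := i₀) hi₀ (SpectralCoarse.CoarseMesh.mem_nbhdElems hi₀ hj)) hv
  have herr := fun i (hi : i ∈ s) =>
    SpectralCoarse.CoarseMesh.setIntegral_localError_le hκ hv hpos ((hs i).1 hi)
  have hvm : ∀ j, v ∈ (M.elem j).localSpace k := fun j => hv.1.2.2 j (Set.mem_univ j)
  have hum : ∀ j, u ∈ (M.elem j).localSpace k := hu.mem
  have hzm : ∀ j, v - u ∈ (M.elem j).localSpace k := fun j =>
    ((M.elem j).localSubmodule k).sub_mem (hvm j) (hum j)
  have hwm : ∀ i, ∀ j ∈ T.nbhdElems i,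
      SpectralCoarse.CoarseMesh.localError B L v i ∈ (M.elem j).localSpace k := fun i =>
    SpectralCoarse.CoarseMesh.localError_mem hv i
  have hwK : ∀ j ∈ T.elems K, ∀ i ∈ s,
      SpectralCoarse.CoarseMesh.localError B L v i ∈ (M.elem j).localSpace k := fun j hj i hi =>
    hwm i j (SpectralCoarse.CoarseMesh.mem_nbhdElems ((hs i).1 hi) hj)
  have hχm : ∀ j i, χ i ∈ (M.elem j).localSpace k := fun j i => (hχ.mem i).2.2 j (Set.mem_univ j)
  have hχ0 : ∀ j, ∀ i ∈ s, ∀ x ∈ (M.elem j).carrier, 0 ≤ χ i x := fun j i _ x hx =>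
    hχ.nonneg i x (SpectralCoarse.FineMesh.carrier_subset_region (Set.mem_univ j) hx)
  have hχ1 : ∀ j ∈ T.elems K, ∀ x ∈ (M.elem j).carrier, ∑ i ∈ s, χ i x = 1 := by
    intro j hj x hx
    rw [← hχ.sum_eq_one x (SpectralCoarse.FineMesh.carrier_subset_region (Set.mem_univ j) hx)]
    exact Finset.sum_subset (Finset.subset_univ s) fun i _ hi =>
      hχ.eq_zero (fun h => hi ((hs i).2 h)) hj x hx
  have hdof := fun j (hj : j ∈ T.elems K) => hu.sameDofs hχ hv hs hj
  set lam := T.nextEigenvalue B L K hL with hlam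
  set E := ∫ x in T.elemNbhd K, κ x * ‖gradient v x‖ ^ 2 with hE
  have hE0 : 0 ≤ E := by
    rw [hE, SpectralCoarse.CoarseMesh.elemNbhd_eq]
    refine integral_nonneg_of_ae (SpectralCoarse.FineMesh.ae_region fun j _ x hx => ?_)
    obtain ⟨c, hc0, hc⟩ := hκ j
    rw [Pi.zero_apply]
    simp only [hc x hx]
    positivity
  have hwsq : ∀ i ∈ s, ∀ j ∈ T.nbhdElems i, IntegrableOn
      (fun x => SpectralCoarse.CoarseMesh.localError B L v i x ^ 2) (interior (M.elem j).carrier) := fun i _ j hj =>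
    SpectralCoarse.Element.integrableOn_interior ((hwm i j hj).1.pow 2)
  constructor
  · have h1 := SpectralCoarse.CoarseMesh.setIntegral_region_le_sum_nbhd hκ (fun i hi => (hs i).1 hi) hC₁
      (g := fun x => (v x - u x) ^ 2) (f := fun i x => SpectralCoarse.CoarseMesh.localError B L v i x ^ 2)
      (fun j _ => SpectralCoarse.Element.integrableOn_interior ((hzm j).1.pow 2)) hwsq
      (fun i x => sq_nonneg _)
      (fun j hj => (hint (M.elem j) (hM j) s χ (SpectralCoarse.CoarseMesh.localError B L v) (v - u)
        (fun i _ => (hχm j i).1) (hχ0 j) (hχ1 j hj) (hwK j hj) (hzm j) (hdof j hj)).1)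
    have h2 : ∑ i ∈ s, (∫ x in T.nbhd i, κ x * SpectralCoarse.CoarseMesh.localError B L v i x ^ 2) ≤
        m * (1 / lam * E) := by
      refine (Finset.sum_le_card_nsmul s _ _ fun i hi => (herr i hi).1).trans ?_
      rw [nsmul_eq_mul]
      gcongr
    have h3 : C₁ * (m * (1 / lam * E)) = C₁ * m * (1 / lam) * E := by ring
    have h4 : 0 ≤ (1 + (2 + 2 * (C₂ * (m * (1 + Cχ ^ 2))))) * (1 / lam) * E := by positivity
    have h5 := h1.trans (mul_le_mul_of_nonneg_left h2 hC₁)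
    linarith
  · have hwg : ∀ i, ∀ j ∈ T.nbhdElems i, IntegrableOn
        (fun x => ‖gradient (SpectralCoarse.CoarseMesh.localError B L v i) x‖ ^ 2)
        (interior (M.elem j).carrier) := fun i j hj => (hwm i j hj).2.2.1
    -- The energy bound is used with `R = Cχ / H`. The `L²` part of the local error then contributes
    -- `Cχ² / (H² λ)`, the gradient part a constant.
    have h1 := SpectralCoarse.CoarseMesh.setIntegral_region_le_sum_nbhd hκ (fun i hi => (hs i).1 hi) hC₂
      (g := fun x => ‖gradient (v - u) x‖ ^ 2)
      (f := fun i x => ‖gradient (SpectralCoarse.CoarseMesh.localError B L v i) x‖ ^ 2 +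
        (Cχ / H) ^ 2 * SpectralCoarse.CoarseMesh.localError B L v i x ^ 2)
      (fun j _ => (hzm j).2.2.1)
      (fun i hi j hj => (hwg i j hj).add ((hwsq i hi j hj).const_mul _))
      (fun i x => by positivity)
      (fun j hj => by
        refine (hgrad (M.elem j) (hM j) s χ (SpectralCoarse.CoarseMesh.localError B L v) (v - u) (Cχ / H) hcard
          (fun i _ => hχm j i) (fun i _ => hχ.gradient_le i j) (hχ0 j) (hχ1 j hj) (hwK j hj)
          (hzm j) (hdof j hj)).trans_eq ?_
        rw [Finset.mul_sum, ← Finset.sum_add_distrib]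
        congr 1
        refine Finset.sum_congr rfl fun i hi => ?_
        have hjn := SpectralCoarse.CoarseMesh.mem_nbhdElems ((hs i).1 hi) hj
        rw [integral_add (hwg i j hjn) ((hwsq i hi j hjn).const_mul _), integral_const_mul])
    have h2 : ∑ i ∈ s, (∫ x in T.nbhd i, κ x *
        (‖gradient (SpectralCoarse.CoarseMesh.localError B L v i) x‖ ^ 2 +
          (Cχ / H) ^ 2 * SpectralCoarse.CoarseMesh.localError B L v i x ^ 2)) ≤
        m * (E + (Cχ / H) ^ 2 * (1 / lam * E)) := by
      refine (Finset.sum_le_card_nsmul s _ (E + (Cχ / H) ^ 2 * (1 / lam * E)) fun i hi => ?_).trans ?_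
      · have h3 : IntegrableOn (fun x => κ x *
            ‖gradient (SpectralCoarse.CoarseMesh.localError B L v i) x‖ ^ 2) (T.nbhd i) :=
          SpectralCoarse.FineMesh.integrableOn_coefficient_mul hκ (hwg i)
        have h4 : IntegrableOn (fun x => (Cχ / H) ^ 2 *
            (κ x * SpectralCoarse.CoarseMesh.localError B L v i x ^ 2)) (T.nbhd i) :=
          (SpectralCoarse.FineMesh.integrableOn_coefficient_mul hκ (hwsq i hi)).const_mul _
        have h5 : (fun x => κ x * (‖gradient (SpectralCoarse.CoarseMesh.localError B L v i) x‖ ^ 2 +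
            (Cχ / H) ^ 2 * SpectralCoarse.CoarseMesh.localError B L v i x ^ 2)) = fun x =>
            κ x * ‖gradient (SpectralCoarse.CoarseMesh.localError B L v i) x‖ ^ 2 +
              (Cχ / H) ^ 2 * (κ x * SpectralCoarse.CoarseMesh.localError B L v i x ^ 2) := by
          funext x; ring
        rw [h5, integral_add h3 h4, integral_const_mul]
        exact add_le_add (herr i hi).2 (mul_le_mul_of_nonneg_left (herr i hi).1 (sq_nonneg _))
      · rw [nsmul_eq_mul]
        gcongr
    have hz := h1.trans (mul_le_mul_of_nonneg_left h2 hC₂)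
    have hiv : IntegrableOn (fun x => κ x * ‖gradient v x‖ ^ 2) (T.region K) :=
      SpectralCoarse.FineMesh.integrableOn_coefficient_mul hκ fun j _ => (hvm j).2.2.1
    have hiz : IntegrableOn (fun x => κ x * ‖gradient (v - u) x‖ ^ 2) (T.region K) :=
      SpectralCoarse.FineMesh.integrableOn_coefficient_mul hκ fun j _ => (hzm j).2.2.1
    have hiu : IntegrableOn (fun x => κ x * ‖gradient u x‖ ^ 2) (T.region K) :=
      SpectralCoarse.FineMesh.integrableOn_coefficient_mul hκ fun j _ => (hum j).2.2.1
    -- The gradient of `I_0 v` is estimated through `u = v - (v - u)`, since the representation by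
    -- local errors is available for `v - u` only.
    have hu2 : (∫ x in T.region K, κ x * ‖gradient u x‖ ^ 2) ≤
        ∫ x in T.region K, (2 * (κ x * ‖gradient v x‖ ^ 2) +
          2 * (κ x * ‖gradient (v - u) x‖ ^ 2)) := by
      refine integral_mono_ae hiu ((hiv.const_mul 2).add (hiz.const_mul 2))
        (SpectralCoarse.FineMesh.ae_region fun j _ x hx => ?_)
      obtain ⟨c, hc0, hc⟩ := hκ j
      have hg : gradient v x = gradient u x + gradient (v - u) x := by
        rw [← SpectralCoarse.gradient_add_apply (SpectralCoarse.Element.differentiableAt_of_mem (hum j) hx)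
          (SpectralCoarse.Element.differentiableAt_of_mem (hzm j) hx), add_sub_cancel]
      have hg' : gradient u x = gradient v x + -gradient (v - u) x := by
        rw [hg]; abel
      have h6 := SpectralCoarse.norm_add_sq_le_two (gradient v x) (-gradient (v - u) x)
      rw [← hg', norm_neg] at h6
      have h7 := mul_le_mul_of_nonneg_left h6 hc0.le
      simp only [hc x hx]
      linarith
    rw [integral_add (hiv.const_mul 2) (hiz.const_mul 2), integral_const_mul,
      integral_const_mul] at hu2
    have hH : (Cχ / H) ^ 2 * (1 / lam * E) = Cχ ^ 2 * (1 / (H ^ 2 * lam)) * E := by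
      field_simp
    rw [hH] at hz
    set μ := max 1 (1 / (H ^ 2 * lam)) with hμ
    have hμ1 : 1 ≤ μ := le_max_left _ _
    have hμ2 : 1 / (H ^ 2 * lam) ≤ μ := le_max_right _ _
    have h8 : C₂ * (m * (E + Cχ ^ 2 * (1 / (H ^ 2 * lam)) * E)) ≤
        C₂ * (m * (μ * E + Cχ ^ 2 * μ * E)) := by
      have : E ≤ μ * E := le_mul_of_one_le_left hE0 hμ1
      gcongr
    have h9 : E ≤ μ * E := le_mul_of_one_le_left hE0 hμ1
    have h10 : 0 ≤ (1 + C₁ * m) * (μ * E) := by positivity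
    linarith
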